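/- Let $T>0$ and let $\sigma_1:[0,T]\to\mathbb C$ be a function of bounded variation which is continuous from the right at every $t\in(0,T)$ and satisfies $H_1:=\sigma_1(0+)-\sigma_1(0)\neq 0$. Put $U_1(y):=\int_0^T y(t)\,d\sigma_1(t)$ (the Stieltjes integral over $[0,T]$, including the mass $H_1$ at $t=0$). For complex-valued functions $p\in AC[0,T]$ and $q\in L(0,T)$ consider the differential pencil $$y''(x)+\bigl(\lambda^2-2\lambda p(x)-q(x)\bigr)y(x)=0,\qquad x\in(0,T),\qquad (1)$$ where a solution is a function $y$ with $y'$ absolutely continuous on $[0,T]$ that satisfies (1) almost everywhere. Let $X_1(x,\lambda),X_2(x,\lambda)$ be the solutions of (1) with $X_1(0,\lambda)=X_2'(0,\lambda)=1$, $X_1'(0,\lambda)=X_2(0,\lambda)=0$. Let $L_1(p,q)$ be the boundary value problem for (1) with the conditions $U_1(y)=0$, $y(T)=0$, and $L_{11}(p,q)$ the one with the conditions $U_1(y)=0$, $y'(T)=0$. A number $\lambda\in\mathbb C$ is an eigenvalue of such a problem if (1) has a nontrivial solution that satisfies both conditions; its multiplicity is its order as a zero of the characteristic function $$\Delta_1(\lambda)=U_1(X_1)X_2(T,\lambda)-U_1(X_2)X_1(T,\lambda),\qquad\text{respectively}\qquad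 \Delta_{11}(\lambda)=U_1(X_1)X_2'(T,\lambda)-U_1(X_2)X_1'(T,\lambda).$$ Let $(p,q)$ and $(\tilde p,\tilde q)$ be two pairs with $p,\tilde p\in AC[0,T]$ and $q,\tilde q\in L(0,T)$, complex-valued, such that $\int_0^T p(x)\,dx=\int_0^T\tilde p(x)\,dx$. If $L_1(p,q)$ and $L_1(\tilde p,\tilde q)$ have the same eigenvalues with the same multiplicities, and $L_{11}(p,q)$ and $L_{11}(\tilde p,\tilde q)$ have the same eigenvalues with the same multiplicities, then $p(x)=\tilde p(x)$ for all $x\in(0,T)$ and $q(x)=\tilde q(x)$ for almost every $x\in(0,T)$. -/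

import Mathlib

open Set Filter Topology MeasureTheory

/-- `(y, z)` is a solution on `[0, T]` of the pencil equation
`y'' + (μ ^ 2 - 2 μ p(x) - q(x)) y = 0`, in the usual sense for an integrable coefficient `q`:
`y` is differentiable on `[0, T]` (one-sidedly at the end points) with derivative `z = y'`,
the function `y'` is absolutely continuous on `[0, T]`, and the equation holds almost everywhere. -/
structure PencilSolution (T : ℝ) (p q : ℝ → ℂ) (μ : ℂ) (y z : ℝ → ℂ) : Prop where
  hasDeriv : ∀ x ∈ Icc 0 T, HasDerivWithinAt y (z x) (Icc 0 T) x
  absCont : AbsolutelyContinuousOnInterval z 0 T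
  equation : ∀ᵐ x ∂(volume.restrict (Ioo 0 T)),
    HasDerivAt z (-((μ ^ 2 - 2 * μ * p x - q x) * y x)) x

/-- The solution `(y, y')` of the pencil equation with the initial data `y(0) = a`, `y'(0) = b`
(unique on `[0, T]`). -/
noncomputable def initialSolution (T : ℝ) (p q : ℝ → ℂ) (μ a b : ℂ) : (ℝ → ℂ) × (ℝ → ℂ) :=
  Classical.epsilon fun Y => PencilSolution T p q μ Y.1 Y.2 ∧ Y.1 0 = a ∧ Y.2 0 = b

/-- A function of bounded variation on `[0, T]`, viewed as a function on the ordered space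
`[0, T]`, is of bounded variation there. -/
theorem BoundedVariationOn.restrict_Icc {T : ℝ} {σ : ℝ → ℂ}
    (hσ : BoundedVariationOn σ (Icc 0 T)) :
    BoundedVariationOn ((Icc (0 : ℝ) T).domRestrict σ) univ := by
  refine ne_top_of_le_ne_top hσ ?_
  exact eVariationOn.comp_le_of_monotoneOn σ (φ := ((↑) : Icc (0 : ℝ) T → ℝ))
    (fun _ _ _ _ h => h) (fun x _ => x.2)

/-- Closed intervals of the ordered space `[0, T]` are compact. -/
instance compactIccSpace_Icc_zero (T : ℝ) : CompactIccSpace (Icc (0 : ℝ) T) :=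
  ⟨fun {_ _} => isClosed_Icc.isCompact⟩

/-- The Stieltjes integral `U(y) = ∫_0^T y(t) dσ(t)` over the closed interval `[0, T]` for a
complex-valued function `σ` of bounded variation. The measure `dσ` lives on the space `[0, T]`;
its mass at the point `0` is `σ(0+) - σ(0)`. -/
noncomputable def stieltjesForm {T : ℝ} {σ : ℝ → ℂ} (hσ : BoundedVariationOn σ (Icc 0 T))
    (y : ℝ → ℂ) : ℂ :=
  VectorMeasure.integral hσ.restrict_Icc.vectorMeasure (fun t : Icc (0 : ℝ) T => y t)
    (ContinuousLinearMap.mul ℝ ℂ)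

/-- `μ` is an eigenvalue of the pencil with the two conditions `U(y) = 0` and `V(y, y') = 0`:
there is a nontrivial solution that satisfies both. -/
def IsPencilEigenvalue (T : ℝ) (p q : ℝ → ℂ) (U : (ℝ → ℂ) → ℂ)
    (V : (ℝ → ℂ) × (ℝ → ℂ) → ℂ) (μ : ℂ) : Prop :=
  ∃ y z : ℝ → ℂ, PencilSolution T p q μ y z ∧ (∃ x ∈ Icc 0 T, y x ≠ 0) ∧
    U y = 0 ∧ V (y, z) = 0

/-- The characteristic function `Δ(μ) = det [U(X_k), V(X_k)]_{k = 1, 2}`, where `X_1`, `X_2` are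
the solutions with `X_1(0) = X_2'(0) = 1` and `X_1'(0) = X_2(0) = 0`. -/
noncomputable def characteristicFunction (T : ℝ) (p q : ℝ → ℂ) (U : (ℝ → ℂ) → ℂ)
    (V : (ℝ → ℂ) × (ℝ → ℂ) → ℂ) (μ : ℂ) : ℂ :=
  Matrix.det !![U (initialSolution T p q μ 1 0).1, V (initialSolution T p q μ 1 0);
                U (initialSolution T p q μ 0 1).1, V (initialSolution T p q μ 0 1)]

open Classical in
/-- The spectrum of the problem `U(y) = V(y, y') = 0`, counted with multiplicities, as the function
that assigns to `μ` its multiplicity: `0` if `μ` is not an eigenvalue, and the order of `μ` as a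
zero of the characteristic function if it is. -/
noncomputable def spectrumMultiplicity (T : ℝ) (p q : ℝ → ℂ) (U : (ℝ → ℂ) → ℂ)
    (V : (ℝ → ℂ) × (ℝ → ℂ) → ℂ) (μ : ℂ) : ℕ∞ :=
  if IsPencilEigenvalue T p q U V μ then
    analyticOrderAt (characteristicFunction T p q U V) μ
  else 0

/-! ### Absolutely continuous functions on `[0, T]` -/

/-! Let `G(t, x)` (`cauchyKernel`) be the solution in `x` with `y(t) = 0`, `y'(t) = 1`, and put
`θ_a(x) = ∫_{t ≤ a} G(t, x) dσ₁(t)` (`cauchyTransform`). For fixed `a` this is a solution in `x`,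
and `θ_T(T)`, `θ_T'(T)` are the two characteristic functions.

The spectra determine both functions. As `G(t, a)` grows like `e^{|Im μ| (a - t)}`, the mass `H₁ ≠
0` at `t = 0` dominates: `μ θ_a(a) e^{iΦ}` tends to `i H₁ / 2` as `Im μ → +∞`, where `Φ = μ a -
∫_0^a p`; the lower half-plane is similar. At `a = T` this depends on `p` only through `∫_0^T p`.
The quotient of two characteristic functions with the same zeros is entire, zero-free, of
exponential type, and tends to `1` as `Im μ → ±∞`. By Phragmén–Lindelöf and Liouville it is `1`
(`IsExpType.eq_of_analyticOrderAt_eq`).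

The functions `θ_a(a)`, `θ_a'(a)` determine the coefficients on `(a/2, a)`. Let a tilde mark the
second pencil and suppose these functions agree for both. Then `θ_a(x)` and its counterpart come
from the same Cauchy data at `a`, and eliminating `θ_a'(a)` gives `θ_a(a) F = θ_a(x) G̃(x, a) - G(x,
a) θ̃_a(x)` with `F = ∂G · G̃ - G · ∂G̃`, where `∂` is the derivative in the second variable. For
`a/2 ≤ x ≤ a` the growth of the right side is that of `e^{|Im μ| a} / |μ|²`, so the entire function
`F` of exponential type tends to `0` in both directions and vanishes (`cauchyKernel_cross_eq_zero`).
Hence the quotients of the fundamental solutions normalized at `a` agree on `[a/2, a]`; the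
Wronskian forces the solutions themselves to agree, and with them the coefficients
(`PencilSolution.pencilCoeff_ae_eq`).

If the coefficients agree on `(a, T)`, the part `t > a` of the integrals can be removed and the
Cauchy data carried from `T` back to `a` (`cauchyTransform_eq_of_ae_eq`). So the halving can be
repeated with `a = T / 2^n`, and these intervals exhaust `(0, T)`. -/

theorem AbsolutelyContinuousOnInterval.of_dist_le {X Y : Type*} [PseudoMetricSpace X]
    [PseudoMetricSpace Y] {f : ℝ → X} {g : ℝ → Y} {a b : ℝ}
    (hf : AbsolutelyContinuousOnInterval f a b)
    (h : ∀ x y, dist (g x) (g y) ≤ dist (f x) (f y)) :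
    AbsolutelyContinuousOnInterval g a b := by
  refine squeeze_zero (fun E => Finset.sum_nonneg fun i _ => dist_nonneg) (fun E => ?_) hf
  exact Finset.sum_le_sum fun i _ => h _ _

theorem AbsolutelyContinuousOnInterval.complex_re {f : ℝ → ℂ} {a b : ℝ}
    (hf : AbsolutelyContinuousOnInterval f a b) :
    AbsolutelyContinuousOnInterval (fun x => (f x).re) a b :=
  hf.of_dist_le fun x y => by
    rw [Real.dist_eq, dist_eq_norm, ← Complex.sub_re]
    exact Complex.abs_re_le_norm _

theorem AbsolutelyContinuousOnInterval.complex_im {f : ℝ → ℂ} {a b : ℝ}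
    (hf : AbsolutelyContinuousOnInterval f a b) :
    AbsolutelyContinuousOnInterval (fun x => (f x).im) a b :=
  hf.of_dist_le fun x y => by
    rw [Real.dist_eq, dist_eq_norm, ← Complex.sub_im]
    exact Complex.abs_im_le_norm _

theorem AbsolutelyContinuousOnInterval.congr {f g : ℝ → ℂ} {a b : ℝ}
    (hf : AbsolutelyContinuousOnInterval f a b) (h : EqOn f g (uIcc a b)) :
    AbsolutelyContinuousOnInterval g a b := by
  rw [absolutelyContinuousOnInterval_iff] at hf ⊢
  intro ε hε
  obtain ⟨δ, hδ, H⟩ := hf ε hε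
  refine ⟨δ, hδ, fun E hE hlt => ?_⟩
  refine lt_of_eq_of_lt (Finset.sum_congr rfl fun i hi => ?_) (H E hE hlt)
  rw [h (hE.1 i hi).1, h (hE.1 i hi).2]

theorem AbsolutelyContinuousOnInterval.of_re_im {f : ℝ → ℂ} {a b : ℝ}
    (hr : AbsolutelyContinuousOnInterval (fun x => (f x).re) a b)
    (hi : AbsolutelyContinuousOnInterval (fun x => (f x).im) a b) :
    AbsolutelyContinuousOnInterval f a b := by
  have h1 : AbsolutelyContinuousOnInterval (fun x => ((f x).re : ℂ)) a b :=
    hr.of_dist_le fun x y => by simp [dist_eq_norm, ← Complex.ofReal_sub, Real.norm_eq_abs]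
  have h2 : AbsolutelyContinuousOnInterval (fun x => ((f x).im : ℂ)) a b :=
    hi.of_dist_le fun x y => by simp [dist_eq_norm, ← Complex.ofReal_sub, Real.norm_eq_abs]
  refine (h1.add (h2.const_smul Complex.I)).congr fun x _ => ?_
  simp [mul_comm Complex.I, Complex.re_add_im]

theorem intervalIntegrable_re {f : ℝ → ℂ} {a b : ℝ} (h : IntervalIntegrable f volume a b) :
    IntervalIntegrable (fun x => (f x).re) volume a b := by
  rw [intervalIntegrable_iff] at h ⊢
  exact h.re

theorem intervalIntegrable_im {f : ℝ → ℂ} {a b : ℝ} (h : IntervalIntegrable f volume a b) :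
    IntervalIntegrable (fun x => (f x).im) volume a b := by
  rw [intervalIntegrable_iff] at h ⊢
  exact h.im

theorem IntervalIntegrable.absolutelyContinuousOnInterval_integral_complex {f : ℝ → ℂ} {a b : ℝ}
    (h : IntervalIntegrable f volume a b) :
    AbsolutelyContinuousOnInterval (fun x => ∫ s in a..x, f s) a b := by
  have hsub : ∀ x ∈ uIcc a b, IntervalIntegrable f volume a x := fun x hx =>
    h.mono_set (uIcc_subset_uIcc_left hx)
  have key : AbsolutelyContinuousOnInterval
      (fun x => (((∫ s in a..x, (f s).re : ℝ) : ℂ) + ((∫ s in a..x, (f s).im : ℝ) : ℂ) * Complex.I))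
      a b := by
    refine .of_re_im ?_ ?_
    · simpa using
        (intervalIntegrable_re h).absolutelyContinuousOnInterval_intervalIntegral left_mem_uIcc
    · simpa using
        (intervalIntegrable_im h).absolutelyContinuousOnInterval_intervalIntegral left_mem_uIcc
  refine key.congr fun x hx => ?_
  have h1 := Complex.reCLM.intervalIntegral_comp_comm (hsub x hx)
  have h2 := Complex.imCLM.intervalIntegral_comp_comm (hsub x hx)
  simp only [Complex.reCLM_apply, Complex.imCLM_apply] at h1 h2
  simp only [h1, h2, Complex.re_add_im]

/-- `f` is absolutely continuous on `[0, T]` with integrable almost everywhere derivative `f'`. -/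
structure HasACDeriv (T : ℝ) (f f' : ℝ → ℂ) : Prop where
  ac : AbsolutelyContinuousOnInterval f 0 T
  int : IntervalIntegrable f' volume 0 T
  ae : ∀ᵐ x ∂(volume.restrict (Ioo 0 T)), HasDerivAt f (f' x) x

namespace HasACDeriv

variable {T : ℝ} {f f' g g' : ℝ → ℂ}

theorem continuousOn (hT : 0 < T) (hf : HasACDeriv T f f') : ContinuousOn f (Icc 0 T) := by
  simpa [uIcc_of_le hT.le] using hf.ac.continuousOn

theorem of_integral (hT : 0 < T) (hf : IntervalIntegrable f' volume 0 T) (c : ℂ) :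
    HasACDeriv T (fun x => c + ∫ s in (0 : ℝ)..x, f' s) f' := by
  refine ⟨?_, hf, ?_⟩
  · refine AbsolutelyContinuousOnInterval.of_dist_le
      hf.absolutelyContinuousOnInterval_integral_complex fun x y => ?_
    simp
  · rw [ae_restrict_iff' measurableSet_Ioo]
    filter_upwards [hf.ae_hasDerivAt_integral] with x hx hxT
    rw [uIcc_of_le hT.le] at hx
    exact (hx (Ioo_subset_Icc_self hxT) 0 ⟨le_rfl, hT.le⟩).const_add c

/-- The difference of `f` and the primitive of `f'` is absolutely continuous with derivative zero
almost everywhere, hence constant. -/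
theorem eq_integral (hT : 0 < T) (hf : HasACDeriv T f f') {s t : ℝ} (hs : s ∈ Icc 0 T)
    (ht : t ∈ Icc 0 T) : f t = f s + ∫ x in s..t, f' x := by
  have h1 := of_integral hT hf.int 0
  have h2 : AbsolutelyContinuousOnInterval (fun x => f x - (0 + ∫ s in (0 : ℝ)..x, f' s)) 0 T :=
    hf.ac.sub h1.ac
  have hae := hf.ae
  have hae1 := h1.ae
  rw [ae_restrict_iff' measurableSet_Ioo] at hae hae1
  have h0 : ∀ᵐ x : ℝ, x ≠ 0 := by simp [ae_iff, measure_singleton]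
  have hT' : ∀ᵐ x : ℝ, x ≠ T := by simp [ae_iff, measure_singleton]
  obtain ⟨C, hC⟩ := h2.const_of_ae_hasDerivAt_zero (by
    filter_upwards [hae, hae1, h0, hT'] with x hx hx1 hx0 hxT hxm
    rw [uIcc_of_le hT.le] at hxm
    have hm : x ∈ Ioo 0 T := ⟨lt_of_le_of_ne hxm.1 (Ne.symm hx0), lt_of_le_of_ne hxm.2 hxT⟩
    have := (hx hm).sub (hx1 hm)
    rw [sub_self] at this
    exact this)
  rw [uIcc_of_le hT.le] at hC
  have e1 := hC s hs
  have e2 := hC t ht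
  have hsub : ∀ x ∈ Icc 0 T, IntervalIntegrable f' volume 0 x := fun x hx =>
    hf.int.mono_set (uIcc_subset_uIcc_left (by rwa [uIcc_of_le hT.le]))
  rw [← intervalIntegral.integral_interval_sub_left (hsub t ht) (hsub s hs)]
  linear_combination e2 - e1

theorem mul (hf : HasACDeriv T f f') (hg : HasACDeriv T g g') :
    HasACDeriv T (fun x => f x * g x) (fun x => f' x * g x + f x * g' x) := by
  refine ⟨?_, ?_, ?_⟩
  · have := hf.ac.smul hg.ac
    exact this
  · refine (hf.int.mul_continuousOn hg.ac.continuousOn).add ?_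
    exact hg.int.continuousOn_mul hf.ac.continuousOn
  · filter_upwards [hf.ae, hg.ae] with x h1 h2 using h1.mul h2

theorem add (hf : HasACDeriv T f f') (hg : HasACDeriv T g g') :
    HasACDeriv T (fun x => f x + g x) (fun x => f' x + g' x) := by
  refine ⟨hf.ac.add hg.ac, hf.int.add hg.int, ?_⟩
  filter_upwards [hf.ae, hg.ae] with x h1 h2 using h1.add h2

theorem const_mul (c : ℂ) (hf : HasACDeriv T f f') :
    HasACDeriv T (fun x => c * f x) (fun x => c * f' x) := by
  refine ⟨hf.ac.const_smul c, hf.int.const_mul c, ?_⟩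
  filter_upwards [hf.ae] with x h1 using h1.const_mul c

theorem sub (hf : HasACDeriv T f f') (hg : HasACDeriv T g g') :
    HasACDeriv T (fun x => f x - g x) (fun x => f' x - g' x) := by
  refine ⟨hf.ac.sub hg.ac, hf.int.sub hg.int, ?_⟩
  filter_upwards [hf.ae, hg.ae] with x h1 h2 using h1.sub h2

theorem const (c : ℂ) : HasACDeriv T (fun _ => c) (fun _ => 0) := by
  refine ⟨?_, by simp, ?_⟩
  · rw [absolutelyContinuousOnInterval_iff]
    intro ε hε
    exact ⟨1, one_pos, fun E _ _ => by simpa using hε⟩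
  · exact .of_forall fun x => hasDerivAt_const x c

theorem of_hasDerivWithinAt (hT : 0 < T) (hf : ∀ x ∈ Icc 0 T, HasDerivWithinAt f (f' x) (Icc 0 T) x)
    (hc : ContinuousOn f' (Icc 0 T)) : HasACDeriv T f f' := by
  have hc' : ContinuousOn f' (uIcc 0 T) := by rwa [uIcc_of_le hT.le]
  obtain ⟨C, hC⟩ := isCompact_Icc.exists_bound_of_continuousOn hc
  refine ⟨?_, hc'.intervalIntegrable, ?_⟩
  · have : LipschitzOnWith C.toNNReal f (Icc 0 T) := by
      refine (convex_Icc 0 T).lipschitzOnWith_of_nnnorm_hasDerivWithin_le hf fun x hx => ?_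
      rw [← NNReal.coe_le_coe, coe_nnnorm]
      exact (hC x hx).trans (Real.le_coe_toNNReal C)
    rw [← uIcc_of_le hT.le] at this
    exact this.absolutelyContinuousOnInterval
  · rw [ae_restrict_iff' measurableSet_Ioo]
    refine .of_forall fun x hx => ?_
    exact (hf x (Ioo_subset_Icc_self hx)).hasDerivAt (Icc_mem_nhds hx.1 hx.2)

end HasACDeriv

/-- Lebesgue's theorem, applied to the real and the imaginary part. It supplies the integrable `p'`
that enters the remainder terms of the asymptotics. -/
theorem AbsolutelyContinuousOnInterval.exists_hasACDeriv {T : ℝ} {f : ℝ → ℂ} (hT : 0 < T)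
    (hf : AbsolutelyContinuousOnInterval f 0 T) : ∃ f', HasACDeriv T f f' := by
  refine ⟨fun x => ((deriv (fun x => (f x).re) x : ℝ) : ℂ) +
    ((deriv (fun x => (f x).im) x : ℝ) : ℂ) * Complex.I, hf, ?_, ?_⟩
  · have h1 := hf.complex_re.intervalIntegrable_deriv
    have h2 := hf.complex_im.intervalIntegrable_deriv
    rw [intervalIntegrable_iff] at h1 h2 ⊢
    exact h1.ofReal.add (h2.ofReal.mul_const _)
  · rw [ae_restrict_iff' measurableSet_Ioo]
    filter_upwards [hf.complex_re.ae_differentiableAt, hf.complex_im.ae_differentiableAt]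
      with x h1 h2 hx
    rw [uIcc_of_le hT.le] at h1 h2
    have e1 := (h1 (Ioo_subset_Icc_self hx)).hasDerivAt.ofReal_comp
    have e2 := (h2 (Ioo_subset_Icc_self hx)).hasDerivAt.ofReal_comp
    have := e1.add (e2.mul_const Complex.I)
    refine this.congr_of_eventuallyEq (.of_forall fun y => ?_)
    simp [Complex.re_add_im]

/-! ### The primitive operators and existence of solutions -/

/-- The operator `y ↦ ∫_0^x g y` on `C([0, T])`. -/
noncomputable def primitiveOp {T : ℝ} (hT : 0 ≤ T) (g : ℝ → ℂ)
    (hg : IntervalIntegrable g volume 0 T) : C(Icc (0 : ℝ) T, ℂ) →L[ℂ] C(Icc (0 : ℝ) T, ℂ) :=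
  have hint : ∀ y : C(Icc (0 : ℝ) T, ℂ),
      IntervalIntegrable (fun s => g s * IccExtend hT y s) volume 0 T := fun y =>
    hg.mul_continuousOn (y.continuous.Icc_extend' (h := hT)).continuousOn
  have hint' : ∀ (y : C(Icc (0 : ℝ) T, ℂ)) (x : Icc (0 : ℝ) T),
      IntervalIntegrable (fun s => g s * IccExtend hT y s) volume 0 x := fun y x =>
    (hint y).mono_set (uIcc_subset_uIcc_left (by rw [uIcc_of_le hT]; exact x.2))
  LinearMap.mkContinuous
    { toFun := fun y => ⟨fun x => ∫ s in (0 : ℝ)..x, g s * IccExtend hT y s, by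
        have h := intervalIntegral.continuousOn_primitive_interval' (hint y) left_mem_uIcc
        rw [uIcc_of_le hT] at h
        exact continuousOn_iff_continuous_domRestrict.1 h⟩
      map_add' := fun y z => by
        ext x
        change ∫ s in (0 : ℝ)..x, g s * IccExtend hT (y + z) s =
          (∫ s in (0 : ℝ)..x, g s * IccExtend hT y s) + ∫ s in (0 : ℝ)..x, g s * IccExtend hT z s
        rw [← intervalIntegral.integral_add (hint' y x) (hint' z x)]
        congr 1
        ext s
        simp [IccExtend, mul_add]
      map_smul' := fun c y => by
        ext x
        change ∫ s in (0 : ℝ)..x, g s * IccExtend hT (c • y) s =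
          c * ∫ s in (0 : ℝ)..x, g s * IccExtend hT y s
        rw [← intervalIntegral.integral_const_mul]
        congr 1
        ext s
        simp [IccExtend]
        ring }
    (∫ s in (0 : ℝ)..T, ‖g s‖) (fun y => by
      have h0 : 0 ≤ ∫ s in (0 : ℝ)..T, ‖g s‖ :=
        intervalIntegral.integral_nonneg hT fun _ _ => norm_nonneg _
      rw [ContinuousMap.norm_le _ (by positivity)]
      intro x
      change ‖∫ s in (0 : ℝ)..x, g s * IccExtend hT y s‖ ≤ _
      calc ‖∫ s in (0 : ℝ)..x, g s * IccExtend hT y s‖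
          ≤ ∫ s in (0 : ℝ)..x, ‖g s * IccExtend hT y s‖ :=
            intervalIntegral.norm_integral_le_integral_norm x.2.1
        _ ≤ ∫ s in (0 : ℝ)..x, ‖g s‖ * ‖y‖ := by
            refine intervalIntegral.integral_mono_on x.2.1 (hint' y x).norm ?_ fun s _ => ?_
            · exact (hg.mono_set (uIcc_subset_uIcc_left
                (by rw [uIcc_of_le hT]; exact x.2))).norm.mul_const _
            · rw [norm_mul]
              exact mul_le_mul_of_nonneg_left (y.norm_coe_le_norm _) (norm_nonneg _)
        _ = (∫ s in (0 : ℝ)..x, ‖g s‖) * ‖y‖ := intervalIntegral.integral_mul_const _ _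
        _ ≤ (∫ s in (0 : ℝ)..T, ‖g s‖) * ‖y‖ := by
            refine mul_le_mul_of_nonneg_right ?_ (norm_nonneg _)
            exact intervalIntegral.integral_mono_interval le_rfl x.2.1 x.2.2
              (.of_forall fun _ => norm_nonneg _) hg.norm)

/-- Multiplication by `e^{c x}` on `C([0, T])`. -/
noncomputable def expWeight (T c : ℝ) : C(Icc (0 : ℝ) T, ℂ) →L[ℂ] C(Icc (0 : ℝ) T, ℂ) :=
  ContinuousLinearMap.mul ℂ C(Icc (0 : ℝ) T, ℂ)
    ⟨fun x => ((Real.exp (c * x) : ℝ) : ℂ), by fun_prop⟩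

theorem expWeight_apply (T c : ℝ) (y : C(Icc (0 : ℝ) T, ℂ)) (x : Icc (0 : ℝ) T) :
    expWeight T c y x = ((Real.exp (c * x) : ℝ) : ℂ) * y x := rfl

theorem expWeight_mul_neg (T c : ℝ) : expWeight T c * expWeight T (-c) = 1 := by
  ext y x
  change ((Real.exp (c * x) : ℝ) : ℂ) * (((Real.exp (-c * x) : ℝ) : ℂ) * y x) = y x
  rw [← mul_assoc, ← Complex.ofReal_mul, ← Real.exp_add]
  simp

/-- Conjugation with the weight bounds the primitive operator by `∫ |g|`, uniformly in `c`. -/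
theorem norm_conj_primitiveOp_le {T : ℝ} (hT : 0 ≤ T) (g : ℝ → ℂ)
    (hg : IntervalIntegrable g volume 0 T) {c M : ℝ} (hM : 0 ≤ M)
    (h : ∀ x ∈ Icc 0 T, ∫ s in (0 : ℝ)..x, ‖g s‖ * Real.exp (-c * (x - s)) ≤ M) :
    ‖expWeight T (-c) * primitiveOp hT g hg * expWeight T c‖ ≤ M := by
  refine ContinuousLinearMap.opNorm_le_bound _ hM fun y => ?_
  rw [ContinuousMap.norm_le _ (by positivity)]
  intro x
  have hsub : IntervalIntegrable g volume 0 x :=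
    hg.mono_set (uIcc_subset_uIcc_left (by rw [uIcc_of_le hT]; exact x.2))
  have e1 : (expWeight T (-c) * primitiveOp hT g hg * expWeight T c) y x =
      ∫ s in (0 : ℝ)..x, ((Real.exp (-c * x) : ℝ) : ℂ) *
        (g s * IccExtend hT (expWeight T c y) s) := by
    rw [intervalIntegral.integral_const_mul]
    rfl
  have e2 : ∀ s ∈ Icc (0 : ℝ) x, ‖((Real.exp (-c * x) : ℝ) : ℂ) *
        (g s * IccExtend hT (expWeight T c y) s)‖ ≤
        (‖g s‖ * Real.exp (-c * (x - s))) * ‖y‖ := by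
    intro s hs
    have hs' : s ∈ Icc 0 T := ⟨hs.1, hs.2.trans x.2.2⟩
    rw [IccExtend_of_mem hT _ hs', expWeight_apply]
    simp only [norm_mul, Complex.norm_real, Real.norm_eq_abs, Real.abs_exp]
    have := y.norm_coe_le_norm ⟨s, hs'⟩
    have e3 : Real.exp (-c * (x - s)) = Real.exp (-c * x) * Real.exp (c * s) := by
      rw [← Real.exp_add]; ring_nf
    rw [e3]
    calc _ = (‖g s‖ * (Real.exp (-c * x) * Real.exp (c * s))) * ‖y ⟨s, hs'⟩‖ := by ring
      _ ≤ _ := by gcongr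
  rw [e1]
  calc _ ≤ ∫ s in (0 : ℝ)..x, (‖g s‖ * Real.exp (-c * (x - s))) * ‖y‖ := by
        refine intervalIntegral.norm_integral_le_of_norm_le x.2.1 ?_ ?_
        · exact .of_forall fun s hs => e2 s (Ioc_subset_Icc_self hs)
        · exact (hsub.norm.mul_continuousOn (by fun_prop)).mul_const _
    _ = (∫ s in (0 : ℝ)..x, ‖g s‖ * Real.exp (-c * (x - s))) * ‖y‖ :=
        intervalIntegral.integral_mul_const _ _
    _ ≤ M * ‖y‖ := mul_le_mul_of_nonneg_right (h x x.2) (norm_nonneg _)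

theorem integral_exp_decay_le {c x : ℝ} (hc : 0 < c) :
    ∫ s in (0 : ℝ)..x, Real.exp (-c * (x - s)) ≤ 1 / c := by
  have h : ∀ s ∈ uIcc 0 x, HasDerivAt (fun s => Real.exp (-c * (x - s)) / c)
      (Real.exp (-c * (x - s))) s := by
    intro s _
    have h1 : HasDerivAt (fun s : ℝ => -c * (x - s)) c s := by
      simpa using ((hasDerivAt_id s).const_sub x).const_mul (-c)
    have := h1.exp.div_const c
    rwa [mul_div_assoc, div_self hc.ne', mul_one] at this
  rw [intervalIntegral.integral_eq_sub_of_hasDerivAt h (by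
    apply Continuous.intervalIntegrable; fun_prop)]
  simp only [sub_self, mul_zero, Real.exp_zero, sub_zero]
  have := Real.exp_pos (-c * x)
  rw [← sub_div]
  gcongr
  linarith

/-- A similarity does not affect invertibility but may shrink the norms: `V (1 + A B) W = 1 + (V A
W) (V B W)`, and the Neumann series converges on the right. -/
theorem isUnit_one_add_mul_of_conj {R : Type*} [NormedRing R] [CompleteSpace R]
    {A B V W : R} (hWV : W * V = 1) (hVW : V * W = 1) (h : ‖V * A * W‖ * ‖V * B * W‖ < 1) :
    IsUnit (1 + A * B) := by
  have e : V * (A * B) * W = (V * A * W) * (V * B * W) := by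
    calc V * (A * B) * W = V * A * 1 * B * W := by simp only [mul_one, mul_assoc]
      _ = V * A * (W * V) * B * W := by rw [hWV]
      _ = _ := by simp only [mul_assoc]
  have hAB : ‖V * (A * B) * W‖ < 1 := by
    rw [e]
    exact (norm_mul_le _ _).trans_lt h
  have hu : IsUnit (1 + V * (A * B) * W) := by
    have := isUnit_one_sub_of_norm_lt_one (x := -(V * (A * B) * W)) (by rwa [norm_neg])
    rwa [sub_neg_eq_add] at this
  have hWu : IsUnit W := ⟨⟨W, V, hWV, hVW⟩, rfl⟩
  have hVu : IsUnit V := ⟨⟨V, W, hVW, hWV⟩, rfl⟩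
  convert (hWu.mul hu).mul hVu using 1
  calc 1 + A * B = W * V + (W * V) * (A * B) * (W * V) := by rw [hWV]; simp
    _ = _ := by simp only [mul_add, add_mul, mul_one, mul_assoc]

/-- Weighted norms: after conjugation with `e^{c x}` plain integration has norm at most `1 / c`,
while the other factor stays below `∫ |g|`. A large `c` thus makes the product small without any
smallness of `g` or `T`. -/
theorem isUnit_one_add_primitiveOp_mul {T : ℝ} (hT : 0 ≤ T) (g : ℝ → ℂ)
    (hg : IntervalIntegrable g volume 0 T) :
    IsUnit (1 + primitiveOp hT (fun _ => 1) (by simp) * primitiveOp hT g hg) := by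
  set G := ∫ s in (0 : ℝ)..T, ‖g s‖ with hG
  have hG0 : 0 ≤ G := intervalIntegral.integral_nonneg hT fun _ _ => norm_nonneg _
  -- Any positive `c > G` would do; the summand `1` covers `G = 0`.
  set c := 2 * G + 1 with hc
  have hc0 : 0 < c := by positivity
  have hVW : expWeight T (-c) * expWeight T c = 1 := by
    simpa using expWeight_mul_neg T (-c)
  refine isUnit_one_add_mul_of_conj (R := C(Icc (0 : ℝ) T, ℂ) →L[ℂ] C(Icc (0 : ℝ) T, ℂ))
    (V := expWeight T (-c)) (W := expWeight T c) (expWeight_mul_neg T c) hVW ?_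
  refine (mul_le_mul (norm_conj_primitiveOp_le hT _ _ (M := 1 / c) (by positivity) fun x hx => ?_)
    (norm_conj_primitiveOp_le hT _ _ hG0 fun x hx => ?_)
    (ContinuousLinearMap.opNorm_nonneg _) (by positivity)).trans_lt ?_
  · simpa using integral_exp_decay_le (x := x) hc0
  · have hsub : IntervalIntegrable g volume 0 x :=
      hg.mono_set (uIcc_subset_uIcc_left (by rwa [uIcc_of_le hT]))
    calc ∫ s in (0 : ℝ)..x, ‖g s‖ * Real.exp (-c * (x - s)) ≤ ∫ s in (0 : ℝ)..x, ‖g s‖ := by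
          refine intervalIntegral.integral_mono_on hx.1
            (hsub.norm.mul_continuousOn (by fun_prop)) hsub.norm fun s hs => ?_
          refine mul_le_of_le_one_right (norm_nonneg _) (Real.exp_le_one_iff.2 ?_)
          nlinarith [hs.2]
      _ ≤ G := intervalIntegral.integral_mono_interval le_rfl hx.1 hx.2
              (.of_forall fun _ => norm_nonneg _) hg.norm
  · rw [one_div, inv_mul_lt_iff₀ hc0]
    linarith

/-- Inversion is holomorphic on the units of a Banach algebra, so `Y μ = S(μ)⁻¹ f` is entire. With
`A` plain integration and `B`, `C` the primitives weighted by `p`, `q`, the first equation is the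
differential equation integrated twice and `Z` is the derivative of `Y`. -/
theorem exists_differentiable_solution_quadratic_pencil {E : Type*} [NormedAddCommGroup E]
    [NormedSpace ℂ E] [CompleteSpace E] (A B C : E →L[ℂ] E) (f g : E)
    (h : ∀ μ : ℂ, IsUnit (1 + A * (μ ^ 2 • A - (2 * μ) • B - C))) :
    ∃ Y Z : ℂ → E, Differentiable ℂ Y ∧ Differentiable ℂ Z ∧ ∀ μ,
      Y μ + A (μ ^ 2 • A (Y μ) - (2 * μ) • B (Y μ) - C (Y μ)) = f ∧
      Z μ = g - (μ ^ 2 • A (Y μ) - (2 * μ) • B (Y μ) - C (Y μ)) := by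
  set S : ℂ → (E →L[ℂ] E) := fun μ => 1 + A * (μ ^ 2 • A - (2 * μ) • B - C) with hS
  have hSd : Differentiable ℂ S := by
    have h1 : Differentiable ℂ fun μ : ℂ => μ ^ 2 • A - (2 * μ) • B - C := by fun_prop
    exact (h1.const_mul A).const_add 1
  set Y : ℂ → E := fun μ => Ring.inverse (S μ) f with hY
  have hYd : Differentiable ℂ Y := fun μ =>
    ((hSd μ).inverse (h μ)).clm_apply (differentiableAt_const f)
  refine ⟨Y, fun μ => g - (μ ^ 2 • A (Y μ) - (2 * μ) • B (Y μ) - C (Y μ)), hYd, ?_, fun μ =>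
    ⟨?_, rfl⟩⟩
  · have hl : ∀ L : E →L[ℂ] E, Differentiable ℂ fun μ => L (Y μ) := fun L =>
      L.differentiable.comp hYd
    have hA := hl A
    have hB := hl B
    have hC := hl C
    fun_prop
  · have h1 : S μ * Ring.inverse (S μ) = 1 := Ring.mul_inverse_cancel _ (h μ)
    have h2 : (S μ * Ring.inverse (S μ)) f = f := by rw [h1]; rfl
    exact h2

/-- The coefficient of the pencil equation. -/
def pencilCoeff (p q : ℝ → ℂ) (μ : ℂ) (x : ℝ) : ℂ := μ ^ 2 - 2 * μ * p x - q x

theorem intervalIntegrable_pencilCoeff {T : ℝ} {p q : ℝ → ℂ} (hp : IntervalIntegrable p volume 0 T)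
    (hq : IntervalIntegrable q volume 0 T) (μ : ℂ) :
    IntervalIntegrable (pencilCoeff p q μ) volume 0 T :=
  (intervalIntegrable_const.sub (hp.const_mul _)).sub hq

theorem primitiveOp_pencilCoeff {T : ℝ} (hT : 0 ≤ T) {p q : ℝ → ℂ}
    (hp : IntervalIntegrable p volume 0 T) (hq : IntervalIntegrable q volume 0 T) (μ : ℂ) :
    μ ^ 2 • primitiveOp hT (fun _ => 1) (by simp) - (2 * μ) • primitiveOp hT p hp -
      primitiveOp hT q hq =
      primitiveOp hT (pencilCoeff p q μ) (intervalIntegrable_pencilCoeff hp hq μ) := by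
  ext y x
  have hsub : ∀ g : ℝ → ℂ, IntervalIntegrable g volume 0 T →
      IntervalIntegrable (fun s => g s * IccExtend hT y s) volume 0 x := fun g hg =>
    (hg.mul_continuousOn (y.continuous.Icc_extend' (h := hT)).continuousOn).mono_set
      (uIcc_subset_uIcc_left (by rw [uIcc_of_le hT]; exact x.2))
  change μ ^ 2 * (∫ s in (0 : ℝ)..x, 1 * IccExtend hT y s) -
    (2 * μ) * (∫ s in (0 : ℝ)..x, p s * IccExtend hT y s) -
    (∫ s in (0 : ℝ)..x, q s * IccExtend hT y s) =
    ∫ s in (0 : ℝ)..x, pencilCoeff p q μ s * IccExtend hT y s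
  rw [← intervalIntegral.integral_const_mul, ← intervalIntegral.integral_const_mul,
    ← intervalIntegral.integral_sub ((hsub _ (by simp)).const_mul _) ((hsub _ hp).const_mul _),
    ← intervalIntegral.integral_sub (((hsub _ (by simp)).const_mul _).sub
      ((hsub _ hp).const_mul _)) (hsub _ hq)]
  congr 1
  ext s
  simp only [pencilCoeff]
  ring

/-- Existence of the solutions of the pencil equation with given initial data, depending
holomorphically on the spectral parameter. -/
theorem exists_pencilSolution_family {T : ℝ} (hT : 0 < T) {p q : ℝ → ℂ}
    (hp : IntervalIntegrable p volume 0 T) (hq : IntervalIntegrable q volume 0 T) (a b : ℂ) :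
    ∃ Y Z : ℂ → C(Icc (0 : ℝ) T, ℂ), Differentiable ℂ Y ∧ Differentiable ℂ Z ∧ ∀ μ,
      PencilSolution T p q μ (IccExtend hT.le (Y μ)) (IccExtend hT.le (Z μ)) ∧
      IccExtend hT.le (Y μ) 0 = a ∧ IccExtend hT.le (Z μ) 0 = b := by
  have hm0 : (0 : ℝ) ∈ Icc 0 T := ⟨le_rfl, hT.le⟩
  obtain ⟨Y, Z, hY, hZ, h⟩ := exists_differentiable_solution_quadratic_pencil
    (primitiveOp hT.le (fun _ => 1) (by simp)) (primitiveOp hT.le p hp) (primitiveOp hT.le q hq)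
    (⟨fun x => a + b * ((x : ℝ) : ℂ), by fun_prop⟩ : C(Icc (0 : ℝ) T, ℂ))
    (⟨fun _ => b, by fun_prop⟩ : C(Icc (0 : ℝ) T, ℂ))
    (fun μ => by
      have := isUnit_one_add_primitiveOp_mul hT.le _ (intervalIntegrable_pencilCoeff hp hq μ)
      rw [← primitiveOp_pencilCoeff hT.le hp hq μ] at this
      exact this)
  refine ⟨Y, Z, hY, hZ, fun μ => ?_⟩
  obtain ⟨h1, h2⟩ := h μ
  set y := IccExtend hT.le (Y μ) with hy
  set z := IccExtend hT.le (Z μ) with hz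
  have hyc : Continuous y := (Y μ).continuous.Icc_extend'
  have hzc : Continuous z := (Z μ).continuous.Icc_extend'
  have hQ := intervalIntegrable_pencilCoeff hp hq μ
  have hQy : IntervalIntegrable (fun s => -(pencilCoeff p q μ s * y s)) volume 0 T :=
    (hQ.mul_continuousOn hyc.continuousOn).neg
  have e0 : μ ^ 2 • primitiveOp hT.le (fun _ => 1) (by simp) (Y μ) -
      (2 * μ) • primitiveOp hT.le p hp (Y μ) - primitiveOp hT.le q hq (Y μ) =
      primitiveOp hT.le (pencilCoeff p q μ) hQ (Y μ) := by
    rw [← primitiveOp_pencilCoeff hT.le hp hq μ]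
    rfl
  have ez : ∀ x ∈ Icc 0 T, z x = b + ∫ s in (0 : ℝ)..x, -(pencilCoeff p q μ s * y s) := by
    intro x hx
    rw [e0] at h2
    have := congrArg (fun u : C(Icc (0 : ℝ) T, ℂ) => u ⟨x, hx⟩) h2
    rw [hz, IccExtend_of_mem hT.le _ hx, intervalIntegral.integral_neg, ← sub_eq_add_neg]
    exact this
  -- Eliminating the coefficient between `h1` and `h2` leaves `Y + A (b - Z) = a + b x`.
  have ey : ∀ x ∈ Icc 0 T, y x = a + ∫ s in (0 : ℝ)..x, z s := by
    intro x hx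
    have e1 : Y μ + primitiveOp hT.le (fun _ => 1) (by simp)
      ((⟨fun _ => b, by fun_prop⟩ : C(Icc (0 : ℝ) T, ℂ)) - Z μ) =
      (⟨fun x => a + b * ((x : ℝ) : ℂ), by fun_prop⟩ : C(Icc (0 : ℝ) T, ℂ)) := by
      rw [← h1, h2, sub_sub_cancel]
    have e2 := congrArg (fun u : C(Icc (0 : ℝ) T, ℂ) => u ⟨x, hx⟩) e1
    have e3 : Y μ ⟨x, hx⟩ + ∫ s in (0 : ℝ)..x, 1 * (b - z s) = a + b * (x : ℂ) := e2
    have e4 : ∫ s in (0 : ℝ)..x, 1 * (b - z s) = b * (x : ℂ) - ∫ s in (0 : ℝ)..x, z s := by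
      simp only [one_mul]
      rw [intervalIntegral.integral_sub (by simp) (hzc.intervalIntegrable _ _)]
      simp [mul_comm]
    rw [hy, IccExtend_of_mem hT.le _ hx]
    linear_combination e3 - e4
  refine ⟨⟨fun x hx => ?_, ?_, ?_⟩, by simpa using ey 0 hm0, by simpa using ez 0 hm0⟩
  · have h3 : HasDerivAt (fun x => a + ∫ s in (0 : ℝ)..x, z s) (z x) x :=
      (intervalIntegral.integral_hasDerivAt_right (hzc.intervalIntegrable _ _)
        (hzc.stronglyMeasurableAtFilter _ _) hzc.continuousAt).const_add a
    exact h3.hasDerivWithinAt.congr (fun x hx => ey x hx) (ey x hx)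
  · refine (HasACDeriv.of_integral hT hQy b).ac.congr fun x hx => ?_
    rw [uIcc_of_le hT.le] at hx
    exact (ez x hx).symm
  · have h3 := (HasACDeriv.of_integral hT hQy b).ae
    rw [ae_restrict_iff' measurableSet_Ioo] at h3 ⊢
    filter_upwards [h3] with x hx hxm
    refine (hx hxm).congr_of_eventuallyEq ?_
    filter_upwards [Icc_mem_nhds hxm.1 hxm.2] with t ht using ez t ht

/-! ### Wronskians, uniqueness and the fundamental solutions -/

namespace PencilSolution

variable {T : ℝ} {p q : ℝ → ℂ} {μ : ℂ} {y z : ℝ → ℂ}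

theorem continuousOn_deriv (hT : 0 < T) (h : PencilSolution T p q μ y z) :
    ContinuousOn z (Icc 0 T) := by
  simpa [uIcc_of_le hT.le] using h.absCont.continuousOn

theorem continuousOn (h : PencilSolution T p q μ y z) : ContinuousOn y (Icc 0 T) := fun x hx =>
  (h.hasDeriv x hx).continuousWithinAt

theorem hasACDeriv (hT : 0 < T) (h : PencilSolution T p q μ y z) : HasACDeriv T y z :=
  .of_hasDerivWithinAt hT h.hasDeriv (h.continuousOn_deriv hT)

theorem hasACDeriv_deriv (hT : 0 < T) (hp : IntervalIntegrable p volume 0 T)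
    (hq : IntervalIntegrable q volume 0 T) (h : PencilSolution T p q μ y z) :
    HasACDeriv T z (fun x => -(pencilCoeff p q μ x * y x)) := by
  refine ⟨h.absCont, ?_, h.equation⟩
  refine ((intervalIntegrable_pencilCoeff hp hq μ).mul_continuousOn ?_).neg
  rw [uIcc_of_le hT.le]
  exact h.continuousOn

theorem combination (h : PencilSolution T p q μ y z) {y' z' : ℝ → ℂ}
    (h' : PencilSolution T p q μ y' z') (c d : ℂ) :
    PencilSolution T p q μ (fun x => c * y x + d * y' x) (fun x => c * z x + d * z' x) := by
  refine ⟨fun x hx => ((h.hasDeriv x hx).const_mul c).add ((h'.hasDeriv x hx).const_mul d),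
    (h.absCont.const_smul c).add (h'.absCont.const_smul d), ?_⟩
  filter_upwards [h.equation, h'.equation] with x h1 h2
  refine ((h1.const_mul c).add (h2.const_mul d)).congr_deriv ?_
  ring

/-- The mixed Wronskian of solutions of two pencils is constant where the coefficients agree. -/
theorem wronskian_eq (hT : 0 < T) {p' q' : ℝ → ℂ} {y' z' : ℝ → ℂ} {a : ℝ} (ha : 0 ≤ a)
    (hp : IntervalIntegrable p volume 0 T) (hq : IntervalIntegrable q volume 0 T)
    (hp' : IntervalIntegrable p' volume 0 T) (hq' : IntervalIntegrable q' volume 0 T)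
    (h : PencilSolution T p q μ y z) (h' : PencilSolution T p' q' μ y' z')
    (hpp : ∀ᵐ x ∂(volume.restrict (Ioo a T)), p x = p' x)
    (hqq : ∀ᵐ x ∂(volume.restrict (Ioo a T)), q x = q' x) {s t : ℝ} (hs : s ∈ Icc a T)
    (ht : t ∈ Icc a T) :
    y s * z' s - z s * y' s = y t * z' t - z t * y' t := by
  have hW := ((h.hasACDeriv hT).mul (h'.hasACDeriv_deriv hT hp' hq')).sub
    ((h.hasACDeriv_deriv hT hp hq).mul (h'.hasACDeriv hT))
  have hm : ∀ u ∈ Icc a T, u ∈ Icc 0 T := fun u hu => ⟨ha.trans hu.1, hu.2⟩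
  have key := hW.eq_integral hT (hm t ht) (hm s hs)
  rw [intervalIntegral.integral_zero_ae] at key
  · simpa using key
  · rw [ae_restrict_iff' measurableSet_Ioo] at hpp hqq
    have ha' : ∀ᵐ x : ℝ, x ≠ a := by simp [ae_iff, measure_singleton]
    have hT' : ∀ᵐ x : ℝ, x ≠ T := by simp [ae_iff, measure_singleton]
    filter_upwards [hpp, hqq, ha', hT'] with x h1 h2 hxa hxT hx
    have hx' := uIoc_subset_uIcc hx
    have hx2 : x ∈ Icc a T := (uIcc_subset_Icc ht hs) hx'
    have hx3 : x ∈ Ioo a T := ⟨lt_of_le_of_ne hx2.1 (Ne.symm hxa), lt_of_le_of_ne hx2.2 hxT⟩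
    simp only [pencilCoeff, h1 hx3, h2 hx3]
    ring

theorem wronskian_eq_self (hT : 0 < T) {y' z' : ℝ → ℂ}
    (hp : IntervalIntegrable p volume 0 T) (hq : IntervalIntegrable q volume 0 T)
    (h : PencilSolution T p q μ y z) (h' : PencilSolution T p q μ y' z') {s t : ℝ}
    (hs : s ∈ Icc 0 T) (ht : t ∈ Icc 0 T) :
    y s * z' s - z s * y' s = y t * z' t - z t * y' t :=
  wronskian_eq hT le_rfl hp hq hp hq h h' (.of_forall fun _ => rfl) (.of_forall fun _ => rfl) hs ht

end PencilSolution

theorem exists_pencilSolution {T : ℝ} (hT : 0 < T) {p q : ℝ → ℂ}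
    (hp : IntervalIntegrable p volume 0 T) (hq : IntervalIntegrable q volume 0 T) (μ a b : ℂ) :
    ∃ y z, PencilSolution T p q μ y z ∧ y 0 = a ∧ z 0 = b := by
  obtain ⟨Y, Z, -, -, h⟩ := exists_pencilSolution_family hT hp hq a b
  exact ⟨_, _, h μ⟩

theorem initialSolution_spec {T : ℝ} (hT : 0 < T) {p q : ℝ → ℂ}
    (hp : IntervalIntegrable p volume 0 T) (hq : IntervalIntegrable q volume 0 T) (μ a b : ℂ) :
    PencilSolution T p q μ (initialSolution T p q μ a b).1 (initialSolution T p q μ a b).2 ∧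
      (initialSolution T p q μ a b).1 0 = a ∧ (initialSolution T p q μ a b).2 0 = b := by
  obtain ⟨y, z, h⟩ := exists_pencilSolution hT hp hq μ a b
  exact Classical.epsilon_spec (p := fun Y : (ℝ → ℂ) × (ℝ → ℂ) =>
    PencilSolution T p q μ Y.1 Y.2 ∧ Y.1 0 = a ∧ Y.2 0 = b) ⟨(y, z), h⟩

/-- Every solution is the combination of the two fundamental ones. -/
theorem PencilSolution.eq_fundamental {T : ℝ} (hT : 0 < T) {p q : ℝ → ℂ} {μ : ℂ} {y z : ℝ → ℂ}
    (hp : IntervalIntegrable p volume 0 T) (hq : IntervalIntegrable q volume 0 T)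
    (h : PencilSolution T p q μ y z) {x : ℝ} (hx : x ∈ Icc 0 T) :
    y x = y 0 * (initialSolution T p q μ 1 0).1 x + z 0 * (initialSolution T p q μ 0 1).1 x ∧
    z x = y 0 * (initialSolution T p q μ 1 0).2 x + z 0 * (initialSolution T p q μ 0 1).2 x := by
  obtain ⟨h1, e1, e1'⟩ := initialSolution_spec hT hp hq μ 1 0
  obtain ⟨h2, e2, e2'⟩ := initialSolution_spec hT hp hq μ 0 1
  have h0 : (0 : ℝ) ∈ Icc 0 T := ⟨le_rfl, hT.le⟩
  have w12 := h1.wronskian_eq_self hT hp hq h2 hx h0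
  have w1 := h.wronskian_eq_self hT hp hq h1 hx h0
  have w2 := h.wronskian_eq_self hT hp hq h2 hx h0
  rw [e1, e1', e2, e2'] at w12
  rw [e1, e1'] at w1
  rw [e2, e2'] at w2
  constructor
  -- Cramer's rule: the Wronskians `w1`, `w2` with the fundamental solutions give the initial data
  -- of `y`, and the determinant `w12` is `1`.
  · linear_combination (-(y x)) * w12 + (initialSolution T p q μ 1 0).1 x * w2 -
      (initialSolution T p q μ 0 1).1 x * w1
  · linear_combination (-(z x)) * w12 + (initialSolution T p q μ 1 0).2 x * w2 -
      (initialSolution T p q μ 0 1).2 x * w1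

/-- Uniqueness needs no Gronwall estimate: constancy of the Wronskian already expresses every
solution by its data at `0`. -/
theorem PencilSolution.eqOn {T : ℝ} (hT : 0 < T) {p q : ℝ → ℂ} {μ : ℂ} {y z y' z' : ℝ → ℂ}
    (hp : IntervalIntegrable p volume 0 T) (hq : IntervalIntegrable q volume 0 T)
    (h : PencilSolution T p q μ y z) (h' : PencilSolution T p q μ y' z') (hy : y 0 = y' 0)
    (hz : z 0 = z' 0) : EqOn y y' (Icc 0 T) ∧ EqOn z z' (Icc 0 T) := by
  constructor <;> intro x hx
  · rw [(h.eq_fundamental hT hp hq hx).1, (h'.eq_fundamental hT hp hq hx).1, hy, hz]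
  · rw [(h.eq_fundamental hT hp hq hx).2, (h'.eq_fundamental hT hp hq hx).2, hy, hz]

/-- The initial solutions are, on `[0, T]`, holomorphic families of continuous functions. -/
theorem exists_initialSolution_family {T : ℝ} (hT : 0 < T) {p q : ℝ → ℂ}
    (hp : IntervalIntegrable p volume 0 T) (hq : IntervalIntegrable q volume 0 T) (a b : ℂ) :
    ∃ Y Z : ℂ → C(Icc (0 : ℝ) T, ℂ), Differentiable ℂ Y ∧ Differentiable ℂ Z ∧
      ∀ μ, ∀ x : Icc (0 : ℝ) T, (initialSolution T p q μ a b).1 x = Y μ x ∧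
        (initialSolution T p q μ a b).2 x = Z μ x := by
  obtain ⟨Y, Z, hY, hZ, h⟩ := exists_pencilSolution_family hT hp hq a b
  refine ⟨Y, Z, hY, hZ, fun μ x => ?_⟩
  obtain ⟨h1, e1, e2⟩ := initialSolution_spec hT hp hq μ a b
  obtain ⟨h2, e3, e4⟩ := h μ
  have := h1.eqOn hT hp hq h2 (e1.trans e3.symm) (e2.trans e4.symm)
  refine ⟨(this.1 x.2).trans ?_, (this.2 x.2).trans ?_⟩
  · simp
  · simp

/-! ### Asymptotics of solutions for large spectral parameter -/

/-- The phase `μ x - ∫_0^x p`. -/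
noncomputable def pencilPhase (p : ℝ → ℂ) (μ : ℂ) (x : ℝ) : ℂ := μ * x - ∫ s in (0 : ℝ)..x, p s

theorem hasACDeriv_exp_phase {T : ℝ} (hT : 0 < T) {p : ℝ → ℂ} (hp : ContinuousOn p (Icc 0 T))
    (μ ε : ℂ) :
    HasACDeriv T (fun x => Complex.exp (ε * pencilPhase p μ x))
      (fun x => Complex.exp (ε * pencilPhase p μ x) * (ε * (μ - p x))) := by
  have hd : ∀ x ∈ Icc 0 T, HasDerivWithinAt (pencilPhase p μ) (μ - p x) (Icc 0 T) x := by
    intro x hx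
    have h1 : HasDerivWithinAt (fun x : ℝ => μ * (x : ℂ)) μ (Icc 0 T) x := by
      simpa using ((hasDerivAt_id x).ofReal_comp.const_mul μ).hasDerivWithinAt
    have hpi : IntervalIntegrable p volume 0 x := by
      apply ContinuousOn.intervalIntegrable
      rw [uIcc_of_le hx.1]
      exact hp.mono (Icc_subset_Icc_right hx.2)
    have h2 : HasDerivWithinAt (fun x => ∫ s in (0 : ℝ)..x, p s) (p x) (Icc 0 T) x := by
      have : Fact (x ∈ Icc 0 T) := ⟨hx⟩
      exact intervalIntegral.integral_hasDerivWithinAt_right hpi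
        (hp.stronglyMeasurableAtFilter_nhdsWithin measurableSet_Icc x) (hp x hx)
    exact h1.sub h2
  have hc : ContinuousOn (pencilPhase p μ) (Icc 0 T) := fun x hx => (hd x hx).continuousWithinAt
  refine .of_hasDerivWithinAt hT (fun x hx => ((hd x hx).const_mul ε).cexp) ?_
  fun_prop

/-- The term `∫ p` of the phase changes the modulus only by a factor bounded independently of `μ`,
`s` and `x`; the exponential growth comes from `ε μ (x - s)`. -/
theorem norm_exp_phase_le {T : ℝ} {p : ℝ → ℂ} (hp : IntervalIntegrable p volume 0 T)
    {ε : ℂ} (hε : ε = Complex.I ∨ ε = -Complex.I) (μ : ℂ) {s x : ℝ} (hs : 0 ≤ s) (hsx : s ≤ x)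
    (hx : x ≤ T) :
    ‖Complex.exp (ε * (pencilPhase p μ x - pencilPhase p μ s))‖ ≤
      Real.exp (∫ u in (0 : ℝ)..T, ‖p u‖) * Real.exp ((ε * μ).re * (x - s)) := by
  have hT : 0 ≤ T := hs.trans (hsx.trans hx)
  have hsub : ∀ u, 0 ≤ u → u ≤ T → IntervalIntegrable p volume 0 u := fun u h0 h1 =>
    hp.mono_set (uIcc_subset_uIcc_left (by rw [uIcc_of_le hT]; exact ⟨h0, h1⟩))
  have e1 : pencilPhase p μ x - pencilPhase p μ s = μ * ((x - s : ℝ) : ℂ) - ∫ u in s..x, p u := by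
    rw [← intervalIntegral.integral_interval_sub_left (hsub x (hs.trans hsx) hx)
      (hsub s hs (hsx.trans hx))]
    simp only [pencilPhase]
    push_cast
    ring
  have hn : ‖ε‖ = 1 := by rcases hε with rfl | rfl <;> simp
  have e2 : ‖∫ u in s..x, p u‖ ≤ ∫ u in (0 : ℝ)..T, ‖p u‖ :=
    (intervalIntegral.norm_integral_le_integral_norm hsx).trans
      (intervalIntegral.integral_mono_interval hs hsx hx (.of_forall fun _ => norm_nonneg _)
        hp.norm)
  rw [Complex.norm_exp, ← Real.exp_add, e1]
  refine Real.exp_le_exp.2 ?_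
  rw [mul_sub, Complex.sub_re, ← mul_assoc, Complex.re_mul_ofReal]
  have e3 : -(ε * ∫ u in s..x, p u).re ≤ ‖∫ u in s..x, p u‖ := by
    have := (neg_abs_le (ε * ∫ u in s..x, p u).re)
    have h2 := Complex.abs_re_le_norm (ε * ∫ u in s..x, p u)
    rw [norm_mul, hn, one_mul] at h2
    linarith
  linarith

theorem re_mul_le_abs_im {ε : ℂ} (hε : ε = Complex.I ∨ ε = -Complex.I) (μ : ℂ) :
    (ε * μ).re ≤ |μ.im| := by
  rcases hε with rfl | rfl
  · simpa using neg_le_abs μ.im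
  · simpa using le_abs_self μ.im

/-- Variation of constants for the combinations `y' ± i (μ - p) y`. -/
theorem PencilSolution.variation_of_constants {T : ℝ} (hT : 0 < T) {p p' q : ℝ → ℂ}
    (hp : HasACDeriv T p p') (hq : IntervalIntegrable q volume 0 T) {μ : ℂ} {y z : ℝ → ℂ}
    (h : PencilSolution T p q μ y z) {ε : ℂ} (hε : ε * ε = -1) {t x : ℝ} (ht : t ∈ Icc 0 T)
    (hx : x ∈ Icc 0 T) :
    (z x + ε * (μ - p x) * y x) * Complex.exp (-ε * pencilPhase p μ x) =
      (z t + ε * (μ - p t) * y t) * Complex.exp (-ε * pencilPhase p μ t) +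
      ∫ s in t..x, Complex.exp (-ε * pencilPhase p μ s) *
        ((p s ^ 2 + q s - ε * p' s) * y s) := by
  have hpi : IntervalIntegrable p volume 0 T := hp.ac.continuousOn.intervalIntegrable
  have hy := h.hasACDeriv hT
  have hz := h.hasACDeriv_deriv hT hpi hq
  have hρ : HasACDeriv T (fun x => μ - p x) (fun x => 0 - p' x) := (HasACDeriv.const μ).sub hp
  have ha := hz.add ((hρ.mul hy).const_mul ε)
  have hE := hasACDeriv_exp_phase hT (hp.continuousOn hT) μ (-ε)
  have hb := ha.mul hE
  have := hb.eq_integral hT ht hx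
  rw [← mul_assoc, ← mul_assoc] at this
  rw [this]
  congr 1
  refine intervalIntegral.integral_congr fun s _ => ?_
  simp only [pencilCoeff]
  -- Since `μ² - 2μp = (μ - p)² - p²` and `ε² = -1`, the term `(μ - p)² y` cancels against the
  -- derivative of the exponential. What remains, `(p² + q - ε p') y`, has a coefficient free of
  -- `μ`.
  linear_combination (- Complex.exp (-ε * pencilPhase p μ s) * (μ - p s) ^ 2 * y s) * hε

/-- The same with the exponential moved to the other side. -/
theorem PencilSolution.variation_of_constants' {T : ℝ} (hT : 0 < T) {p p' q : ℝ → ℂ}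
    (hp : HasACDeriv T p p') (hq : IntervalIntegrable q volume 0 T) {μ : ℂ} {y z : ℝ → ℂ}
    (h : PencilSolution T p q μ y z) {ε : ℂ} (hε : ε * ε = -1) {t x : ℝ} (ht : t ∈ Icc 0 T)
    (hx : x ∈ Icc 0 T) :
    z x + ε * (μ - p x) * y x =
      (z t + ε * (μ - p t) * y t) *
        Complex.exp (ε * (pencilPhase p μ x - pencilPhase p μ t)) +
      ∫ s in t..x, Complex.exp (ε * (pencilPhase p μ x - pencilPhase p μ s)) *
        ((p s ^ 2 + q s - ε * p' s) * y s) := by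
  have h1 := h.variation_of_constants hT hp hq hε ht hx
  have h2 : ∀ s, Complex.exp (ε * (pencilPhase p μ x - pencilPhase p μ s)) =
      Complex.exp (ε * pencilPhase p μ x) * Complex.exp (-ε * pencilPhase p μ s) := fun s => by
    rw [← Complex.exp_add]; ring_nf
  have h3 : Complex.exp (ε * pencilPhase p μ x) * Complex.exp (-ε * pencilPhase p μ x) = 1 := by
    rw [← Complex.exp_add]; simp
  simp only [h2, mul_assoc]
  rw [intervalIntegral.integral_const_mul]
  linear_combination Complex.exp (ε * pencilPhase p μ x) * h1 - (z x + ε * (μ - p x) * y x) * h3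

theorem norm_remainder_coeff_le {p p' q : ℝ → ℂ} {ε : ℂ} (hε : ε = Complex.I ∨ ε = -Complex.I)
    (s : ℝ) : ‖p s ^ 2 + q s - ε * p' s‖ ≤ ‖p s‖ ^ 2 + ‖q s‖ + ‖p' s‖ := by
  have hn : ‖ε‖ = 1 := by rcases hε with rfl | rfl <;> simp
  calc _ ≤ ‖p s ^ 2 + q s‖ + ‖ε * p' s‖ := norm_sub_le _ _
    _ ≤ ‖p s ^ 2‖ + ‖q s‖ + ‖ε * p' s‖ := by gcongr; exact norm_add_le _ _
    _ = _ := by rw [norm_pow, norm_mul, hn, one_mul]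

/-- Uniform exponential bounds of the solutions with `y(t) = 0`, `y'(t) = 1`. -/
theorem exists_pencilSolution_bound {T : ℝ} (hT : 0 < T) {p p' q : ℝ → ℂ}
    (hp : HasACDeriv T p p') (hq : IntervalIntegrable q volume 0 T) :
    ∃ K : ℝ, 1 ≤ K ∧ ∀ μ : ℂ, K ≤ ‖μ‖ → ∀ y z, PencilSolution T p q μ y z → ∀ t ∈ Icc 0 T,
      y t = 0 → z t = 1 → ∀ x ∈ Icc t T,
        ‖y x‖ ≤ K * Real.exp (|μ.im| * (x - t)) / ‖μ‖ ∧
        ‖z x‖ ≤ K * Real.exp (|μ.im| * (x - t)) := by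
  have hpi : IntervalIntegrable p volume 0 T := hp.ac.continuousOn.intervalIntegrable
  have hpc := hp.continuousOn hT
  obtain ⟨B, hB⟩ := isCompact_Icc.exists_bound_of_continuousOn hpc
  have hB0 : 0 ≤ B := (norm_nonneg _).trans (hB 0 ⟨le_rfl, hT.le⟩)
  set K₀ := Real.exp (∫ u in (0 : ℝ)..T, ‖p u‖) with hK₀
  have hK₀1 : 1 ≤ K₀ := Real.one_le_exp
    (intervalIntegral.integral_nonneg hT.le fun _ _ => norm_nonneg _)
  set m : ℝ → ℝ := fun s => ‖p s‖ ^ 2 + ‖q s‖ + ‖p' s‖ with hm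
  have hm0 : ∀ s, 0 ≤ m s := fun s => by positivity
  have hmi : IntervalIntegrable m volume 0 T := by
    refine (IntervalIntegrable.add ?_ hq.norm).add hp.int.norm
    exact (hp.ac.continuousOn.norm.pow 2).intervalIntegrable
  set R := ∫ s in (0 : ℝ)..T, m s with hR
  have hR0 : 0 ≤ R := intervalIntegral.integral_nonneg hT.le fun s _ => hm0 s
  -- `2 B` ensures `‖μ‖ ≤ 2 ‖μ - p‖`, `4 K₀ R` lets the term with the weighted maximum `M` be
  -- absorbed, and `4 K₀` is the resulting bound for `‖μ‖ M`.
  refine ⟨4 * K₀ + 2 * B + 4 * K₀ * R, by nlinarith [mul_nonneg (zero_le_one.trans hK₀1) hR0],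
    fun μ hμ y z h t ht hyt hzt => ?_⟩
  have hK₀R : 0 ≤ K₀ * R := by positivity
  have hμ1 : 4 ≤ ‖μ‖ := by linarith
  have hμ0 : 0 < ‖μ‖ := by linarith
  have hρ : ∀ x ∈ Icc 0 T, ‖μ‖ ≤ 2 * ‖μ - p x‖ := fun x hx => by
    have h1 := norm_sub_norm_le μ (p x)
    have h2 := hB x hx
    linarith
  have hmem : ∀ x ∈ Icc t T, x ∈ Icc 0 T := fun x hx => ⟨ht.1.trans hx.1, hx.2⟩
  have hyc : ContinuousOn (fun x => ‖y x‖ * Real.exp (-|μ.im| * (x - t))) (Icc t T) :=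
    (h.continuousOn.mono (Icc_subset_Icc_left ht.1)).norm.mul (by fun_prop)
  -- The maximum `M` of `|y| e^{-|Im μ| (x - t)}` will be bounded in terms of itself through the
  -- variation of constants.
  obtain ⟨x₀, hx₀, hmax⟩ := isCompact_Icc.exists_isMaxOn ⟨t, le_rfl, ht.2⟩ hyc
  set M := ‖y x₀‖ * Real.exp (-|μ.im| * (x₀ - t)) with hM
  have hM0 : 0 ≤ M := by positivity
  have hyM : ∀ x ∈ Icc t T, ‖y x‖ ≤ M * Real.exp (|μ.im| * (x - t)) := by
    intro x hx
    have h1 : ‖y x‖ * Real.exp (-|μ.im| * (x - t)) ≤ M := hmax hx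
    calc ‖y x‖ = ‖y x‖ * Real.exp (-|μ.im| * (x - t)) * Real.exp (|μ.im| * (x - t)) := by
          rw [mul_assoc, ← Real.exp_add]; simp
      _ ≤ _ := by gcongr
  have ha : ∀ ε, ε = Complex.I ∨ ε = -Complex.I → ∀ x ∈ Icc t T,
      ‖z x + ε * (μ - p x) * y x‖ ≤ K₀ * (1 + M * R) * Real.exp (|μ.im| * (x - t)) := by
    intro ε hε x hx
    have hε2 : ε * ε = -1 := by rcases hε with rfl | rfl <;> simp
    rw [h.variation_of_constants' hT hp hq hε2 ht (hmem x hx), hyt, hzt, mul_zero, add_zero,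
      one_mul]
    have b0 : ∀ s ∈ Icc t x, ‖Complex.exp (ε * (pencilPhase p μ x - pencilPhase p μ s))‖ ≤
        K₀ * Real.exp (|μ.im| * (x - s)) := fun s hs => by
      refine (norm_exp_phase_le hpi hε μ (ht.1.trans hs.1) hs.2 hx.2).trans ?_
      gcongr
      · linarith [hs.2]
      · exact re_mul_le_abs_im hε μ
    have b1 := b0 t ⟨le_rfl, hx.1⟩
    have hmx : IntervalIntegrable m volume t x :=
      hmi.mono_set (by
        rw [uIcc_of_le hx.1, uIcc_of_le hT.le]; exact Icc_subset_Icc ht.1 hx.2)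
    have b2 : ‖∫ s in t..x, Complex.exp (ε * (pencilPhase p μ x - pencilPhase p μ s)) *
        ((p s ^ 2 + q s - ε * p' s) * y s)‖ ≤
        K₀ * (M * R) * Real.exp (|μ.im| * (x - t)) := by
      calc _ ≤ ∫ s in t..x, K₀ * M * Real.exp (|μ.im| * (x - t)) * m s := by
            refine intervalIntegral.norm_integral_le_of_norm_le hx.1 (.of_forall fun s hs => ?_)
              (hmx.const_mul _)
            have hs' : s ∈ Icc t x := Ioc_subset_Icc_self hs
            rw [norm_mul, norm_mul]
            have c1 := b0 s hs'
            have c2 := norm_remainder_coeff_le (p := p) (p' := p') (q := q) hε s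
            have c3 := hyM s ⟨hs'.1, hs'.2.trans hx.2⟩
            calc _ ≤ (K₀ * Real.exp (|μ.im| * (x - s))) *
                  (m s * (M * Real.exp (|μ.im| * (s - t)))) := by
                  gcongr
              _ = K₀ * M * (Real.exp (|μ.im| * (x - s)) * Real.exp (|μ.im| * (s - t))) * m s := by
                  ring
              _ = _ := by rw [← Real.exp_add]; ring_nf
        _ = K₀ * M * Real.exp (|μ.im| * (x - t)) * ∫ s in t..x, m s :=
            intervalIntegral.integral_const_mul _ _
        _ ≤ K₀ * M * Real.exp (|μ.im| * (x - t)) * R := by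
            gcongr
            exact intervalIntegral.integral_mono_interval ht.1 hx.1 hx.2
              (.of_forall fun _ => hm0 _) hmi
        _ = _ := by ring
    calc _ ≤ _ := norm_add_le _ _
      _ ≤ K₀ * Real.exp (|μ.im| * (x - t)) + K₀ * (M * R) * Real.exp (|μ.im| * (x - t)) :=
          add_le_add b1 b2
      _ = _ := by ring
  have hyz : ∀ x ∈ Icc t T, ‖μ‖ * ‖y x‖ ≤ 2 * (K₀ * (1 + M * R) * Real.exp (|μ.im| * (x - t))) ∧
      ‖z x‖ ≤ K₀ * (1 + M * R) * Real.exp (|μ.im| * (x - t)) := by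
    intro x hx
    -- The difference of the combinations with `ε = i` and `ε = -i` isolates `(μ - p) y`, their sum
    -- isolates `z`.
    have a1 := ha _ (.inl rfl) x hx
    have a2 := ha _ (.inr rfl) x hx
    have n1 : ‖2 * (μ - p x) * y x‖ ≤ ‖z x + Complex.I * (μ - p x) * y x‖ +
        ‖z x + -Complex.I * (μ - p x) * y x‖ := by
      calc ‖2 * (μ - p x) * y x‖ = ‖Complex.I * (2 * (μ - p x) * y x)‖ := by simp
        _ = ‖(z x + Complex.I * (μ - p x) * y x) - (z x + -Complex.I * (μ - p x) * y x)‖ := by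
            congr 1; ring
        _ ≤ _ := norm_sub_le _ _
    have n2 : ‖2 * z x‖ ≤ ‖z x + Complex.I * (μ - p x) * y x‖ +
        ‖z x + -Complex.I * (μ - p x) * y x‖ := by
      calc ‖2 * z x‖ =
          ‖(z x + Complex.I * (μ - p x) * y x) + (z x + -Complex.I * (μ - p x) * y x)‖ := by
            congr 1; ring
        _ ≤ _ := norm_add_le _ _
    rw [norm_mul, norm_mul, Complex.norm_ofNat] at n1
    rw [norm_mul, Complex.norm_ofNat] at n2
    constructor
    · calc ‖μ‖ * ‖y x‖ ≤ 2 * ‖μ - p x‖ * ‖y x‖ := by gcongr; exact hρ x (hmem x hx)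
        _ ≤ _ := by linarith
    · linarith
  have hMb : ‖μ‖ * M ≤ 2 * K₀ * (1 + M * R) := by
    have := (hyz x₀ hx₀).1
    calc ‖μ‖ * M = ‖μ‖ * ‖y x₀‖ * Real.exp (-|μ.im| * (x₀ - t)) := by rw [hM]; ring
      _ ≤ 2 * (K₀ * (1 + M * R) * Real.exp (|μ.im| * (x₀ - t))) *
          Real.exp (-|μ.im| * (x₀ - t)) := by gcongr
      _ = 2 * K₀ * (1 + M * R) * (Real.exp (|μ.im| * (x₀ - t)) *
          Real.exp (-|μ.im| * (x₀ - t))) := by ring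
      _ = _ := by rw [← Real.exp_add]; simp
  have hμR : 4 * K₀ * R ≤ ‖μ‖ := by linarith
  -- By `hμR` the term `2 K₀ R M` is at most `‖μ‖ M / 2` and moves to the left side.
  have hM2 : ‖μ‖ * M ≤ 4 * K₀ := by nlinarith
  have hMR : M * R ≤ 1 := by
    by_contra hcon
    push Not at hcon
    nlinarith [mul_le_mul_of_nonneg_right hμR hM0]
  intro x hx
  obtain ⟨h1, h2⟩ := hyz x hx
  have hE := Real.exp_pos (|μ.im| * (x - t))
  constructor
  · rw [le_div_iff₀ hμ0, mul_comm]
    calc _ ≤ _ := h1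
      _ ≤ 2 * (K₀ * (1 + 1) * Real.exp (|μ.im| * (x - t))) := by gcongr
      _ = (4 * K₀) * Real.exp (|μ.im| * (x - t)) := by ring
      _ ≤ _ := by gcongr; linarith
  · calc _ ≤ _ := h2
      _ ≤ (K₀ * (1 + 1) * Real.exp (|μ.im| * (x - t))) := by gcongr
      _ = (2 * K₀) * Real.exp (|μ.im| * (x - t)) := by ring
      _ ≤ _ := by gcongr; linarith

/-! ### The Cauchy function and its asymptotics -/

/-- The Cauchy function: the solution in `x` with the values `0`, `1` of `y`, `y'` at `t`. -/
noncomputable def cauchyKernel (T : ℝ) (p q : ℝ → ℂ) (μ : ℂ) (t x : ℝ) : ℂ :=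
  (initialSolution T p q μ 1 0).1 t * (initialSolution T p q μ 0 1).1 x -
    (initialSolution T p q μ 0 1).1 t * (initialSolution T p q μ 1 0).1 x

/-- The derivative of the Cauchy function in the second variable. -/
noncomputable def cauchyKernelDeriv (T : ℝ) (p q : ℝ → ℂ) (μ : ℂ) (t x : ℝ) : ℂ :=
  (initialSolution T p q μ 1 0).1 t * (initialSolution T p q μ 0 1).2 x -
    (initialSolution T p q μ 0 1).1 t * (initialSolution T p q μ 1 0).2 x

/-- The mixed second derivative of the Cauchy function. -/
noncomputable def cauchyKernelDeriv₂ (T : ℝ) (p q : ℝ → ℂ) (μ : ℂ) (t x : ℝ) : ℂ :=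
  (initialSolution T p q μ 1 0).2 t * (initialSolution T p q μ 0 1).2 x -
    (initialSolution T p q μ 0 1).2 t * (initialSolution T p q μ 1 0).2 x

section Kernel

variable {T : ℝ} (hT : 0 < T) {p q : ℝ → ℂ} (hp : IntervalIntegrable p volume 0 T)
  (hq : IntervalIntegrable q volume 0 T) (μ : ℂ)

include hT hp hq in
theorem initialSolution_wronskian {x : ℝ} (hx : x ∈ Icc 0 T) :
    (initialSolution T p q μ 1 0).1 x * (initialSolution T p q μ 0 1).2 x -
      (initialSolution T p q μ 1 0).2 x * (initialSolution T p q μ 0 1).1 x = 1 := by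
  obtain ⟨h1, e1, e1'⟩ := initialSolution_spec hT hp hq μ 1 0
  obtain ⟨h2, e2, e2'⟩ := initialSolution_spec hT hp hq μ 0 1
  have := h1.wronskian_eq_self hT hp hq h2 hx ⟨le_rfl, hT.le⟩
  rw [e1, e1', e2, e2'] at this
  linear_combination this

theorem cauchyKernel_self (t : ℝ) : cauchyKernel T p q μ t t = 0 := by
  simp only [cauchyKernel]; ring

theorem cauchyKernel_swap (t x : ℝ) : cauchyKernel T p q μ t x = -cauchyKernel T p q μ x t := by
  simp only [cauchyKernel]; ring

include hT hp hq in
theorem cauchyKernelDeriv_self {t : ℝ} (ht : t ∈ Icc 0 T) :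
    cauchyKernelDeriv T p q μ t t = 1 := by
  have := initialSolution_wronskian hT hp hq μ ht
  simp only [cauchyKernelDeriv]
  linear_combination this

include hT hp hq in
theorem pencilSolution_cauchyKernel (t : ℝ) :
    PencilSolution T p q μ (cauchyKernel T p q μ t) (cauchyKernelDeriv T p q μ t) := by
  have h1 := (initialSolution_spec hT hp hq μ 1 0).1
  have h2 := (initialSolution_spec hT hp hq μ 0 1).1
  have := h2.combination h1 ((initialSolution T p q μ 1 0).1 t)
    (-(initialSolution T p q μ 0 1).1 t)
  convert this using 1
  · ext x; simp only [cauchyKernel]; ring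
  · ext x; simp only [cauchyKernelDeriv]; ring

end Kernel

theorem exists_cauchyKernel_bound {T : ℝ} (hT : 0 < T) {p p' q : ℝ → ℂ}
    (hp : HasACDeriv T p p') (hq : IntervalIntegrable q volume 0 T) :
    ∃ K : ℝ, 1 ≤ K ∧ ∀ μ : ℂ, K ≤ ‖μ‖ → ∀ t ∈ Icc 0 T, ∀ x ∈ Icc t T,
        ‖cauchyKernel T p q μ t x‖ ≤ K * Real.exp (|μ.im| * (x - t)) / ‖μ‖ ∧
        ‖cauchyKernelDeriv T p q μ t x‖ ≤ K * Real.exp (|μ.im| * (x - t)) := by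
  have hpi : IntervalIntegrable p volume 0 T := hp.ac.continuousOn.intervalIntegrable
  obtain ⟨K, hK, H⟩ := exists_pencilSolution_bound hT hp hq
  exact ⟨K, hK, fun μ hμ t ht x hx => H μ hμ _ _ (pencilSolution_cauchyKernel hT hpi hq μ t) t ht
    (cauchyKernel_self μ t) (cauchyKernelDeriv_self hT hpi hq μ ht) x hx⟩

/-- The filter `comap Complex.im atTop` means `Im μ → +∞` uniformly in the real part. Limits along
it bound a function on a whole half-plane, which leaves a horizontal strip for Phragmén–Lindelöf. -/
theorem tendsto_norm_comap_im : Tendsto (fun μ : ℂ => ‖μ‖) (comap Complex.im atTop) atTop :=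
  tendsto_atTop_mono (fun μ => (le_abs_self _).trans (Complex.abs_im_le_norm μ)) tendsto_comap

/-- Variation of constants from `0`: for `ε = i` the leading term is `e^{iΦ}`, which after
multiplication by the decaying `e^{iΦ}` has size `e^{-2a Im μ}`; for `ε = -i` it is exactly `1`
after the multiplication. The a priori bound makes both remainder integrals `O(1 / ‖μ‖)`. -/
theorem exists_pencilSolution_asymptotics {T : ℝ} (hT : 0 < T) {p p' q : ℝ → ℂ}
    (hp : HasACDeriv T p p') (hq : IntervalIntegrable q volume 0 T) {a : ℝ} (ha : a ∈ Icc 0 T) :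
    ∃ K : ℝ, ∀ μ : ℂ, K ≤ ‖μ‖ → 0 ≤ μ.im → ∀ y z, PencilSolution T p q μ y z →
      y 0 = 0 → z 0 = 1 →
        ‖(z a + Complex.I * (μ - p a) * y a) * Complex.exp (Complex.I * pencilPhase p μ a)‖ ≤
          K * Real.exp (-(2 * a * μ.im)) + K / ‖μ‖ ∧
        ‖(z a - Complex.I * (μ - p a) * y a) * Complex.exp (Complex.I * pencilPhase p μ a) - 1‖ ≤
          K / ‖μ‖ := by
  have hpi : IntervalIntegrable p volume 0 T := hp.ac.continuousOn.intervalIntegrable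
  obtain ⟨K, hK, H⟩ := exists_pencilSolution_bound hT hp hq
  set K₀ := Real.exp (∫ u in (0 : ℝ)..T, ‖p u‖) with hK₀
  have hK₀1 : 1 ≤ K₀ := Real.one_le_exp
    (intervalIntegral.integral_nonneg hT.le fun _ _ => norm_nonneg _)
  set m : ℝ → ℝ := fun s => ‖p s‖ ^ 2 + ‖q s‖ + ‖p' s‖ with hm
  have hm0 : ∀ s, 0 ≤ m s := fun s => by positivity
  have hmi : IntervalIntegrable m volume 0 T := by
    refine (IntervalIntegrable.add ?_ hq.norm).add hp.int.norm
    exact (hp.ac.continuousOn.norm.pow 2).intervalIntegrable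
  set R := ∫ s in (0 : ℝ)..T, m s with hR
  have hR0 : 0 ≤ R := intervalIntegral.integral_nonneg hT.le fun s _ => hm0 s
  have h0 : (0 : ℝ) ∈ Icc 0 T := ⟨le_rfl, hT.le⟩
  have hΦ0 : ∀ μ, pencilPhase p μ 0 = 0 := fun μ => by simp [pencilPhase]
  -- `K` is the threshold of the a priori bound, `K₀²` the constant for `e^{2iΦ}`, and `K₀² K R` the
  -- one for the remainder integrals.
  refine ⟨K + K₀ ^ 2 + K₀ ^ 2 * K * R, fun μ hμ him y z h hy0 hz0 => ?_⟩
  have hc0 : 0 ≤ K₀ ^ 2 * K * R := by positivity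
  have hc1 : 1 ≤ K₀ ^ 2 := one_le_pow₀ hK₀1
  have hμK : K ≤ ‖μ‖ := by linarith
  have hμ0 : 0 < ‖μ‖ := by linarith
  have hy : ∀ s ∈ Icc 0 a, ‖y s‖ ≤ K * Real.exp (μ.im * s) / ‖μ‖ := fun s hs => by
    have := (H μ hμK y z h 0 h0 hy0 hz0 s ⟨hs.1, hs.2.trans ha.2⟩).1
    rwa [abs_of_nonneg him, sub_zero] at this
  have hE : ∀ s x, 0 ≤ s → s ≤ x → x ≤ T →
      ‖Complex.exp (Complex.I * (pencilPhase p μ x - pencilPhase p μ s))‖ ≤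
      K₀ * Real.exp (-(μ.im * (x - s))) := fun s x hs hsx hx => by
    have := norm_exp_phase_le hpi (.inl rfl) μ hs hsx hx
    simpa using this
  have hE0 : ∀ x ∈ Icc 0 T, ‖Complex.exp (Complex.I * pencilPhase p μ x)‖ ≤
      K₀ * Real.exp (-(μ.im * x)) := fun x hx => by
    have := hE 0 x le_rfl hx.1 hx.2
    rwa [hΦ0, sub_zero, sub_zero] at this
  have hint : ∀ f : ℝ → ℂ, (∀ s ∈ Icc 0 a, ‖f s‖ ≤ K₀ ^ 2 * K / ‖μ‖ * m s) →
      ‖∫ s in (0 : ℝ)..a, f s‖ ≤ K₀ ^ 2 * K * R / ‖μ‖ := by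
    intro f hf
    have hma : IntervalIntegrable m volume 0 a :=
      hmi.mono_set (uIcc_subset_uIcc_left (by rwa [uIcc_of_le hT.le]))
    calc _ ≤ ∫ s in (0 : ℝ)..a, K₀ ^ 2 * K / ‖μ‖ * m s :=
          intervalIntegral.norm_integral_le_of_norm_le ha.1
            (.of_forall fun s hs => hf s (Ioc_subset_Icc_self hs)) (hma.const_mul _)
      _ = K₀ ^ 2 * K / ‖μ‖ * ∫ s in (0 : ℝ)..a, m s := intervalIntegral.integral_const_mul _ _
      _ ≤ K₀ ^ 2 * K / ‖μ‖ * R := by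
          gcongr
          exact intervalIntegral.integral_mono_interval le_rfl ha.1 ha.2
            (.of_forall fun _ => hm0 _) hmi
      _ = _ := by ring
  constructor
  · have e := h.variation_of_constants' hT hp hq Complex.I_mul_I h0 ha
    rw [hy0, hz0, hΦ0, mul_zero, add_zero, one_mul, sub_zero] at e
    rw [e, add_mul, ← intervalIntegral.integral_mul_const]
    refine (norm_add_le _ _).trans (add_le_add ?_ ?_)
    · rw [norm_mul]
      calc _ ≤ (K₀ * Real.exp (-(μ.im * a))) * (K₀ * Real.exp (-(μ.im * a))) :=
            mul_le_mul (hE0 a ha) (hE0 a ha) (norm_nonneg _) (by positivity)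
        _ = K₀ ^ 2 * (Real.exp (-(μ.im * a)) * Real.exp (-(μ.im * a))) := by ring
        _ = K₀ ^ 2 * Real.exp (-(2 * a * μ.im)) := by rw [← Real.exp_add]; ring_nf
        _ ≤ _ := by gcongr; linarith
    · refine (hint _ fun s hs => ?_).trans (by gcongr; linarith)
      rw [norm_mul, norm_mul, norm_mul]
      calc _ ≤ (K₀ * Real.exp (-(μ.im * (a - s)))) *
            (m s * (K * Real.exp (μ.im * s) / ‖μ‖)) * (K₀ * Real.exp (-(μ.im * a))) := by
            gcongr
            · exact hE s a hs.1 hs.2 ha.2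
            · exact norm_remainder_coeff_le (.inl rfl) s
            · exact hy s hs
            · exact hE0 a ha
        _ = K₀ ^ 2 * K / ‖μ‖ * m s * (Real.exp (-(μ.im * (a - s))) * Real.exp (μ.im * s) *
            Real.exp (-(μ.im * a))) := by ring
        _ = K₀ ^ 2 * K / ‖μ‖ * m s * Real.exp (-(2 * (μ.im * (a - s)))) := by
            rw [← Real.exp_add, ← Real.exp_add]; ring_nf
        _ ≤ _ := by
            refine mul_le_of_le_one_right (mul_nonneg (by positivity) (hm0 s))
              (Real.exp_le_one_iff.2 ?_)
            have := mul_nonneg him (sub_nonneg.2 hs.2)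
            linarith
  · have e := h.variation_of_constants hT hp hq (ε := -Complex.I) (by simp) h0 ha
    rw [hy0, hz0, hΦ0, mul_zero, add_zero, mul_zero, Complex.exp_zero, neg_neg, mul_one] at e
    have e' : (z a - Complex.I * (μ - p a) * y a) * Complex.exp (Complex.I * pencilPhase p μ a) - 1
        = ∫ s in (0 : ℝ)..a, Complex.exp (Complex.I * pencilPhase p μ s) *
          ((p s ^ 2 + q s - -Complex.I * p' s) * y s) := by
      linear_combination e
    rw [e']
    refine (hint _ fun s hs => ?_).trans (by gcongr; linarith)
    rw [norm_mul, norm_mul]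
    calc _ ≤ (K₀ * Real.exp (-(μ.im * s))) * (m s * (K * Real.exp (μ.im * s) / ‖μ‖)) := by
            gcongr
            · exact hE0 s ⟨hs.1, hs.2.trans ha.2⟩
            · exact norm_remainder_coeff_le (.inr rfl) s
            · exact hy s hs
      _ = K₀ * K / ‖μ‖ * m s * (Real.exp (-(μ.im * s)) * Real.exp (μ.im * s)) := by ring
      _ = K₀ * K / ‖μ‖ * m s := by rw [← Real.exp_add]; simp
      _ ≤ _ := by
          gcongr
          nlinarith

/-- Half the sum and the difference of the two combinations above. The condition `a > 0` makes
`e^{-2a Im μ}` vanish in the limit. -/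
theorem tendsto_cauchyKernel_zero {T : ℝ} (hT : 0 < T) {p p' q : ℝ → ℂ}
    (hp : HasACDeriv T p p') (hq : IntervalIntegrable q volume 0 T) {a : ℝ} (ha : a ∈ Ioc 0 T) :
    Tendsto (fun μ => μ * cauchyKernel T p q μ 0 a * Complex.exp (Complex.I * pencilPhase p μ a))
      (comap Complex.im atTop) (𝓝 (Complex.I / 2)) ∧
    Tendsto (fun μ => cauchyKernelDeriv T p q μ 0 a * Complex.exp (Complex.I * pencilPhase p μ a))
      (comap Complex.im atTop) (𝓝 (1 / 2)) := by
  have hpi : IntervalIntegrable p volume 0 T := hp.ac.continuousOn.intervalIntegrable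
  obtain ⟨K, H⟩ := exists_pencilSolution_asymptotics hT hp hq (Ioc_subset_Icc_self ha)
  set y := fun μ => cauchyKernel T p q μ 0 a
  set z := fun μ => cauchyKernelDeriv T p q μ 0 a
  set e := fun μ => Complex.exp (Complex.I * pencilPhase p μ a)
  have hH : ∀ᶠ μ in comap Complex.im atTop,
      ‖(z μ + Complex.I * (μ - p a) * y μ) * e μ‖ ≤
          K * Real.exp (-(2 * a * μ.im)) + K / ‖μ‖ ∧
        ‖(z μ - Complex.I * (μ - p a) * y μ) * e μ - 1‖ ≤ K / ‖μ‖ := by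
    filter_upwards [tendsto_norm_comap_im.eventually_ge_atTop K,
      tendsto_comap.eventually_ge_atTop 0] with μ h1 h2
    exact H μ h1 h2 _ _ (pencilSolution_cauchyKernel hT hpi hq μ 0) (cauchyKernel_self μ 0)
      (cauchyKernelDeriv_self hT hpi hq μ ⟨le_rfl, hT.le⟩)
  have l1 : Tendsto (fun μ : ℂ => K / ‖μ‖) (comap Complex.im atTop) (𝓝 0) :=
    tendsto_norm_comap_im.const_div_atTop K
  have l2 : Tendsto (fun μ : ℂ => K * Real.exp (-(2 * a * μ.im))) (comap Complex.im atTop)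
      (𝓝 0) := by
    have : Tendsto (fun μ : ℂ => 2 * a * μ.im) (comap Complex.im atTop) atTop :=
      tendsto_comap.const_mul_atTop (by linarith [ha.1])
    simpa using (Real.tendsto_exp_neg_atTop_nhds_zero.comp this).const_mul K
  have A : Tendsto (fun μ => (z μ + Complex.I * (μ - p a) * y μ) * e μ) (comap Complex.im atTop)
      (𝓝 0) := by
    refine squeeze_zero_norm' (hH.mono fun μ h => h.1) ?_
    simpa using l2.add l1
  have B : Tendsto (fun μ => (z μ - Complex.I * (μ - p a) * y μ) * e μ) (comap Complex.im atTop)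
      (𝓝 1) := by
    rw [← tendsto_sub_nhds_zero_iff]
    exact squeeze_zero_norm' (hH.mono fun μ h => h.2) l1
  have hinv : Tendsto (fun μ : ℂ => (μ - p a)⁻¹) (comap Complex.im atTop) (𝓝 0) := by
    refine tendsto_inv₀_cobounded.comp ?_
    refine tendsto_norm_atTop_iff_cobounded.1 ?_
    refine tendsto_atTop_mono (fun μ => norm_sub_norm_le μ (p a)) ?_
    exact tendsto_atTop_add_const_right _ _ tendsto_norm_comap_im
  have hne : ∀ᶠ μ in comap Complex.im atTop, μ - p a ≠ 0 := by
    filter_upwards [tendsto_norm_comap_im.eventually_gt_atTop ‖p a‖] with μ h1 h2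
    rw [sub_eq_zero.1 h2] at h1
    exact lt_irrefl _ h1
  constructor
  -- The difference is `2i (μ - p(a)) y`; the factor `1 + p(a) / (μ - p(a)) = μ / (μ - p(a))`, which
  -- tends to `1`, replaces `μ - p(a)` by `μ`.
  · have h1 := ((A.sub B).mul (((hinv.const_mul (p a)).const_add 1).const_mul (-Complex.I / 2)))
    have h2 : (0 - 1) * (-Complex.I / 2 * (1 + p a * 0)) = Complex.I / 2 := by ring
    rw [h2] at h1
    refine h1.congr' ?_
    filter_upwards [hne] with μ hμ
    field_simp
    ring_nf
    simp only [Complex.I_sq]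
    ring
  · have h1 := (A.add B).mul_const (1 / 2)
    have h2 : ((0 : ℂ) + 1) * (1 / 2) = 1 / 2 := by ring
    rw [h2] at h1
    refine h1.congr fun μ => ?_
    ring

/-! ### The Stieltjes form as an integral with a density -/

/-- A complex measure has an integrable density with respect to a finite measure. -/
theorem MeasureTheory.ComplexMeasure.exists_eq_withDensity {X : Type*} [MeasurableSpace X]
    (c : ComplexMeasure X) : ∃ (ν : Measure X) (_ : IsFiniteMeasure ν) (w : X → ℂ),
      Integrable w ν ∧ ν.withDensityᵥ w = c := by
  -- This measure dominates the real and the imaginary part, so both have densities by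
  -- Radon–Nikodym.
  set ν := (ComplexMeasure.re c).totalVariation + (ComplexMeasure.im c).totalVariation with hν
  refine ⟨ν, inferInstance, c.rnDeriv ν, c.integrable_rnDeriv ν, ?_⟩
  have hac : ∀ s : SignedMeasure X, s.totalVariation ≤ ν → ν.withDensityᵥ (s.rnDeriv ν) = s := by
    intro s hs
    refine SignedMeasure.withDensityᵥ_rnDeriv_eq s ν (VectorMeasure.AbsolutelyContinuous.mk ?_)
    intro i hi hi0
    rw [Measure.toENNRealVectorMeasure_apply_measurable hi] at hi0
    have h1 : ‖s i‖ₑ ≤ 0 := (s.enorm_le_totalVariation i).trans ((hs i).trans hi0.le)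
    simpa using h1
  have hre := hac _ (Measure.le_add_right le_rfl)
  have him := hac _ (Measure.le_add_left le_rfl)
  ext i hi : 1
  rw [withDensityᵥ_apply (c.integrable_rnDeriv ν) hi]
  have e1 : (c i).re = ComplexMeasure.re c i := rfl
  have e2 : (c i).im = ComplexMeasure.im c i := rfl
  apply Complex.ext
  · rw [e1, ← RCLike.re_eq_complex_re, ← integral_re (c.integrable_rnDeriv ν).integrableOn, ← congrArg (fun s : SignedMeasure X => s i) hre]
    rw [withDensityᵥ_apply (SignedMeasure.integrable_rnDeriv _ _) hi]
    rfl
  · rw [e2, ← RCLike.im_eq_complex_im, ← integral_im (c.integrable_rnDeriv ν).integrableOn, ← congrArg (fun s : SignedMeasure X => s i) him]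
    rw [withDensityᵥ_apply (SignedMeasure.integrable_rnDeriv _ _) hi]
    rfl

/-- Both sides agree on simple functions, and dominated convergence passes to bounded functions on
either side because the variation of the vector measure is finite. -/
theorem MeasureTheory.integral_withDensityᵥ_mul {X : Type*} [MeasurableSpace X] {ν : Measure X}
    {w : X → ℂ} (hw : Integrable w ν) {f : X → ℂ} (hf : StronglyMeasurable f)
    {C : ℝ} (hC : ∀ x, ‖f x‖ ≤ C) :
    VectorMeasure.integral (ν.withDensityᵥ w) f (ContinuousLinearMap.mul ℝ ℂ) =
      ∫ x, f x * w x ∂ν := by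
  have hfin : IsFiniteMeasure (ν.withDensityᵥ w).variation := by
    rw [Measure.variation_withDensityᵥ hw]
    exact isFiniteMeasure_withDensity hw.2.ne
  rcases isEmpty_or_nonempty X with hX | ⟨⟨x₀⟩⟩
  · rw [VectorMeasure.integral_of_isEmpty, integral_of_isEmpty]
  have hC0 : 0 ≤ C := (norm_nonneg _).trans (hC x₀)
  have simple : ∀ g : SimpleFunc X ℂ,
      VectorMeasure.integral (ν.withDensityᵥ w) g (ContinuousLinearMap.mul ℝ ℂ) =
      ∫ x, g x * w x ∂ν := by
    intro g
    classical
    induction g using SimpleFunc.induction with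
    | const c hs =>
      rename_i s
      rw [SimpleFunc.coe_piecewise, SimpleFunc.coe_const, SimpleFunc.coe_const]
      have e : s.piecewise (Function.const X c) (Function.const X 0) = s.indicator fun _ => c := by
        ext x; simp [piecewise, indicator]
      rw [e, VectorMeasure.integral_indicator_const c hs, withDensityᵥ_apply hw hs]
      simp only [ContinuousLinearMap.mul_apply']
      rw [← integral_const_mul, ← integral_indicator hs]
      congr 1
      ext x
      by_cases hx : x ∈ s <;> simp [hx]
    | add hd hf hg =>
      rename_i f g
      have hint : ∀ u : SimpleFunc X ℂ, (ν.withDensityᵥ w).Integrable u := fun u =>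
        SimpleFunc.integrable_of_isFiniteMeasure u
      have hint' : ∀ u : SimpleFunc X ℂ, Integrable (fun x => u x * w x) ν := fun u => by
        obtain ⟨D, hD⟩ := u.exists_forall_norm_le
        exact hw.bdd_mul u.stronglyMeasurable.aestronglyMeasurable (.of_forall hD)
      rw [SimpleFunc.coe_add, VectorMeasure.integral_add (hint f) (hint g), hf, hg,
        ← integral_add (hint' f) (hint' g)]
      simp [add_mul]
  have l1 : Tendsto (fun n => VectorMeasure.integral (ν.withDensityᵥ w) (hf.approxBounded C n)
      (ContinuousLinearMap.mul ℝ ℂ)) atTop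
      (𝓝 (VectorMeasure.integral (ν.withDensityᵥ w) f (ContinuousLinearMap.mul ℝ ℂ))) :=
    VectorMeasure.tendsto_integral_of_dominated_convergence
    (fun _ => C) (fun n => (SimpleFunc.stronglyMeasurable _).aestronglyMeasurable)
    (integrable_const C) (fun n => .of_forall fun x => hf.norm_approxBounded_le hC0 n x)
    (.of_forall fun x => hf.tendsto_approxBounded_of_norm_le (hC x))
  have l2 : Tendsto (fun n => ∫ x, hf.approxBounded C n x * w x ∂ν) atTop
      (𝓝 (∫ x, f x * w x ∂ν)) := by
    refine tendsto_integral_of_dominated_convergence (fun x => C * ‖w x‖)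
      (fun n => (SimpleFunc.stronglyMeasurable _).aestronglyMeasurable.mul hw.1)
      (hw.norm.const_mul C) (fun n => .of_forall fun x => ?_) (.of_forall fun x => ?_)
    · rw [norm_mul]
      exact mul_le_mul_of_nonneg_right (hf.norm_approxBounded_le hC0 n x) (norm_nonneg _)
    · exact (hf.tendsto_approxBounded_of_norm_le (hC x)).mul_const _
  simp only [simple] at l1
  exact tendsto_nhds_unique l1 l2

/-- On continuous functions the Stieltjes form becomes an ordinary integral with a density, where
restriction to `t ≤ a` and dominated convergence are available. -/
theorem exists_density_stieltjesForm {T : ℝ} (hT : 0 < T) {σ : ℝ → ℂ}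
    (hσ : BoundedVariationOn σ (Icc 0 T)) {H : ℂ}
    (hH : Tendsto (fun t => σ t - σ 0) (𝓝[>] 0) (𝓝 H)) :
    ∃ (ν : Measure (Icc (0 : ℝ) T)) (_ : IsFiniteMeasure ν) (w : Icc (0 : ℝ) T → ℂ),
      Integrable w ν ∧
      (∀ y : ℝ → ℂ, ContinuousOn y (Icc 0 T) → stieltjesForm hσ y = ∫ t, y t * w t ∂ν) ∧
      ∫ t in {⟨0, le_rfl, hT.le⟩}, w t ∂ν = H := by
  obtain ⟨ν, hν, w, hw, hc⟩ := ComplexMeasure.exists_eq_withDensity hσ.restrict_Icc.vectorMeasure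
  refine ⟨ν, hν, w, hw, fun y hy => ?_, ?_⟩
  · rw [stieltjesForm, ← hc]
    obtain ⟨C, hC⟩ := isCompact_Icc.exists_bound_of_continuousOn hy
    refine integral_withDensityᵥ_mul hw ?_ (C := C) fun x => hC x x.2
    exact (continuousOn_iff_continuous_domRestrict.1 hy).stronglyMeasurable
  · rw [← withDensityᵥ_apply hw (measurableSet_singleton _), hc,
      BoundedVariationOn.vectorMeasure_singleton]
    set o : Icc (0 : ℝ) T := ⟨0, le_rfl, hT.le⟩ with ho
    have hbot : IsBot o := fun x => x.2.1
    -- At the least point the left limit is by convention the value there, so the mass is `σ(0+) -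
    -- σ(0)`.
    rw [leftLim_eq_of_isBot hbot]
    have hne : (𝓝[>] o).NeBot := by
      refine nhdsGT_neBot_of_exists_gt ⟨⟨T, hT.le, le_rfl⟩, ?_⟩
      exact hT
    have hcoe : Tendsto (fun t : Icc (0 : ℝ) T => (t : ℝ)) (𝓝[>] o) (𝓝[>] 0) := by
      refine tendsto_nhdsWithin_iff.2 ⟨?_, ?_⟩
      · exact (continuous_subtype_val.tendsto o).mono_left nhdsWithin_le_nhds
      · filter_upwards [self_mem_nhdsWithin] with t ht using ht
    have hlim : Tendsto ((Icc (0 : ℝ) T).domRestrict σ) (𝓝[>] o) (𝓝 (H + σ 0)) := by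
      have := (hH.comp hcoe).add_const (σ 0)
      refine this.congr fun t => ?_
      simp
    rw [rightLim_eq_of_tendsto hlim]
    simp [ho]

/-! ### Entire functions of exponential type -/

/-- `f` is of exponential type: `‖f z‖ ≤ exp (A + B ‖z‖)`. -/
def IsExpType (f : ℂ → ℂ) : Prop :=
  ∃ A B : ℝ, 0 ≤ A ∧ 0 ≤ B ∧ ∀ z, ‖f z‖ ≤ Real.exp (A + B * ‖z‖)

theorem IsExpType.of_eventually_le {f : ℂ → ℂ} (hf : Continuous f) {K B : ℝ} (hK : 0 ≤ K)
    (hB : 0 ≤ B) (h : ∀ z, K ≤ ‖z‖ → ‖f z‖ ≤ K * Real.exp (B * ‖z‖)) : IsExpType f := by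
  obtain ⟨M, hM⟩ := (isCompact_closedBall (0 : ℂ) K).exists_bound_of_continuousOn hf.continuousOn
  refine ⟨max M K, B, le_max_of_le_right hK, hB, fun z => ?_⟩
  have hexp : max M K ≤ Real.exp (max M K) := by linarith [Real.add_one_le_exp (max M K)]
  have h1 : (1 : ℝ) ≤ Real.exp (B * ‖z‖) := Real.one_le_exp (by positivity)
  rw [Real.exp_add]
  have key : ∀ m, m ≤ max M K → ‖f z‖ ≤ m * Real.exp (B * ‖z‖) →
      ‖f z‖ ≤ Real.exp (max M K) * Real.exp (B * ‖z‖) := fun m hm hle =>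
    hle.trans (by gcongr; exact hm.trans hexp)
  rcases le_total K ‖z‖ with hz | hz
  · exact key K (le_max_right _ _) (h z hz)
  · have hMz := hM z (by simpa using hz)
    refine key M (le_max_left _ _) (hMz.trans ?_)
    nlinarith [norm_nonneg (f z)]

instance neBot_comap_im_atTop : (comap Complex.im atTop).NeBot :=
  atTop_neBot.comap_of_surj Complex.im_surjective

/-- The limits bound `f` on two half-planes `|Im z| ≥ R`, Phragmén–Lindelöf bounds it on the strip
between them, and Liouville makes it constant. -/
theorem IsExpType.eq_of_tendsto {f : ℂ → ℂ} (hf : Differentiable ℂ f) (hexp : IsExpType f)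
    {L L' : ℂ} (hL : Tendsto f (comap Complex.im atTop) (𝓝 L))
    (hL' : Tendsto f (comap Complex.im atBot) (𝓝 L')) (z : ℂ) : f z = L := by
  have hev : ∀ {l : Filter ℂ} {L : ℂ}, Tendsto f l (𝓝 L) → ∀ᶠ z in l, ‖f z‖ ≤ ‖L‖ + 1 :=
    fun h => (h.norm.eventually (gt_mem_nhds (lt_add_one _))).mono fun _ h => le_of_lt h
  obtain ⟨R₁, hR₁⟩ := (atTop_basis.comap Complex.im).eventually_iff.1 (hev hL) |>.imp
    fun _ h => h.2
  obtain ⟨R₂, hR₂⟩ := (atBot_basis.comap Complex.im).eventually_iff.1 (hev hL') |>.imp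
    fun _ h => h.2
  set R := max (max R₁ (-R₂)) 1 with hR
  have hR1 : R₁ ≤ R := (le_max_left _ _).trans (le_max_left _ _)
  have hR2 : -R₂ ≤ R := (le_max_right _ _).trans (le_max_left _ _)
  have hRp : 1 ≤ R := le_max_right _ _
  set C := max (‖L‖ + 1) (‖L'‖ + 1) with hC
  have hup : ∀ z : ℂ, R ≤ z.im → ‖f z‖ ≤ C := fun z hz =>
    (hR₁ (show R₁ ≤ z.im from hR1.trans hz)).trans (le_max_left _ _)
  have hdown : ∀ z : ℂ, z.im ≤ -R → ‖f z‖ ≤ C := fun z hz =>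
    (hR₂ (show z.im ≤ R₂ by linarith)).trans (le_max_right _ _)
  obtain ⟨A, B, hA, hB, hAB⟩ := hexp
  have hbdd : ∀ z, ‖f z‖ ≤ C := by
    intro z
    rcases le_total R z.im with h | h
    · exact hup z h
    rcases le_total z.im (-R) with h' | h'
    · exact hdown z h'
    refine PhragmenLindelof.horizontal_strip (a := -R) (b := R) hf.diffContOnCl
      -- The strip has width `2R`, so any rate below `π / (2R)` is admissible; half of it is taken.
      -- The constant comes from `‖w‖ ≤ |Re w| + R` and `c |Re w| ≤ e^{c |Re w|}`.
      ⟨Real.pi / (4 * R), ?_, A + B * R + B / (Real.pi / (4 * R)), ?_⟩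
      (fun z hz => hdown z hz.le) (fun z hz => hup z hz.ge) h' h
    · have := Real.pi_pos
      gcongr <;> linarith
    · set c := Real.pi / (4 * R) with hc
      have hcpos : 0 < c := by have := Real.pi_pos; positivity
      refine Asymptotics.IsBigO.of_bound 1 ?_
      filter_upwards [mem_inf_of_right (mem_principal_self _)] with w hw
      have hw1 : |w.im| ≤ R := abs_le.2 ⟨hw.1.le, hw.2.le⟩
      have hwn : ‖w‖ ≤ |w.re| + R := (Complex.norm_le_abs_re_add_abs_im w).trans (by linarith)
      rw [one_mul, Real.norm_eq_abs, abs_of_pos (Real.exp_pos _)]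
      refine (hAB w).trans (Real.exp_le_exp.2 ?_)
      have e1 : 1 ≤ Real.exp (c * |w.re|) := Real.one_le_exp (by positivity)
      have e2 : c * |w.re| ≤ Real.exp (c * |w.re|) := by
        linarith [Real.add_one_le_exp (c * |w.re|)]
      calc A + B * ‖w‖ ≤ (A + B * R) * 1 + B / c * (c * |w.re|) := by
            rw [div_mul_eq_mul_div, mul_left_comm, mul_div_cancel_left₀ _ hcpos.ne']
            nlinarith
        _ ≤ (A + B * R) * Real.exp (c * |w.re|) + B / c * Real.exp (c * |w.re|) := by
            gcongr
        _ = _ := by ring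
  have hconst : ∀ w, f w = f z := fun w =>
    hf.apply_eq_apply_of_bounded (Metric.isBounded_iff_subset_closedBall 0 |>.2
      ⟨C, by rintro _ ⟨w, rfl⟩; simpa using hbdd w⟩) w z
  exact tendsto_nhds_unique ((tendsto_congr hconst).2 tendsto_const_nhds) hL

/-- Entire functions with the same zeros, counted with multiplicities, differ by a zero-free
entire factor. -/
theorem exists_entire_ne_zero_factor {f₁ f₂ : ℂ → ℂ} (h₁ : Differentiable ℂ f₁)
    (h₂ : Differentiable ℂ f₂) (hord : ∀ z, analyticOrderAt f₁ z = analyticOrderAt f₂ z)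
    {c : ℂ} (hc : f₂ c ≠ 0) :
    ∃ g : ℂ → ℂ, Differentiable ℂ g ∧ (∀ z, g z ≠ 0) ∧ ∀ z, f₁ z = g z * f₂ z := by
  have ha₁ : ∀ z, AnalyticAt ℂ f₁ z := fun z => h₁.analyticAt z
  have ha₂ : ∀ z, AnalyticAt ℂ f₂ z := fun z => h₂.analyticAt z
  have hm : MeromorphicOn (f₁ / f₂) univ := fun z _ =>
    (ha₁ z).meromorphicAt.div (ha₂ z).meromorphicAt
  have htop : ∀ z, analyticOrderAt f₂ z ≠ ⊤ := fun z hz =>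
    hc (congrFun ((AnalyticOnNhd.analyticOrderAt_eq_top_iff_eq_zero z
      ha₂).1 hz) c)
  -- The normal form corrects the values of the quotient at the common zeros; as its order is `0`
  -- everywhere, it is analytic and zero-free.
  set g := toMeromorphicNFOn (f₁ / f₂) univ with hg
  have hnf : ∀ z, MeromorphicNFAt g z := fun z =>
    meromorphicNFOn_toMeromorphicNFOn (f₁ / f₂) univ (mem_univ z)
  have hord0 : ∀ z, meromorphicOrderAt g z = 0 := by
    intro z
    rw [meromorphicOrderAt_congr (hm.toMeromorphicNFOn_eq_self_on_nhdsNE (mem_univ z)),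
      meromorphicOrderAt_div (ha₁ z).meromorphicAt (ha₂ z).meromorphicAt,
      (ha₁ z).meromorphicOrderAt_eq, (ha₂ z).meromorphicOrderAt_eq, hord]
    obtain ⟨n, hn⟩ := ENat.ne_top_iff_exists.1 (htop z)
    rw [← hn]
    simp only [ENat.map_natCast]
    norm_cast
    simp
  have hga : ∀ z, AnalyticAt ℂ g z := fun z =>
    (hnf z).meromorphicOrderAt_nonneg_iff_analyticAt.1 (hord0 z).ge
  refine ⟨g, fun z => (hga z).differentiableAt,
    fun z => (hnf z).meromorphicOrderAt_eq_zero_iff.1 (hord0 z), fun z => ?_⟩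
  have hev : f₁ =ᶠ[𝓝[≠] z] g * f₂ := by
    have hne : ∀ᶠ w in 𝓝[≠] z, f₂ w ≠ 0 := by
      rcases (ha₂ z).eventually_eq_zero_or_eventually_ne_zero with h | h
      · exact absurd (analyticOrderAt_eq_top.2 h) (htop z)
      · exact h
    filter_upwards [hm.toMeromorphicNFOn_eq_self_on_nhdsNE (mem_univ z), hne] with w hw hw'
    simp only [Pi.mul_apply, hg, hw, Pi.div_apply]
    field_simp
  exact ((ha₁ z).continuousAt.eventuallyEq_nhds_iff_eventuallyEq_nhdsNE
    ((hga z).mul (ha₂ z)).continuousAt).1 hev |>.eq_of_nhds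

/-- The quotient of two entire functions of exponential type, if it is entire and zero-free, is of
exponential type. -/
theorem IsExpType.of_mul {g f₁ f₂ : ℂ → ℂ} (hg : Differentiable ℂ g) (hg0 : ∀ z, g z ≠ 0)
    (h₂ : Differentiable ℂ f₂) (he₁ : IsExpType f₁)
    (he₂ : IsExpType f₂) (hmul : ∀ z, f₁ z = g z * f₂ z) {c : ℂ} (hc : f₂ c ≠ 0) :
    IsExpType g := by
  obtain ⟨A₁, B₁, hA₁, hB₁, hAB₁⟩ := he₁
  obtain ⟨A₂, B₂, hA₂, hB₂, hAB₂⟩ := he₂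
  set A := A₁ + A₂ with hA
  set B := B₁ + B₂ with hB
  have hA0 : 0 ≤ A := add_nonneg hA₁ hA₂
  have hB0 : 0 ≤ B := add_nonneg hB₁ hB₂
  set l := |Real.log ‖f₂ c‖| with hl
  -- the growth of the logarithm along circles
  have key : ∀ w, Real.log ‖g w‖ ≤
      3 * (2 * (A + B * (‖c‖ + (2 * ‖w - c‖ + 1))) + l) := by
    intro w
    -- With this radius the Poisson kernel at `w` is at most `3`; the summand `1` keeps the radius
    -- positive at `w = c`. The plan is to integrate `log ‖g‖ = log ‖f₁‖ - log ‖f₂‖`, which is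
    -- harmonic, against the kernel and to bound the mean of `log ‖f₂‖` from below by Jensen's
    -- formula.
    set R := 2 * ‖w - c‖ + 1 with hR
    set M := A + B * (‖c‖ + R) with hM
    have hRpos : 0 < R := by positivity
    have hM0 : 0 ≤ M := by positivity
    have habs : |R| = R := abs_of_pos hRpos
    have hwb : w ∈ Metric.ball c R := by
      rw [mem_ball_iff_norm]; linarith [norm_nonneg (w - c)]
    have hharm : InnerProductSpace.HarmonicOnNhd (fun z => Real.log ‖g z‖)
        (Metric.closedBall c R) :=
      fun z _ => (hg.analyticAt z).harmonicAt_log_norm (hg0 z)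
    have hP := hharm.circleAverage_re_herglotzRieszKernel_smul hwb
    have hlogle : ∀ z ∈ Metric.sphere c |R|, ∀ {f : ℂ → ℂ} {a b : ℝ}, a ≤ A → b ≤ B → 0 ≤ b →
        ‖f z‖ ≤ Real.exp (a + b * ‖z‖) → f z ≠ 0 → Real.log ‖f z‖ ≤ M := by
      intro z hz f a b ha hb hb0 hf hne
      have hzn : ‖z‖ ≤ ‖c‖ + R := by
        rw [habs, mem_sphere_iff_norm] at hz
        calc ‖z‖ = ‖c + (z - c)‖ := by congr 1; ring
          _ ≤ _ := (norm_add_le _ _).trans (by rw [hz])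
      rw [Real.log_le_iff_le_exp (norm_pos_iff.2 hne)]
      refine hf.trans (Real.exp_le_exp.2 ?_)
      have : b * ‖z‖ ≤ B * (‖c‖ + R) := by gcongr
      linarith
    have hcod : ∀ᶠ z in codiscreteWithin (Metric.sphere c |R|), f₂ z ≠ 0 := by
      have h := AnalyticOnNhd.preimage_zero_mem_codiscrete (fun z _ => h₂.analyticAt z) hc
      exact codiscreteWithin_mono (subset_univ _) h
    classical
    set P : ℂ → ℝ := (Complex.re ∘ herglotzRieszKernel c w) • fun z => Real.log ‖g z‖ with hPdef
    -- At zeros of `f₂` the identity for the logarithms fails, as `Real.log 0 = 0`. These points are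
    -- discrete, so replacing the integrand by `0` there leaves the average unchanged.
    set v : ℂ → ℝ := fun z => if f₂ z = 0 then 0 else P z with hv
    have hPv : P =ᶠ[codiscreteWithin (Metric.sphere c |R|)] v := by
      filter_upwards [hcod] with z hz
      simp [hv, hz]
    have hPint : CircleIntegrable P c R := by
      refine ContinuousOn.circleIntegrable' ?_
      refine ContinuousOn.smul ?_ ?_
      · exact Complex.continuous_re.comp_continuousOn (continuousOn_herglotzRieszKernel_sphere hwb)
      · exact (hg.continuous.norm.log fun z => norm_ne_zero_iff.2 (hg0 z)).continuousOn
    have hlogint : CircleIntegrable (fun z => Real.log ‖f₂ z‖) c R :=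
      MeromorphicOn.circleIntegrable_log_norm fun z _ => (h₂.analyticAt z).meromorphicAt
    have hwint : CircleIntegrable (fun z => 3 * (2 * M - Real.log ‖f₂ z‖)) c R :=
      ((circleIntegrable_const (2 * M) c R).sub hlogint).const_mul 3
    have hle : Real.circleAverage v c R ≤
        Real.circleAverage (fun z => 3 * (2 * M - Real.log ‖f₂ z‖)) c R := by
      refine Real.circleAverage_mono (hPint.congr_codiscreteWithin hPv) hwint fun z hz => ?_
      by_cases hz0 : f₂ z = 0
      · simp only [hv, hz0, if_true, norm_zero, Real.log_zero]; linarith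
      · simp only [hv, hz0, if_false]
        have hz1 : f₁ z ≠ 0 := by rw [hmul]; exact mul_ne_zero (hg0 z) hz0
        have l1 : Real.log ‖f₁ z‖ ≤ M :=
          hlogle z hz (by linarith) (by linarith) hB₁ (hAB₁ z) hz1
        have l2 : Real.log ‖f₂ z‖ ≤ M :=
          hlogle z hz (by linarith) (by linarith) hB₂ (hAB₂ z) hz0
        have l3 : Real.log ‖f₁ z‖ = Real.log ‖g z‖ + Real.log ‖f₂ z‖ := by
          rw [hmul, norm_mul, Real.log_mul (norm_ne_zero_iff.2 (hg0 z)) (norm_ne_zero_iff.2 hz0)]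
        rw [habs] at hz
        have k1 := re_herglotzRieszKernel_le hz hwb
        have k2 := le_re_herglotzRieszKernel hz hwb
        have k3 : (R + ‖w - c‖) / (R - ‖w - c‖) ≤ 3 := by
          rw [div_le_iff₀ (by linarith [norm_nonneg (w - c)])]; linarith
        have k4 : 0 ≤ (R - ‖w - c‖) / (R + ‖w - c‖) :=
          div_nonneg (by linarith [norm_nonneg (w - c)]) (by positivity)
        change ((z - c + (w - c)) / (z - c - (w - c))).re * Real.log ‖g z‖ ≤ _
        set k := ((z - c + (w - c)) / (z - c - (w - c))).re
        -- `M` in place of `2 M` would suffice for this inequality; the larger value makes the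
        -- majorant visibly nonnegative, so that the kernel can be replaced by its upper bound `3`.
        have hu : Real.log ‖g z‖ ≤ 2 * M - Real.log ‖f₂ z‖ := by linarith
        have hu0 : 0 ≤ 2 * M - Real.log ‖f₂ z‖ := by linarith
        calc k * Real.log ‖g z‖ ≤ k * (2 * M - Real.log ‖f₂ z‖) := by
              gcongr; exact k4.trans k2
          _ ≤ _ := by gcongr; exact k1.trans k3
    -- Jensen's formula: the average is `log ‖f₂ c‖` plus nonnegative contributions of the zeros in
    -- the disc.
    have hjen : -l ≤ Real.circleAverage (fun z => Real.log ‖f₂ z‖) c R := by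
      have han : AnalyticOnNhd ℂ f₂ (Metric.closedBall c |R|) := fun z _ => h₂.analyticAt z
      rw [AnalyticOnNhd.circleAverage_log_norm hRpos.ne' han hc]
      have h0 : 0 ≤ ∑ᶠ u, (MeromorphicOn.divisor f₂ (Metric.closedBall c |R|) u : ℝ) *
          Real.log (R * ‖c - u‖⁻¹) := by
        refine finsum_nonneg fun u => ?_
        by_cases hu : u ∈ Metric.closedBall c |R|
        · refine mul_nonneg (mod_cast MeromorphicOn.AnalyticOnNhd.divisor_nonneg han u) ?_
          rcases eq_or_ne u c with rfl | hne
          · simp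
          · refine Real.log_nonneg ?_
            have hpos : 0 < ‖c - u‖ := norm_pos_iff.2 (sub_ne_zero.2 hne.symm)
            rw [← div_eq_mul_inv, one_le_div hpos, norm_sub_rev]
            rwa [habs, mem_closedBall_iff_norm] at hu
        · simp [hu]
      have := neg_abs_le (Real.log ‖f₂ c‖)
      linarith
    have hav : Real.circleAverage (fun z => 3 * (2 * M - Real.log ‖f₂ z‖)) c R =
        3 * (2 * M - Real.circleAverage (fun z => Real.log ‖f₂ z‖) c R) := by
      have := Real.circleAverage_fun_smul (a := (3 : ℝ)) (c := c) (R := R)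
        (f := fun z => 2 * M - Real.log ‖f₂ z‖)
      simp only [smul_eq_mul] at this
      rw [this, Real.circleAverage_fun_sub (circleIntegrable_const _ _ _) hlogint,
        Real.circleAverage_const]
    have hPv' := Real.circleAverage_congr_codiscreteWithin hPv hRpos.ne'
    calc Real.log ‖g w‖ = Real.circleAverage v c R := by rw [← hPv']; exact hP.symm
      _ ≤ 3 * (2 * M - Real.circleAverage (fun z => Real.log ‖f₂ z‖) c R) := hav ▸ hle
      _ ≤ _ := by linarith
  refine ⟨3 * (2 * (A + B * (3 * ‖c‖ + 1)) + l), 12 * B, by positivity, by positivity,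
    fun w => ?_⟩
  rw [← Real.log_le_iff_le_exp (norm_pos_iff.2 (hg0 w))]
  have : B * ‖w - c‖ ≤ B * (‖w‖ + ‖c‖) := by gcongr; exact norm_sub_le _ _
  linarith [key w]

/-- Two entire functions of exponential type with the same zeros, counted with multiplicities,
coincide if after multiplication with the same factor they have the same nonzero limits as the
imaginary part tends to `±∞`. -/
theorem IsExpType.eq_of_analyticOrderAt_eq {f₁ f₂ : ℂ → ℂ} (h₁ : Differentiable ℂ f₁)
    (h₂ : Differentiable ℂ f₂) (he₁ : IsExpType f₁) (he₂ : IsExpType f₂)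
    (hord : ∀ z, analyticOrderAt f₁ z = analyticOrderAt f₂ z) {φ ψ : ℂ → ℂ} {L L' : ℂ}
    (hL : L ≠ 0) (hL' : L' ≠ 0)
    (hφ₁ : Tendsto (fun z => f₁ z * φ z) (comap Complex.im atTop) (𝓝 L))
    (hφ₂ : Tendsto (fun z => f₂ z * φ z) (comap Complex.im atTop) (𝓝 L))
    (hψ₁ : Tendsto (fun z => f₁ z * ψ z) (comap Complex.im atBot) (𝓝 L'))
    (hψ₂ : Tendsto (fun z => f₂ z * ψ z) (comap Complex.im atBot) (𝓝 L')) : f₁ = f₂ := by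
  obtain ⟨c, hc⟩ := (hφ₂.eventually_ne hL).exists
  have hc : f₂ c ≠ 0 := left_ne_zero_of_mul hc
  obtain ⟨g, hg, hg0, hmul⟩ := exists_entire_ne_zero_factor h₁ h₂ hord hc
  have hlim : ∀ {l : Filter ℂ} {χ : ℂ → ℂ} {K : ℂ}, K ≠ 0 →
      Tendsto (fun z => f₁ z * χ z) l (𝓝 K) → Tendsto (fun z => f₂ z * χ z) l (𝓝 K) →
      Tendsto g l (𝓝 1) := by
    intro l χ K hK t₁ t₂
    have := t₁.div t₂ hK
    rw [div_self hK] at this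
    refine this.congr' ?_
    filter_upwards [t₂.eventually_ne hK] with z hz
    simp only [Pi.div_apply, hmul, mul_assoc]
    exact mul_div_cancel_right₀ _ hz
  have hone := (IsExpType.of_mul hg hg0 h₂ he₁ he₂ hmul hc).eq_of_tendsto hg (hlim hL hφ₁ hφ₂)
    (hlim hL' hψ₁ hψ₂)
  funext z
  rw [hmul, hone, one_mul]

/-! ### The Cauchy transform, its bounds and its leading term -/

theorem ContinuousMap.integrable_mul {X : Type*} [TopologicalSpace X] [CompactSpace X]
    [MeasurableSpace X] [BorelSpace X] {ν : Measure X} {w : X → ℂ} (hw : Integrable w ν)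
    (f : C(X, ℂ)) : Integrable (fun t => f t * w t) ν :=
  hw.bdd_mul f.continuous.aestronglyMeasurable (.of_forall fun x => f.norm_coe_le_norm x)

/-- Integration against `w` is a bounded linear functional on `C(X)`, and those preserve holomorphy.
-/
theorem Differentiable.integral_continuousMap_mul {X : Type*} [TopologicalSpace X] [CompactSpace X]
    [MeasurableSpace X] [BorelSpace X] {ν : Measure X} {w : X → ℂ} (hw : Integrable w ν)
    {Y : ℂ → C(X, ℂ)} (hY : Differentiable ℂ Y) :
    Differentiable ℂ fun μ => ∫ t, Y μ t * w t ∂ν := by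
  let L : C(X, ℂ) →L[ℂ] ℂ := LinearMap.mkContinuous
    { toFun := fun f => ∫ t, f t * w t ∂ν
      map_add' := fun f g => by
        simp only [ContinuousMap.add_apply, add_mul]
        exact integral_add (f.integrable_mul hw) (g.integrable_mul hw)
      map_smul' := fun c f => by
        simp only [ContinuousMap.smul_apply, smul_eq_mul, mul_assoc, RingHom.id_apply]
        exact integral_const_mul _ _ } (∫ t, ‖w t‖ ∂ν) fun f => by
      refine (norm_integral_le_integral_norm _).trans ?_
      rw [← integral_mul_const]
      refine integral_mono (f.integrable_mul hw).norm (hw.norm.mul_const _) fun t => ?_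
      simp only [norm_mul]
      rw [mul_comm]
      gcongr
      exact f.norm_coe_le_norm t
  exact L.differentiable.comp hY

/-- The solution `∫_{t ≤ a} G(t, x) w(t) dν(t)` with the Cauchy function `G`. -/
noncomputable def cauchyTransform (T : ℝ) (p q : ℝ → ℂ) (ν : Measure (Icc (0 : ℝ) T))
    (w : Icc (0 : ℝ) T → ℂ) (a : ℝ) (μ : ℂ) (x : ℝ) : ℂ :=
  ∫ t in {t : Icc (0 : ℝ) T | (t : ℝ) ≤ a}, cauchyKernel T p q μ t x * w t ∂ν

/-- The derivative of `cauchyTransform`. -/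
noncomputable def cauchyTransformDeriv (T : ℝ) (p q : ℝ → ℂ) (ν : Measure (Icc (0 : ℝ) T))
    (w : Icc (0 : ℝ) T → ℂ) (a : ℝ) (μ : ℂ) (x : ℝ) : ℂ :=
  ∫ t in {t : Icc (0 : ℝ) T | (t : ℝ) ≤ a}, cauchyKernelDeriv T p q μ t x * w t ∂ν

theorem measurableSet_coe_le (T a : ℝ) : MeasurableSet {t : Icc (0 : ℝ) T | (t : ℝ) ≤ a} :=
  measurable_subtype_coe measurableSet_Iic

section Transform

variable {T : ℝ} (hT : 0 < T) {p p' q : ℝ → ℂ} (hp : IntervalIntegrable p volume 0 T)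
  (hp' : HasACDeriv T p p')
  (hq : IntervalIntegrable q volume 0 T) {ν : Measure (Icc (0 : ℝ) T)}
  {w : Icc (0 : ℝ) T → ℂ} (hw : Integrable w ν)

include hT hp hq in
theorem continuous_initialSolution (μ a b : ℂ) :
    Continuous (fun t : Icc (0 : ℝ) T => (initialSolution T p q μ a b).1 t) := by
  obtain ⟨Y, Z, -, -, h⟩ := exists_initialSolution_family hT hp hq a b
  exact (Y μ).continuous.congr fun t => ((h μ t).1).symm

include hT hp hq hw in
theorem integrable_initialSolution_mul (μ a b : ℂ) :
    Integrable (fun t : Icc (0 : ℝ) T => (initialSolution T p q μ a b).1 t * w t) ν :=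
  ContinuousMap.integrable_mul hw ⟨_, continuous_initialSolution hT hp hq μ a b⟩

include hT hp hq in
theorem continuous_cauchyKernel_left (μ : ℂ) (x : ℝ) :
    Continuous (fun t : Icc (0 : ℝ) T => cauchyKernel T p q μ t x) :=
  ((continuous_initialSolution hT hp hq μ 1 0).mul_const _).sub
    ((continuous_initialSolution hT hp hq μ 0 1).mul_const _)

include hT hp hq in
theorem continuous_cauchyKernelDeriv_left (μ : ℂ) (x : ℝ) :
    Continuous (fun t : Icc (0 : ℝ) T => cauchyKernelDeriv T p q μ t x) :=
  ((continuous_initialSolution hT hp hq μ 1 0).mul_const _).sub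
    ((continuous_initialSolution hT hp hq μ 0 1).mul_const _)

include hT hp hq hw in
-- The kernel is a sum of two products. This form yields the holomorphy in `μ`, the differential
-- equation in `x`, and for `a = x = T` the characteristic determinant.
theorem cauchyTransform_eq (a : ℝ) (μ : ℂ) (x : ℝ) :
    cauchyTransform T p q ν w a μ x =
      (∫ t in {t : Icc (0 : ℝ) T | (t : ℝ) ≤ a}, (initialSolution T p q μ 1 0).1 t * w t ∂ν) *
        (initialSolution T p q μ 0 1).1 x -
      (∫ t in {t : Icc (0 : ℝ) T | (t : ℝ) ≤ a}, (initialSolution T p q μ 0 1).1 t * w t ∂ν) *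
        (initialSolution T p q μ 1 0).1 x := by
  rw [← integral_mul_const, ← integral_mul_const, ← integral_sub]
  · simp only [cauchyTransform, cauchyKernel]
    congr 1; ext t; ring
  · exact ((integrable_initialSolution_mul hT hp hq hw μ 1 0).mul_const _).integrableOn
  · exact ((integrable_initialSolution_mul hT hp hq hw μ 0 1).mul_const _).integrableOn

include hT hp hq hw in
theorem cauchyTransformDeriv_eq (a : ℝ) (μ : ℂ) (x : ℝ) :
    cauchyTransformDeriv T p q ν w a μ x =
      (∫ t in {t : Icc (0 : ℝ) T | (t : ℝ) ≤ a}, (initialSolution T p q μ 1 0).1 t * w t ∂ν) *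
        (initialSolution T p q μ 0 1).2 x -
      (∫ t in {t : Icc (0 : ℝ) T | (t : ℝ) ≤ a}, (initialSolution T p q μ 0 1).1 t * w t ∂ν) *
        (initialSolution T p q μ 1 0).2 x := by
  rw [← integral_mul_const, ← integral_mul_const, ← integral_sub]
  · simp only [cauchyTransformDeriv, cauchyKernelDeriv]
    congr 1; ext t; ring
  · exact ((integrable_initialSolution_mul hT hp hq hw μ 1 0).mul_const _).integrableOn
  · exact ((integrable_initialSolution_mul hT hp hq hw μ 0 1).mul_const _).integrableOn

include hT hp hq in
theorem differentiable_initialSolution (a b : ℂ) {x : ℝ} (hx : x ∈ Icc 0 T) :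
    Differentiable ℂ (fun μ => (initialSolution T p q μ a b).1 x) ∧
      Differentiable ℂ (fun μ => (initialSolution T p q μ a b).2 x) := by
  obtain ⟨Y, Z, hY, hZ, h⟩ := exists_initialSolution_family hT hp hq a b
  let e : C(Icc (0 : ℝ) T, ℂ) →L[ℂ] ℂ := ContinuousMap.evalCLM ℂ (⟨x, hx⟩ : Icc (0 : ℝ) T)
  constructor
  · have he : (fun μ => (initialSolution T p q μ a b).1 x) = e ∘ Y :=
      funext fun μ => (h μ ⟨x, hx⟩).1
    exact he ▸ e.differentiable.comp hY
  · have he : (fun μ => (initialSolution T p q μ a b).2 x) = e ∘ Z :=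
      funext fun μ => (h μ ⟨x, hx⟩).2
    exact he ▸ e.differentiable.comp hZ

include hT hp hq hw in
theorem differentiable_integral_initialSolution (a b : ℂ) (A : Set (Icc (0 : ℝ) T)) :
    Differentiable ℂ (fun μ => ∫ t in A, (initialSolution T p q μ a b).1 t * w t ∂ν) := by
  obtain ⟨Y, Z, hY, hZ, h⟩ := exists_initialSolution_family hT hp hq a b
  convert Differentiable.integral_continuousMap_mul (hw.integrableOn (s := A)) hY using 1
  ext μ
  exact integral_congr_ae (.of_forall fun t => by simp only [(h μ t).1])

include hT hp hq hw in
theorem differentiable_cauchyTransform (a : ℝ) {x : ℝ} (hx : x ∈ Icc 0 T) :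
    Differentiable ℂ (fun μ => cauchyTransform T p q ν w a μ x) := by
  simp only [cauchyTransform_eq hT hp hq hw]
  exact ((differentiable_integral_initialSolution hT hp hq hw 1 0 _).mul
    (differentiable_initialSolution hT hp hq 0 1 hx).1).sub
    ((differentiable_integral_initialSolution hT hp hq hw 0 1 _).mul
    (differentiable_initialSolution hT hp hq 1 0 hx).1)

include hT hp hq hw in
theorem differentiable_cauchyTransformDeriv (a : ℝ) {x : ℝ} (hx : x ∈ Icc 0 T) :
    Differentiable ℂ (fun μ => cauchyTransformDeriv T p q ν w a μ x) := by
  simp only [cauchyTransformDeriv_eq hT hp hq hw]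
  exact ((differentiable_integral_initialSolution hT hp hq hw 1 0 _).mul
    (differentiable_initialSolution hT hp hq 0 1 hx).2).sub
    ((differentiable_integral_initialSolution hT hp hq hw 0 1 _).mul
    (differentiable_initialSolution hT hp hq 1 0 hx).2)

include hT hp hq in
theorem differentiable_cauchyKernel {t x : ℝ} (ht : t ∈ Icc 0 T) (hx : x ∈ Icc 0 T) :
    Differentiable ℂ (fun μ => cauchyKernel T p q μ t x) ∧
      Differentiable ℂ (fun μ => cauchyKernelDeriv T p q μ t x) :=
  ⟨((differentiable_initialSolution hT hp hq 1 0 ht).1.mul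
    (differentiable_initialSolution hT hp hq 0 1 hx).1).sub
    ((differentiable_initialSolution hT hp hq 0 1 ht).1.mul
    (differentiable_initialSolution hT hp hq 1 0 hx).1),
   ((differentiable_initialSolution hT hp hq 1 0 ht).1.mul
    (differentiable_initialSolution hT hp hq 0 1 hx).2).sub
    ((differentiable_initialSolution hT hp hq 0 1 ht).1.mul
    (differentiable_initialSolution hT hp hq 1 0 hx).2)⟩

theorem norm_setIntegral_mul_le {X : Type*} [MeasurableSpace X] {ν : Measure X} {w : X → ℂ}
    (hw : Integrable w ν) {A : Set X} (hA : MeasurableSet A) {f : X → ℂ} {C : ℝ} (hC : 0 ≤ C)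
    (hf : ∀ t ∈ A, ‖f t‖ ≤ C) : ‖∫ t in A, f t * w t ∂ν‖ ≤ C * ∫ t, ‖w t‖ ∂ν := by
  rw [← integral_const_mul]
  calc _ ≤ ∫ t in A, C * ‖w t‖ ∂ν := by
        refine norm_integral_le_of_norm_le (hw.norm.const_mul C).integrableOn ?_
        filter_upwards [ae_restrict_mem hA] with t ht
        rw [norm_mul]
        gcongr
        exact hf t ht
    _ ≤ _ := setIntegral_le_integral (hw.norm.const_mul C) (.of_forall fun t => by positivity)

include hT hp' hq hw in
-- For `t ≤ x` the kernel has growth exponent `x - t ≤ x`, for `x ≤ t ≤ a` it has `t - x ≤ a - x`,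
-- and `a ≤ 2x` makes this at most `x` as well. This is why one step recovers the coefficients only
-- on the right half of `(0, a)`.
theorem exists_cauchyTransform_bound :
    ∃ K : ℝ, 1 ≤ K ∧ ∀ μ : ℂ, K ≤ ‖μ‖ → ∀ a x, x ∈ Icc 0 T → x ≤ a → a ≤ 2 * x →
      ‖cauchyTransform T p q ν w a μ x‖ ≤ K * Real.exp (|μ.im| * x) / ‖μ‖ ∧
      ‖cauchyTransformDeriv T p q ν w x μ x‖ ≤ K * Real.exp (|μ.im| * x) := by
  obtain ⟨K, hK, h⟩ := exists_cauchyKernel_bound hT hp' hq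
  set V := ∫ t, ‖w t‖ ∂ν
  have hV : 0 ≤ V := integral_nonneg fun _ => norm_nonneg _
  have hKV : K ≤ K * (1 + V) := le_mul_of_one_le_right (by linarith) (by linarith)
  refine ⟨K * (1 + V), hK.trans hKV, fun μ hμ a x hx hxa hax => ?_⟩
  have hμ' := hKV.trans hμ
  have hμ0 : 0 < ‖μ‖ := by linarith
  have hexp : ∀ s, s ≤ x → Real.exp (|μ.im| * s) ≤ Real.exp (|μ.im| * x) := fun s hs =>
    Real.exp_le_exp.2 (by gcongr)
  constructor
  · refine (norm_setIntegral_mul_le hw (measurableSet_coe_le T a)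
      (C := K * Real.exp (|μ.im| * x) / ‖μ‖) (by positivity) fun t ht => ?_).trans ?_
    · have ht : (t : ℝ) ≤ a := ht
      rcases le_total (t : ℝ) x with htx | htx
      · refine (h μ hμ' t t.2 x ⟨htx, hx.2⟩).1.trans ?_
        gcongr; linarith [t.2.1]
      · rw [cauchyKernel_swap, norm_neg]
        refine (h μ hμ' x hx t ⟨htx, t.2.2⟩).1.trans ?_
        gcongr; linarith
    · have : K * Real.exp (|μ.im| * x) / ‖μ‖ * V ≤ K * Real.exp (|μ.im| * x) / ‖μ‖ * (1 + V) := by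
        gcongr; linarith
      exact this.trans (le_of_eq (by ring))
  · refine (norm_setIntegral_mul_le hw (measurableSet_coe_le T x)
      (C := K * Real.exp (|μ.im| * x)) (by positivity) fun t ht => ?_).trans ?_
    · have ht : (t : ℝ) ≤ x := ht
      refine (h μ hμ' t t.2 x ⟨ht, hx.2⟩).2.trans ?_
      gcongr; linarith [t.2.1]
    · have : K * Real.exp (|μ.im| * x) * V ≤ K * Real.exp (|μ.im| * x) * (1 + V) := by
        gcongr; linarith
      exact this.trans (le_of_eq (by ring))

/-- Dominated convergence when the integrand vanishes in the limit away from `o`: only the mass of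
that point survives. -/
theorem tendsto_setIntegral_mul_of_singleton {X : Type*} [MeasurableSpace X]
    [MeasurableSingletonClass X] {ν : Measure X} {w : X → ℂ} (hw : Integrable w ν) {A : Set X}
    {l : Filter ℂ} [l.IsCountablyGenerated] {f : ℂ → X → ℂ}
    (hA : MeasurableSet A) (hf : ∀ μ, AEStronglyMeasurable (f μ) ν) {C : ℝ}
    (hC : ∀ᶠ μ in l, ∀ t ∈ A, ‖f μ t‖ ≤ C) {o : X} (ho : o ∈ A) {c : ℂ}
    (hfo : Tendsto (fun μ => f μ o) l (𝓝 c))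
    (hft : ∀ t ∈ A, t ≠ o → Tendsto (fun μ => f μ t) l (𝓝 0)) :
    Tendsto (fun μ => ∫ t in A, f μ t * w t ∂ν) l (𝓝 (c * ∫ t in {o}, w t ∂ν)) := by
  classical
  have hlim : c * ∫ t in {o}, w t ∂ν = ∫ t in A, ({o} : Set X).indicator (fun t => c * w t) t ∂ν := by
    rw [setIntegral_indicator (measurableSet_singleton o), integral_const_mul,
      inter_eq_right.2 (singleton_subset_iff.2 ho)]
  rw [hlim]
  refine tendsto_integral_filter_of_dominated_convergence (fun t => C * ‖w t‖)
    (.of_forall fun μ => ((hf μ).mul hw.aestronglyMeasurable).restrict) ?_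
    (hw.norm.const_mul C).integrableOn ?_
  · filter_upwards [hC] with μ hμ
    filter_upwards [ae_restrict_mem hA] with t ht
    rw [norm_mul]
    gcongr
    exact hμ t ht
  · filter_upwards [ae_restrict_mem hA] with t ht
    by_cases hto : t = o
    · subst hto
      simpa using hfo.mul_const (w t)
    · simpa [hto] using (hft t ht hto).mul_const (w t)

include hT hp' hq hw in
-- After normalization the kernel is `O(e^{-t Im μ})`, so the limit sees only the mass `H` at `t =
-- 0`, multiplied by the limit of the kernel with `t = 0`.
theorem tendsto_cauchyTransform {H : ℂ} (hH : ∫ t in {⟨0, le_rfl, hT.le⟩}, w t ∂ν = H) {a : ℝ}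
    (ha : a ∈ Ioc 0 T) :
    Tendsto (fun μ => cauchyTransform T p q ν w a μ a *
        (μ * Complex.exp (Complex.I * pencilPhase p μ a)))
      (comap Complex.im atTop) (𝓝 (Complex.I / 2 * H)) ∧
    Tendsto (fun μ => cauchyTransformDeriv T p q ν w a μ a *
        Complex.exp (Complex.I * pencilPhase p μ a))
      (comap Complex.im atTop) (𝓝 (1 / 2 * H)) := by
  have hpi : IntervalIntegrable p volume 0 T := hp'.ac.continuousOn.intervalIntegrable
  obtain ⟨K, hK, h⟩ := exists_cauchyKernel_bound hT hp' hq
  obtain ⟨l₁, l₂⟩ := tendsto_cauchyKernel_zero hT hp' hq ha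
  set K₀ := Real.exp (∫ u in (0 : ℝ)..T, ‖p u‖)
  set e := fun μ => Complex.exp (Complex.I * pencilPhase p μ a) with he
  have hphase : ∀ μ, ‖e μ‖ ≤ K₀ * Real.exp (-(μ.im * a)) := fun μ => by
    have := norm_exp_phase_le hpi (Or.inl rfl) μ le_rfl ha.1.le ha.2
    simpa [pencilPhase, he] using this
  have hbd : ∀ᶠ μ in comap Complex.im atTop, ∀ t : Icc (0 : ℝ) T, (t : ℝ) ≤ a →
      ‖cauchyKernel T p q μ t a * (μ * e μ)‖ ≤ K * K₀ * Real.exp (-(t * μ.im)) ∧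
      ‖cauchyKernelDeriv T p q μ t a * e μ‖ ≤ K * K₀ * Real.exp (-(t * μ.im)) := by
    filter_upwards [tendsto_norm_comap_im.eventually_ge_atTop K,
      tendsto_comap.eventually_ge_atTop 0] with μ hμ hτ t ht
    obtain ⟨h1, h2⟩ := h μ hμ t t.2 a ⟨ht, ha.2⟩
    have hμ0 : 0 < ‖μ‖ := by linarith
    rw [abs_of_nonneg hτ] at h1 h2
    have hee : Real.exp (-(t * μ.im)) = Real.exp (μ.im * (a - t)) * Real.exp (-(μ.im * a)) := by
      rw [← Real.exp_add]; congr 1; ring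
    rw [hee]
    constructor
    · rw [norm_mul, norm_mul]
      calc _ ≤ K * Real.exp (μ.im * (a - t)) / ‖μ‖ *
              (‖μ‖ * (K₀ * Real.exp (-(μ.im * a)))) := by gcongr; exact hphase μ
        _ = _ := by field_simp
    · rw [norm_mul]
      calc _ ≤ K * Real.exp (μ.im * (a - t)) * (K₀ * Real.exp (-(μ.im * a))) := by
            gcongr; exact hphase μ
        _ = _ := by ring
  have hKK : 0 ≤ K * K₀ := by positivity
  have hle : ∀ᶠ μ in comap Complex.im atTop, ∀ t : Icc (0 : ℝ) T,
      K * K₀ * Real.exp (-(t * μ.im)) ≤ K * K₀ := by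
    filter_upwards [tendsto_comap.eventually_ge_atTop 0] with μ hτ t
    refine mul_le_of_le_one_right hKK (Real.exp_le_one_iff.2 ?_)
    have := mul_nonneg t.2.1 hτ
    linarith
  have hzero : ∀ t : Icc (0 : ℝ) T, t ≠ ⟨0, le_rfl, hT.le⟩ → Tendsto (fun μ : ℂ =>
      K * K₀ * Real.exp (-(t * μ.im))) (comap Complex.im atTop) (𝓝 0) := by
    intro t ht
    have htp : 0 < (t : ℝ) := lt_of_le_of_ne t.2.1 fun h0 => ht (Subtype.ext h0.symm)
    have : Tendsto (fun μ : ℂ => -((t : ℝ) * μ.im)) (comap Complex.im atTop) atBot :=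
      tendsto_neg_atTop_atBot.comp (tendsto_comap.const_mul_atTop htp)
    simpa using (Real.tendsto_exp_atBot.comp this).const_mul (K * K₀)
  constructor
  · have := tendsto_setIntegral_mul_of_singleton (l := comap Complex.im atTop) hw
      (measurableSet_coe_le T a)
      (f := fun μ t => cauchyKernel T p q μ t a * (μ * e μ))
      (fun μ => ((continuous_cauchyKernel_left hT hpi hq μ a).mul_const _).aestronglyMeasurable)
      (C := K * K₀) (by
        filter_upwards [hbd, hle] with μ h1 h2 t ht using (h1 t ht).1.trans (h2 t))
      (o := ⟨0, le_rfl, hT.le⟩) ha.1.le (c := Complex.I / 2)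
      (l₁.congr fun μ => by simp only [he]; ring) (fun t ht hto => by
        refine squeeze_zero_norm' ?_ (hzero t hto)
        filter_upwards [hbd] with μ h1 using (h1 t ht).1)
    rw [hH] at this
    refine this.congr fun μ => ?_
    rw [cauchyTransform, ← integral_mul_const]
    congr 1; ext t; simp only [he]; ring
  · have := tendsto_setIntegral_mul_of_singleton (l := comap Complex.im atTop) hw
      (measurableSet_coe_le T a)
      (f := fun μ t => cauchyKernelDeriv T p q μ t a * e μ)
      (fun μ => ((continuous_cauchyKernelDeriv_left hT hpi hq μ a).mul_const _).aestronglyMeasurable)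
      (C := K * K₀) (by
        filter_upwards [hbd, hle] with μ h1 h2 t ht using (h1 t ht).2.trans (h2 t))
      (o := ⟨0, le_rfl, hT.le⟩) ha.1.le (c := 1 / 2) l₂ (fun t ht hto => by
        refine squeeze_zero_norm' ?_ (hzero t hto)
        filter_upwards [hbd] with μ h1 using (h1 t ht).2)
    rw [hH] at this
    refine this.congr fun μ => ?_
    rw [cauchyTransformDeriv, ← integral_mul_const]
    congr 1; ext t; simp only [he]; ring

end Transform

theorem IsExpType.of_norm_le_exp_im {f : ℂ → ℂ} (hf : Continuous f) {K B : ℝ} (hK : 0 ≤ K)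
    (hB : 0 ≤ B) (h : ∀ z, K ≤ ‖z‖ → ‖f z‖ ≤ K * Real.exp (|z.im| * B)) : IsExpType f := by
  refine .of_eventually_le hf hK hB fun z hz => (h z hz).trans ?_
  rw [mul_comm B]
  gcongr
  exact Complex.abs_im_le_norm z

/-- The equation is invariant under `(μ, p) ↦ (-μ, -p)`. This symmetry transfers every statement
about `Im μ → +∞` to `Im μ → -∞`. -/
theorem initialSolution_neg (T : ℝ) (p q : ℝ → ℂ) (μ a b : ℂ) :
    initialSolution T (fun x => -p x) q (-μ) a b = initialSolution T p q μ a b := by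
  have h : ∀ y z, PencilSolution T (fun x => -p x) q (-μ) y z ↔ PencilSolution T p q μ y z := by
    intro y z
    have e : ∀ x, -(((-μ) ^ 2 - 2 * (-μ) * (-p x) - q x) * y x) =
        -((μ ^ 2 - 2 * μ * p x - q x) * y x) := fun x => by ring
    exact ⟨fun h => ⟨h.hasDeriv, h.absCont, by simpa only [e] using h.equation⟩,
      fun h => ⟨h.hasDeriv, h.absCont, by simpa only [e] using h.equation⟩⟩
  simp only [initialSolution, h]

theorem cauchyTransform_neg (T : ℝ) (p q : ℝ → ℂ) (ν : Measure (Icc (0 : ℝ) T))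
    (w : Icc (0 : ℝ) T → ℂ) (a : ℝ) (μ : ℂ) (x : ℝ) :
    cauchyTransform T (fun x => -p x) q ν w a (-μ) x = cauchyTransform T p q ν w a μ x ∧
      cauchyTransformDeriv T (fun x => -p x) q ν w a (-μ) x =
        cauchyTransformDeriv T p q ν w a μ x := by
  simp only [cauchyTransform, cauchyTransformDeriv, cauchyKernel, cauchyKernelDeriv,
    initialSolution_neg, and_self]

theorem pencilPhase_neg (p : ℝ → ℂ) (μ : ℂ) (x : ℝ) :
    pencilPhase (fun x => -p x) (-μ) x = -pencilPhase p μ x := by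
  simp only [pencilPhase, intervalIntegral.integral_neg]; ring

theorem tendsto_neg_comap_im_atBot :
    Tendsto (fun μ : ℂ => -μ) (comap Complex.im atBot) (comap Complex.im atTop) := by
  rw [tendsto_comap_iff]
  exact (tendsto_neg_atBot_atTop.comp tendsto_comap).congr fun μ => by simp

theorem HasACDeriv.neg {T : ℝ} {f f' : ℝ → ℂ} (hf : HasACDeriv T f f') :
    HasACDeriv T (fun x => -f x) (fun x => -f' x) := by
  simpa using hf.const_mul (-1)

section Transform

variable {T : ℝ} (hT : 0 < T) {p p' q : ℝ → ℂ} (hp' : HasACDeriv T p p')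
  (hq : IntervalIntegrable q volume 0 T) {ν : Measure (Icc (0 : ℝ) T)}
  {w : Icc (0 : ℝ) T → ℂ} (hw : Integrable w ν)

include hT hp' hq hw in
theorem tendsto_cauchyTransform_atBot {H : ℂ} (hH : ∫ t in {⟨0, le_rfl, hT.le⟩}, w t ∂ν = H)
    {a : ℝ} (ha : a ∈ Ioc 0 T) :
    Tendsto (fun μ => cauchyTransform T p q ν w a μ a *
        (-μ * Complex.exp (-(Complex.I * pencilPhase p μ a))))
      (comap Complex.im atBot) (𝓝 (Complex.I / 2 * H)) ∧
    Tendsto (fun μ => cauchyTransformDeriv T p q ν w a μ a *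
        Complex.exp (-(Complex.I * pencilPhase p μ a)))
      (comap Complex.im atBot) (𝓝 (1 / 2 * H)) := by
  obtain ⟨h1, h2⟩ := tendsto_cauchyTransform hT hp'.neg hq hw hH ha
  constructor
  · refine (h1.comp tendsto_neg_comap_im_atBot).congr fun μ => ?_
    simp only [Function.comp_apply, (cauchyTransform_neg T p q ν w a μ a).1, pencilPhase_neg,
      mul_neg]
  · refine (h2.comp tendsto_neg_comap_im_atBot).congr fun μ => ?_
    simp only [Function.comp_apply, (cauchyTransform_neg T p q ν w a μ a).2, pencilPhase_neg,
      mul_neg]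

include hT hp' hq hw in
theorem isExpType_cauchyTransform {x : ℝ} (hx : x ∈ Icc 0 T) :
    IsExpType (fun μ => cauchyTransform T p q ν w x μ x) ∧
      IsExpType (fun μ => cauchyTransformDeriv T p q ν w x μ x) := by
  have hpi : IntervalIntegrable p volume 0 T := hp'.ac.continuousOn.intervalIntegrable
  obtain ⟨K, hK, h⟩ := exists_cauchyTransform_bound hT hp' hq hw
  constructor
  · refine .of_norm_le_exp_im (differentiable_cauchyTransform hT hpi hq hw x hx).continuous
      (zero_le_one.trans hK) hx.1 fun μ hμ =>
        (h μ hμ x x hx le_rfl (by linarith [hx.1])).1.trans ?_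
    exact div_le_self (by positivity) (hK.trans hμ)
  · exact .of_norm_le_exp_im (differentiable_cauchyTransformDeriv hT hpi hq hw x hx).continuous
      (zero_le_one.trans hK) hx.1 fun μ hμ =>
        (h μ hμ x x hx le_rfl (by linarith [hx.1])).2

variable {r r' s : ℝ → ℂ} (hr' : HasACDeriv T r r') (hs : IntervalIntegrable s volume 0 T)

include hT hp' hq hw hr' hs in
-- Equal integrals of `p` and `r` give equal phases at `a`, so one normalizing factor serves both
-- transforms and gives the same nonzero limit.
theorem cauchyTransform_eq_of_analyticOrderAt_eq {H : ℂ}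
    (hH : ∫ t in {⟨0, le_rfl, hT.le⟩}, w t ∂ν = H) (hH0 : H ≠ 0) {a : ℝ} (ha : a ∈ Ioc 0 T)
    (hint : ∫ x in (0 : ℝ)..a, p x = ∫ x in (0 : ℝ)..a, r x)
    (hord : ∀ z, analyticOrderAt (fun μ => cauchyTransform T p q ν w a μ a) z =
      analyticOrderAt (fun μ => cauchyTransform T r s ν w a μ a) z)
    (hord' : ∀ z, analyticOrderAt (fun μ => cauchyTransformDeriv T p q ν w a μ a) z =
      analyticOrderAt (fun μ => cauchyTransformDeriv T r s ν w a μ a) z) (μ : ℂ) :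
    cauchyTransform T p q ν w a μ a = cauchyTransform T r s ν w a μ a ∧
      cauchyTransformDeriv T p q ν w a μ a = cauchyTransformDeriv T r s ν w a μ a := by
  have hpi : IntervalIntegrable p volume 0 T := hp'.ac.continuousOn.intervalIntegrable
  have hri : IntervalIntegrable r volume 0 T := hr'.ac.continuousOn.intervalIntegrable
  have hph : ∀ μ, pencilPhase p μ a = pencilPhase r μ a := fun μ => by
    simp only [pencilPhase, hint]
  have hx := Ioc_subset_Icc_self ha
  have t₁ := tendsto_cauchyTransform hT hp' hq hw hH ha
  have t₂ := tendsto_cauchyTransform hT hr' hs hw hH ha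
  have b₁ := tendsto_cauchyTransform_atBot hT hp' hq hw hH ha
  have b₂ := tendsto_cauchyTransform_atBot hT hr' hs hw hH ha
  simp only [← hph] at t₂ b₂
  have e₁ := isExpType_cauchyTransform hT hp' hq hw hx
  have e₂ := isExpType_cauchyTransform hT hr' hs hw hx
  have hI : Complex.I / 2 * H ≠ 0 := by simp [hH0]
  have hI' : 1 / 2 * H ≠ 0 := by simp [hH0]
  exact ⟨congrFun (IsExpType.eq_of_analyticOrderAt_eq
      (differentiable_cauchyTransform hT hpi hq hw a hx)
      (differentiable_cauchyTransform hT hri hs hw a hx) e₁.1 e₂.1 hord hI hI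
      t₁.1 t₂.1 b₁.1 b₂.1) μ,
    congrFun (IsExpType.eq_of_analyticOrderAt_eq
      (differentiable_cauchyTransformDeriv hT hpi hq hw a hx)
      (differentiable_cauchyTransformDeriv hT hri hs hw a hx) e₁.2 e₂.2 hord' hI' hI'
      t₁.2 t₂.2 b₁.2 b₂.2) μ⟩

end Transform

/-! ### Spectra as zeros of the characteristic functions -/

section Spectrum

variable {T : ℝ} (hT : 0 < T) {p q : ℝ → ℂ} (hp : IntervalIntegrable p volume 0 T)
  (hq : IntervalIntegrable q volume 0 T)

include hT in
theorem PencilSolution.exists_ne_zero {μ : ℂ} {y z : ℝ → ℂ} (h : PencilSolution T p q μ y z)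
    (h0 : y 0 ≠ 0 ∨ z 0 ≠ 0) : ∃ x ∈ Icc 0 T, y x ≠ 0 := by
  by_contra! hy
  have hm : (0 : ℝ) ∈ Icc 0 T := ⟨le_rfl, hT.le⟩
  have hz : z 0 = 0 := by
    refine (uniqueDiffOn_Icc hT 0 hm).eq_deriv _ (h.hasDeriv 0 hm) ?_
    exact (hasDerivWithinAt_const 0 _ (0 : ℂ)).congr hy (hy 0 hm)
  exact h0.elim (fun h => h (hy 0 hm)) fun h => h hz

include hT hp hq in
theorem IsPencilEigenvalue.of_characteristicFunction_eq_zero {U : (ℝ → ℂ) → ℂ}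
    {V : (ℝ → ℂ) × (ℝ → ℂ) → ℂ}
    (hU : ∀ y y' : ℝ → ℂ, ContinuousOn y (Icc 0 T) → ContinuousOn y' (Icc 0 T) → ∀ c d : ℂ,
      U (fun x => c * y x + d * y' x) = c * U y + d * U y')
    (hV : ∀ (Y Z : (ℝ → ℂ) × (ℝ → ℂ)) (c d : ℂ),
      V (fun x => c * Y.1 x + d * Z.1 x, fun x => c * Y.2 x + d * Z.2 x) = c * V Y + d * V Z)
    {μ : ℂ} (h : characteristicFunction T p q U V μ = 0) : IsPencilEigenvalue T p q U V μ := by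
  -- A vector in the left kernel of the singular matrix gives the coefficients of an eigenfunction
  -- in the fundamental solutions.
  obtain ⟨v, hv, hv0⟩ := Matrix.exists_vecMul_eq_zero_iff.2 h
  obtain ⟨h1, e1, e1'⟩ := initialSolution_spec hT hp hq μ 1 0
  obtain ⟨h2, e2, e2'⟩ := initialSolution_spec hT hp hq μ 0 1
  have k0 := congrFun hv0 0
  have k1 := congrFun hv0 1
  simp only [Matrix.vecMul, dotProduct, Fin.sum_univ_two, Matrix.of_apply, Matrix.cons_val',
    Matrix.cons_val_zero, Matrix.cons_val_one, Matrix.cons_val_fin_one, Pi.zero_apply] at k0 k1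
  have hs := h1.combination h2 (v 0) (v 1)
  refine ⟨_, _, hs, hs.exists_ne_zero hT ?_, ?_, ?_⟩
  · simp only [e1, e1', e2, e2', mul_one, mul_zero, add_zero, zero_add]
    by_contra! hvv
    exact hv (by ext i; fin_cases i; exacts [hvv.1, hvv.2])
  · rw [hU _ _ h1.continuousOn h2.continuousOn]; exact k0
  · rw [hV]; exact k1

include hT hp hq in
-- The case distinction in the multiplicity is harmless: off the eigenvalues the characteristic
-- function does not vanish, so its order is `0` too.
theorem spectrumMultiplicity_eq_analyticOrderAt {U : (ℝ → ℂ) → ℂ}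
    {V : (ℝ → ℂ) × (ℝ → ℂ) → ℂ}
    (hU : ∀ y y' : ℝ → ℂ, ContinuousOn y (Icc 0 T) → ContinuousOn y' (Icc 0 T) → ∀ c d : ℂ,
      U (fun x => c * y x + d * y' x) = c * U y + d * U y')
    (hV : ∀ (Y Z : (ℝ → ℂ) × (ℝ → ℂ)) (c d : ℂ),
      V (fun x => c * Y.1 x + d * Z.1 x, fun x => c * Y.2 x + d * Z.2 x) = c * V Y + d * V Z)
    (μ : ℂ) : spectrumMultiplicity T p q U V μ =
      analyticOrderAt (characteristicFunction T p q U V) μ := by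
  rw [spectrumMultiplicity]
  split_ifs with h
  · rfl
  · exact (analyticOrderAt_eq_zero.2 (.inr fun h0 =>
      h (.of_characteristicFunction_eq_zero hT hp hq hU hV h0))).symm

variable {ν : Measure (Icc (0 : ℝ) T)} {w : Icc (0 : ℝ) T → ℂ} (hw : Integrable w ν)
  {U : (ℝ → ℂ) → ℂ} (hU : ∀ y : ℝ → ℂ, ContinuousOn y (Icc 0 T) → U y = ∫ t, y t * w t ∂ν)

include hT hp hq hw hU in
theorem characteristicFunction_eq_cauchyTransform :
    characteristicFunction T p q U (fun Y => Y.1 T) =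
        (fun μ => cauchyTransform T p q ν w T μ T) ∧
      characteristicFunction T p q U (fun Y => Y.2 T) =
        (fun μ => cauchyTransformDeriv T p q ν w T μ T) := by
  have huniv : {t : Icc (0 : ℝ) T | (t : ℝ) ≤ T} = univ := eq_univ_of_forall fun t => t.2.2
  constructor <;> funext μ
  · rw [cauchyTransform_eq hT hp hq hw, huniv, Measure.restrict_univ, characteristicFunction,
      Matrix.det_fin_two_of, hU _ (initialSolution_spec hT hp hq μ 1 0).1.continuousOn,
      hU _ (initialSolution_spec hT hp hq μ 0 1).1.continuousOn]
    ring
  · rw [cauchyTransformDeriv_eq hT hp hq hw, huniv, Measure.restrict_univ, characteristicFunction,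
      Matrix.det_fin_two_of, hU _ (initialSolution_spec hT hp hq μ 1 0).1.continuousOn,
      hU _ (initialSolution_spec hT hp hq μ 0 1).1.continuousOn]
    ring

include hT hp hq hw hU in
theorem spectrumMultiplicity_eq_analyticOrderAt_cauchyTransform (μ : ℂ) :
    spectrumMultiplicity T p q U (fun Y => Y.1 T) μ =
        analyticOrderAt (fun μ => cauchyTransform T p q ν w T μ T) μ ∧
      spectrumMultiplicity T p q U (fun Y => Y.2 T) μ =
        analyticOrderAt (fun μ => cauchyTransformDeriv T p q ν w T μ T) μ := by
  have hlin : ∀ y y' : ℝ → ℂ, ContinuousOn y (Icc 0 T) → ContinuousOn y' (Icc 0 T) → ∀ c d : ℂ,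
      U (fun x => c * y x + d * y' x) = c * U y + d * U y' := by
    intro y y' hy hy' c d
    have hi : ∀ {f : ℝ → ℂ}, ContinuousOn f (Icc 0 T) →
        Integrable (fun t : Icc (0 : ℝ) T => f t * w t) ν := fun hf =>
      ContinuousMap.integrable_mul hw ⟨_, continuousOn_iff_continuous_domRestrict.1 hf⟩
    rw [hU (fun x => c * y x + d * y' x)
      ((continuousOn_const.mul hy).add (continuousOn_const.mul hy')), hU y hy, hU y' hy',
      ← integral_const_mul, ← integral_const_mul,
      ← integral_add ((hi hy).const_mul c) ((hi hy').const_mul d)]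
    congr 1; ext t; ring
  obtain ⟨h1, h2⟩ := characteristicFunction_eq_cauchyTransform hT hp hq hw hU
  exact ⟨h1 ▸ spectrumMultiplicity_eq_analyticOrderAt hT hp hq hlin (fun _ _ _ _ => rfl) μ,
    h2 ▸ spectrumMultiplicity_eq_analyticOrderAt hT hp hq hlin (fun _ _ _ _ => rfl) μ⟩

end Spectrum

/-! ### Carrying Cauchy data from `T` back to `a` -/

section Kernel

variable {T : ℝ} (hT : 0 < T) {p q : ℝ → ℂ} (hp : IntervalIntegrable p volume 0 T)
  (hq : IntervalIntegrable q volume 0 T) (μ : ℂ)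

theorem cauchyKernelDeriv₂_self (x : ℝ) : cauchyKernelDeriv₂ T p q μ x x = 0 := by
  simp only [cauchyKernelDeriv₂]; ring

include hT hp hq in
theorem pencilSolution_cauchyKernelDeriv (x : ℝ) :
    PencilSolution T p q μ (fun t => cauchyKernelDeriv T p q μ t x)
      (fun t => cauchyKernelDeriv₂ T p q μ t x) := by
  have h1 := (initialSolution_spec hT hp hq μ 1 0).1
  have h2 := (initialSolution_spec hT hp hq μ 0 1).1
  have := h1.combination h2 ((initialSolution T p q μ 0 1).2 x)
    (-(initialSolution T p q μ 1 0).2 x)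
  convert this using 1
  · ext t; simp only [cauchyKernelDeriv]; ring
  · ext t; simp only [cauchyKernelDeriv₂]; ring

include hT hp hq in
theorem pencilSolution_cauchyTransform {ν : Measure (Icc (0 : ℝ) T)} {w : Icc (0 : ℝ) T → ℂ}
    (hw : Integrable w ν) (a : ℝ) :
    PencilSolution T p q μ (cauchyTransform T p q ν w a μ) (cauchyTransformDeriv T p q ν w a μ) := by
  have h1 := (initialSolution_spec hT hp hq μ 1 0).1
  have h2 := (initialSolution_spec hT hp hq μ 0 1).1
  have := h2.combination h1
    (∫ t in {t : Icc (0 : ℝ) T | (t : ℝ) ≤ a}, (initialSolution T p q μ 1 0).1 t * w t ∂ν)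
    (-∫ t in {t : Icc (0 : ℝ) T | (t : ℝ) ≤ a}, (initialSolution T p q μ 0 1).1 t * w t ∂ν)
  convert this using 1
  · ext x; rw [cauchyTransform_eq hT hp hq hw]; ring
  · ext x; rw [cauchyTransformDeriv_eq hT hp hq hw]; ring

variable {μ}

include hT hp hq in
theorem PencilSolution.eq_cauchyKernel {y z : ℝ → ℂ} (h : PencilSolution T p q μ y z) {a x : ℝ}
    (ha : a ∈ Icc 0 T) (hx : x ∈ Icc 0 T) :
    y x = y a * cauchyKernelDeriv T p q μ x a - z a * cauchyKernel T p q μ x a := by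
  have := h.wronskian_eq_self hT hp hq (pencilSolution_cauchyKernel hT hp hq μ x) hx ha
  rw [cauchyKernel_self, cauchyKernelDeriv_self hT hp hq μ hx] at this
  linear_combination this

variable {r s : ℝ → ℂ} (hr : IntervalIntegrable r volume 0 T)
  (hs : IntervalIntegrable s volume 0 T)

include hT hp hq hr hs in
/-- Solutions of two pencils with the same data at `T` coincide as long as the coefficients do. -/
theorem PencilSolution.eqOn_of_ae_eq {y z y' z' : ℝ → ℂ} (h : PencilSolution T p q μ y z)
    (h' : PencilSolution T r s μ y' z') (hy : y T = y' T) (hz : z T = z' T) {a : ℝ} (ha : 0 ≤ a)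
    (hpr : ∀ᵐ x ∂(volume.restrict (Ioo a T)), p x = r x)
    (hqs : ∀ᵐ x ∂(volume.restrict (Ioo a T)), q x = s x) {x : ℝ} (hx : x ∈ Icc a T) :
    y x = y' x ∧ z x = z' x := by
  have hx0 : x ∈ Icc 0 T := ⟨ha.trans hx.1, hx.2⟩
  have hTa : T ∈ Icc a T := ⟨hx.1.trans hx.2, le_rfl⟩
  have key : ∀ {u v : ℝ → ℂ}, PencilSolution T r s μ u v →
      y x * v x - z x * u x = y' x * v x - z' x * u x := by
    intro u v huv
    rw [h.wronskian_eq hT ha hp hq hr hs huv hpr hqs hx hTa,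
      h'.wronskian_eq_self hT hr hs huv hx0 ⟨hT.le, le_rfl⟩, hy, hz]
  constructor
  · have := key (pencilSolution_cauchyKernel hT hr hs μ x)
    rw [cauchyKernel_self, cauchyKernelDeriv_self hT hr hs μ hx0] at this
    linear_combination this
  · have := key (pencilSolution_cauchyKernelDeriv hT hr hs μ x)
    simp only [cauchyKernelDeriv₂_self, cauchyKernelDeriv_self hT hr hs μ hx0] at this
    linear_combination -this

include hT hp hq hr hs in
/-- If the coefficients coincide on `(a, T)`, then so do the Cauchy data at `a` of the transforms
of the restrictions to `[0, a]`, provided the Cauchy data at `T` of the full transforms do. -/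
theorem cauchyTransform_eq_of_ae_eq {ν : Measure (Icc (0 : ℝ) T)} {w : Icc (0 : ℝ) T → ℂ}
    (hw : Integrable w ν)
    (h : cauchyTransform T p q ν w T μ T = cauchyTransform T r s ν w T μ T)
    (h' : cauchyTransformDeriv T p q ν w T μ T = cauchyTransformDeriv T r s ν w T μ T) {a : ℝ}
    (ha : a ∈ Icc 0 T)
    (hpr : ∀ᵐ x ∂(volume.restrict (Ioo a T)), p x = r x)
    (hqs : ∀ᵐ x ∂(volume.restrict (Ioo a T)), q x = s x) :
    cauchyTransform T p q ν w a μ a = cauchyTransform T r s ν w a μ a ∧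
      cauchyTransformDeriv T p q ν w a μ a = cauchyTransformDeriv T r s ν w a μ a := by
  have hTT : T ∈ Icc 0 T := ⟨hT.le, le_rfl⟩
  -- As functions of `t` the kernels with `x = T` are solutions with data at `T` that do not depend
  -- on the coefficients.
  have hG : ∀ t ∈ Icc a T, cauchyKernel T p q μ t T = cauchyKernel T r s μ t T := by
    intro t ht
    rw [cauchyKernel_swap μ t T, cauchyKernel_swap μ t T, neg_inj]
    exact ((pencilSolution_cauchyKernel hT hp hq μ T).eqOn_of_ae_eq hT hp hq hr hs
      (pencilSolution_cauchyKernel hT hr hs μ T) (by simp only [cauchyKernel_self])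
      (by rw [cauchyKernelDeriv_self hT hp hq μ hTT, cauchyKernelDeriv_self hT hr hs μ hTT])
      ha.1 hpr hqs ht).1
  have hD : ∀ t ∈ Icc a T, cauchyKernelDeriv T p q μ t T = cauchyKernelDeriv T r s μ t T := by
    intro t ht
    exact ((pencilSolution_cauchyKernelDeriv hT hp hq μ T).eqOn_of_ae_eq hT hp hq hr hs
      (pencilSolution_cauchyKernelDeriv hT hr hs μ T)
      (by rw [cauchyKernelDeriv_self hT hp hq μ hTT, cauchyKernelDeriv_self hT hr hs μ hTT])
      (by simp only [cauchyKernelDeriv₂_self]) ha.1 hpr hqs ht).1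
  set A := {t : Icc (0 : ℝ) T | (t : ℝ) ≤ a}
  have hA : MeasurableSet A := measurableSet_coe_le T a
  have huniv : {t : Icc (0 : ℝ) T | (t : ℝ) ≤ T} = univ := eq_univ_of_forall fun t => t.2.2
  -- The contributions of `t > a` are equal, so they can be subtracted from the equal full
  -- integrals.
  have split : ∀ {f g : Icc (0 : ℝ) T → ℂ}, Continuous f → Continuous g →
      ∫ t in {t : Icc (0 : ℝ) T | (t : ℝ) ≤ T}, f t * w t ∂ν =
        ∫ t in {t : Icc (0 : ℝ) T | (t : ℝ) ≤ T}, g t * w t ∂ν →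
      (∀ t : Icc (0 : ℝ) T, (t : ℝ) ∈ Icc a T → f t = g t) →
      ∫ t in A, f t * w t ∂ν = ∫ t in A, g t * w t ∂ν := by
    intro f g hf hg he hfg
    have i₁ : Integrable (fun t => f t * w t) ν := ContinuousMap.integrable_mul hw ⟨f, hf⟩
    have i₂ : Integrable (fun t => g t * w t) ν := ContinuousMap.integrable_mul hw ⟨g, hg⟩
    rw [huniv, Measure.restrict_univ, ← integral_add_compl hA i₁, ← integral_add_compl hA i₂] at he
    have hc : ∫ t in Aᶜ, f t * w t ∂ν = ∫ t in Aᶜ, g t * w t ∂ν := by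
      refine setIntegral_congr_fun hA.compl fun t ht => ?_
      have ht : a < (t : ℝ) := not_le.1 ht
      simp only [hfg t ⟨ht.le, t.2.2⟩]
    rw [hc] at he
    exact add_right_cancel he
  have hT1 : cauchyTransform T p q ν w a μ T = cauchyTransform T r s ν w a μ T :=
    split (continuous_cauchyKernel_left hT hp hq μ T) (continuous_cauchyKernel_left hT hr hs μ T) h
      fun t ht => hG t ht
  have hT2 : cauchyTransformDeriv T p q ν w a μ T = cauchyTransformDeriv T r s ν w a μ T :=
    split (continuous_cauchyKernelDeriv_left hT hp hq μ T)
      (continuous_cauchyKernelDeriv_left hT hr hs μ T) h' fun t ht => hD t ht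
  exact (pencilSolution_cauchyTransform hT hp hq μ hw a).eqOn_of_ae_eq hT hp hq hr hs
    (pencilSolution_cauchyTransform hT hr hs μ hw a) hT1 hT2 ha.1 hpr hqs ⟨le_rfl, ha.2⟩

end Kernel

/-! ### Vanishing of the cross product on `[a/2, a]` -/

section Halving

variable {T : ℝ} (hT : 0 < T) {p p' q : ℝ → ℂ} (hp' : HasACDeriv T p p')
  (hq : IntervalIntegrable q volume 0 T) {r r' s : ℝ → ℂ} (hr' : HasACDeriv T r r')
  (hs : IntervalIntegrable s volume 0 T) {ν : Measure (Icc (0 : ℝ) T)}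
  {w : Icc (0 : ℝ) T → ℂ} (hw : Integrable w ν)

include hT hp' hq hr' hs hw in
theorem tendsto_cauchyKernel_cross {H : ℂ} (hH : ∫ t in {⟨0, le_rfl, hT.le⟩}, w t ∂ν = H)
    (hH0 : H ≠ 0) {a : ℝ} (ha : a ∈ Ioc 0 T)
    (h : ∀ μ, cauchyTransform T p q ν w a μ a = cauchyTransform T r s ν w a μ a ∧
      cauchyTransformDeriv T p q ν w a μ a = cauchyTransformDeriv T r s ν w a μ a) {x : ℝ}
    (hx : x ∈ Icc (a / 2) a) :
    Tendsto (fun μ => cauchyKernelDeriv T p q μ x a * cauchyKernel T r s μ x a -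
      cauchyKernel T p q μ x a * cauchyKernelDeriv T r s μ x a)
      (comap Complex.im atTop) (𝓝 0) := by
  have hpi : IntervalIntegrable p volume 0 T := hp'.ac.continuousOn.intervalIntegrable
  have hri : IntervalIntegrable r volume 0 T := hr'.ac.continuousOn.intervalIntegrable
  have ha' := Ioc_subset_Icc_self ha
  have hx0 : x ∈ Icc 0 T := ⟨by linarith [hx.1, ha.1], hx.2.trans ha.2⟩
  set F := fun μ => cauchyKernelDeriv T p q μ x a * cauchyKernel T r s μ x a -
      cauchyKernel T p q μ x a * cauchyKernelDeriv T r s μ x a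
  set θ := fun μ => cauchyTransform T p q ν w a μ a with hθ
  set e := fun μ => Complex.exp (Complex.I * pencilPhase p μ a) with he
  -- Both transforms at `x` are expressed by their common Cauchy data at `a`; the derivative `θ'(a)`
  -- drops out.
  have hF : ∀ μ, θ μ * F μ = cauchyTransform T p q ν w a μ x * cauchyKernel T r s μ x a -
      cauchyKernel T p q μ x a * cauchyTransform T r s ν w a μ x := by
    intro μ
    have e1 := (pencilSolution_cauchyTransform hT hpi hq μ hw a).eq_cauchyKernel hT hpi hq ha' hx0
    have e2 := (pencilSolution_cauchyTransform hT hri hs μ hw a).eq_cauchyKernel hT hri hs ha' hx0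
    rw [← (h μ).1, ← (h μ).2] at e2
    rw [e1, e2]
    simp only [hθ, F]
    ring
  obtain ⟨K₁, hK₁, b₁⟩ := exists_cauchyKernel_bound hT hp' hq
  obtain ⟨K₂, hK₂, b₂⟩ := exists_cauchyKernel_bound hT hr' hs
  obtain ⟨K₃, hK₃, b₃⟩ := exists_cauchyTransform_bound hT hp' hq hw
  obtain ⟨K₄, hK₄, b₄⟩ := exists_cauchyTransform_bound hT hr' hs hw
  set K₀ := Real.exp (∫ u in (0 : ℝ)..T, ‖p u‖)
  have hden := (tendsto_cauchyTransform hT hp' hq hw hH ha).1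
  have hne : Complex.I / 2 * H ≠ 0 := by simp [hH0]
  have hnum : Tendsto (fun μ => θ μ * F μ * (μ * e μ)) (comap Complex.im atTop) (𝓝 0) := by
    refine squeeze_zero_norm' (a := fun μ => K₀ * (K₃ * K₂ + K₁ * K₄) / ‖μ‖) ?_
      (tendsto_norm_comap_im.const_div_atTop _)
    filter_upwards [tendsto_norm_comap_im.eventually_ge_atTop K₁,
      tendsto_norm_comap_im.eventually_ge_atTop K₂, tendsto_norm_comap_im.eventually_ge_atTop K₃,
      tendsto_norm_comap_im.eventually_ge_atTop K₄, tendsto_comap.eventually_ge_atTop 0]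
      with μ m₁ m₂ m₃ m₄ hτ
    have hμ0 : 0 < ‖μ‖ := by linarith
    have g₁ := (b₁ μ m₁ x hx0 a ⟨hx.2, ha.2⟩).1
    have g₂ := (b₂ μ m₂ x hx0 a ⟨hx.2, ha.2⟩).1
    have g₃ := (b₃ μ m₃ a x hx0 hx.2 (by linarith [hx.1])).1
    have g₄ := (b₄ μ m₄ a x hx0 hx.2 (by linarith [hx.1])).1
    have g₀ : ‖e μ‖ ≤ K₀ * Real.exp (-(μ.im * a)) := by
      have := norm_exp_phase_le hpi (Or.inl rfl) μ le_rfl ha.1.le ha.2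
      simpa [pencilPhase, he] using this
    rw [abs_of_nonneg hτ] at g₁ g₂ g₃ g₄
    rw [hF, norm_mul, norm_mul]
    set X := Real.exp (μ.im * x)
    set Y := Real.exp (μ.im * (a - x))
    -- The growth `e^{τx} · e^{τ(a - x)}` of the numerator, `τ = Im μ`, is exactly that of `θ(a)`; a
    -- factor `1 / ‖μ‖` is left over.
    have hXY : X * Y * Real.exp (-(μ.im * a)) = 1 := by
      rw [← Real.exp_add, ← Real.exp_add, Real.exp_eq_one_iff]; ring
    calc _ ≤ (K₃ * X / ‖μ‖ * (K₂ * Y / ‖μ‖) + K₁ * Y / ‖μ‖ * (K₄ * X / ‖μ‖)) *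
          (‖μ‖ * (K₀ * Real.exp (-(μ.im * a)))) := by
          gcongr
          refine (norm_sub_le _ _).trans ?_
          rw [norm_mul, norm_mul]
          gcongr
      _ = K₀ * (K₃ * K₂ + K₁ * K₄) / ‖μ‖ * (X * Y * Real.exp (-(μ.im * a))) := by
          field_simp
      _ = _ := by rw [hXY, mul_one]
  have := hnum.div hden hne
  rw [zero_div] at this
  refine this.congr' ?_
  filter_upwards [hden.eventually_ne hne] with μ hμ
  simp only [Pi.div_apply]
  rw [div_eq_iff hμ]
  ring

include hT hp' hq hr' hs hw in
-- The cross product is entire of exponential type and tends to `0` as `Im μ → ±∞`, the lower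
-- direction by the reflection `(μ, p) ↦ (-μ, -p)`.
theorem cauchyKernel_cross_eq_zero {H : ℂ} (hH : ∫ t in {⟨0, le_rfl, hT.le⟩}, w t ∂ν = H)
    (hH0 : H ≠ 0) {a : ℝ} (ha : a ∈ Ioc 0 T)
    (h : ∀ μ, cauchyTransform T p q ν w a μ a = cauchyTransform T r s ν w a μ a ∧
      cauchyTransformDeriv T p q ν w a μ a = cauchyTransformDeriv T r s ν w a μ a) {x : ℝ}
    (hx : x ∈ Icc (a / 2) a) (μ : ℂ) :
    cauchyKernelDeriv T p q μ x a * cauchyKernel T r s μ x a -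
      cauchyKernel T p q μ x a * cauchyKernelDeriv T r s μ x a = 0 := by
  have hpi : IntervalIntegrable p volume 0 T := hp'.ac.continuousOn.intervalIntegrable
  have hri : IntervalIntegrable r volume 0 T := hr'.ac.continuousOn.intervalIntegrable
  have ha' := Ioc_subset_Icc_self ha
  have hx0 : x ∈ Icc 0 T := ⟨by linarith [hx.1, ha.1], hx.2.trans ha.2⟩
  have d₁ := differentiable_cauchyKernel hT hpi hq hx0 ha'
  have d₂ := differentiable_cauchyKernel hT hri hs hx0 ha'
  have hF := (d₁.2.mul d₂.1).sub (d₁.1.mul d₂.2)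
  refine IsExpType.eq_of_tendsto hF ?_
    (tendsto_cauchyKernel_cross hT hp' hq hr' hs hw hH hH0 ha h hx) (L' := 0) ?_ μ
  · obtain ⟨K₁, hK₁, b₁⟩ := exists_cauchyKernel_bound hT hp' hq
    obtain ⟨K₂, hK₂, b₂⟩ := exists_cauchyKernel_bound hT hr' hs
    have hKK : K₁ ≤ 2 * K₁ * K₂ := by nlinarith
    have hKK' : K₂ ≤ 2 * K₁ * K₂ := by nlinarith
    refine .of_norm_le_exp_im hF.continuous (K := 2 * K₁ * K₂) (B := 2 * (a - x))
      (by positivity) (by linarith [hx.2]) fun μ hμ => ?_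
    have m₁ := hKK.trans hμ
    have m₂ := hKK'.trans hμ
    have hμ1 : 1 ≤ ‖μ‖ := hK₁.trans m₁
    obtain ⟨g₁, f₁⟩ := b₁ μ m₁ x hx0 a ⟨hx.2, ha.2⟩
    obtain ⟨g₂, f₂⟩ := b₂ μ m₂ x hx0 a ⟨hx.2, ha.2⟩
    replace g₁ := g₁.trans (div_le_self (by positivity) hμ1)
    replace g₂ := g₂.trans (div_le_self (by positivity) hμ1)
    refine (norm_sub_le _ _).trans ?_
    simp only [Pi.mul_apply, norm_mul]
    have hee : Real.exp (|μ.im| * (2 * (a - x))) =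
        Real.exp (|μ.im| * (a - x)) * Real.exp (|μ.im| * (a - x)) := by
      rw [← Real.exp_add]; congr 1; ring
    rw [hee]
    set Y := Real.exp (|μ.im| * (a - x))
    calc _ ≤ K₁ * Y * (K₂ * Y) + K₁ * Y * (K₂ * Y) := by gcongr
      _ = _ := by ring
  · have h' : ∀ μ, cauchyTransform T (fun x => -p x) q ν w a μ a =
          cauchyTransform T (fun x => -r x) s ν w a μ a ∧
        cauchyTransformDeriv T (fun x => -p x) q ν w a μ a =
          cauchyTransformDeriv T (fun x => -r x) s ν w a μ a := by
      intro μ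
      rw [← neg_neg μ, (cauchyTransform_neg _ _ _ _ _ _ _ _).1,
        (cauchyTransform_neg _ _ _ _ _ _ _ _).1, (cauchyTransform_neg _ _ _ _ _ _ _ _).2,
        (cauchyTransform_neg _ _ _ _ _ _ _ _).2]
      exact h (-μ)
    refine ((tendsto_cauchyKernel_cross hT hp'.neg hq hr'.neg hs hw hH hH0 ha h' hx).comp
      tendsto_neg_comap_im_atBot).congr fun μ => ?_
    simp only [Function.comp_apply, cauchyKernel, cauchyKernelDeriv, initialSolution_neg,
      Pi.mul_apply, Pi.sub_apply]

end Halving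

/-- The cross relation makes `(y, z)` a multiple `k` of `(c, d)`, and the unit Wronskians give `k² =
1`. By continuity and `k(a) = 1` the solutions coincide, and so do the coefficients in their
equations, since `c` and `d` have no common zero. -/
theorem PencilSolution.pencilCoeff_ae_eq {T : ℝ} (hT : 0 < T) {p q r s : ℝ → ℂ}
    (hp : IntervalIntegrable p volume 0 T) (hq : IntervalIntegrable q volume 0 T)
    (hr : IntervalIntegrable r volume 0 T) (hs : IntervalIntegrable s volume 0 T) {μ : ℂ}
    {c c' d d' y y' z z' : ℝ → ℂ} (hc : PencilSolution T p q μ c c')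
    (hd : PencilSolution T p q μ d d') (hy : PencilSolution T r s μ y y')
    (hz : PencilSolution T r s μ z z') {b a : ℝ} (hb : 0 ≤ b) (hba : b < a) (ha : a ≤ T)
    (hca : c a = 1) (hca' : c' a = 0) (hda : d a = 0) (hda' : d' a = 1)
    (hya : y a = 1) (hya' : y' a = 0) (hza : z a = 0) (hza' : z' a = 1)
    (hcross : ∀ x ∈ Icc b a, c x * z x = d x * y x) :
    ∀ᵐ x ∂(volume.restrict (Ioo b a)), pencilCoeff p q μ x = pencilCoeff r s μ x := by
  have hsub : Icc b a ⊆ Icc 0 T := Icc_subset_Icc hb ha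
  have ham : a ∈ Icc b a := ⟨hba.le, le_rfl⟩
  have hw : ∀ x ∈ Icc b a, c x * d' x - c' x * d x = 1 := fun x hx => by
    rw [hc.wronskian_eq_self hT hp hq hd (hsub hx) (hsub ham), hca, hca', hda, hda']; ring
  have hw' : ∀ x ∈ Icc b a, y x * z' x - y' x * z x = 1 := fun x hx => by
    rw [hy.wronskian_eq_self hT hr hs hz (hsub hx) (hsub ham), hya, hya', hza, hza']; ring
  have der : ∀ {p q : ℝ → ℂ} {f f' : ℝ → ℂ}, PencilSolution T p q μ f f' → ∀ x ∈ Icc b a,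
      HasDerivWithinAt f (f' x) (Icc b a) x := fun h x hx => (h.hasDeriv x (hsub hx)).mono hsub
  have huniq := uniqueDiffOn_Icc hba
  have hcross' : ∀ x ∈ Icc b a, c' x * z x + c x * z' x = d' x * y x + d x * y' x := fun x hx =>
    (huniq x hx).eq_deriv _ ((der hc x hx).mul (der hz x hx))
      ((((der hd x hx).mul (der hy x hx))).congr hcross (hcross x hx))
  set k : ℝ → ℂ := fun x => y x * d' x - z x * c' x with hk
  have hkc : ContinuousOn k (Icc b a) :=
    ((hy.continuousOn.mul (hd.continuousOn_deriv hT)).sub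
      (hz.continuousOn.mul (hc.continuousOn_deriv hT))).mono hsub
  have hk1 : EqOn k 1 (Icc b a) := by
    refine isPreconnected_Icc.eq_of_sq_eq hkc continuousOn_const ?_
      (fun _ => one_ne_zero) ham ?_
    · intro x hx
      have e1 : y x = c x * k x := by
        simp only [hk]
        linear_combination (-y x) * hw x hx + (c' x) * hcross x hx
      have e2 : z x = d x * k x := by
        simp only [hk]
        linear_combination (-z x) * hw x hx + (d' x) * hcross x hx
      have e3 : c x * z' x - d x * y' x = k x := by
        simp only [hk]
        linear_combination hcross' x hx
      -- The differentiated cross relation gives `c z' - d y' = k`, so `1 = y z' - y' z = k (c z' -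
      -- d y') = k²` without differentiating `k`.
      have : k x ^ 2 = 1 := by
        linear_combination hw' x hx - z' x * e1 + y' x * e2 - k x * e3
      simpa using this
    · simp [hk, hya, hda', hza]
  have ey : EqOn y c (Icc b a) := fun x hx => by
    have : y x * d' x - z x * c' x = 1 := hk1 hx
    linear_combination (-y x) * hw x hx + (c' x) * hcross x hx + c x * this
  have ez : EqOn z d (Icc b a) := fun x hx => by
    have : y x * d' x - z x * c' x = 1 := hk1 hx
    linear_combination (-z x) * hw x hx + (d' x) * hcross x hx + d x * this
  have ey' : EqOn y' c' (Icc b a) := fun x hx =>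
    (huniq x hx).eq_deriv _ (der hy x hx) ((der hc x hx).congr ey (ey hx))
  have ez' : EqOn z' d' (Icc b a) := fun x hx =>
    (huniq x hx).eq_deriv _ (der hz x hx) ((der hd x hx).congr ez (ez hx))
  have res : ∀ {A : ℝ → Prop}, (∀ᵐ x ∂(volume.restrict (Ioo 0 T)), A x) →
      ∀ᵐ x ∂(volume.restrict (Ioo b a)), A x := fun h =>
    ae_restrict_of_ae_restrict_of_subset (Ioo_subset_Ioo hb ha) h
  filter_upwards [res hc.equation, res hd.equation, res hy.equation, res hz.equation,
    ae_restrict_mem measurableSet_Ioo] with x h1 h2 h3 h4 hx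
  have hxI := Ioo_subset_Icc_self hx
  have hnhds : Icc b a ∈ 𝓝 x := Icc_mem_nhds hx.1 hx.2
  have g1 := h1.unique (h3.congr_of_eventuallyEq (ey'.symm.eventuallyEq_of_mem hnhds))
  have g2 := h2.unique (h4.congr_of_eventuallyEq (ez'.symm.eventuallyEq_of_mem hnhds))
  rw [ey hxI] at g1
  rw [ez hxI] at g2
  simp only [pencilCoeff]
  -- The difference of the coefficients annihilates both `c` and `d`; combining with `d'` and `c'`
  -- leaves it times the Wronskian `1`.
  linear_combination (-(μ ^ 2 - 2 * μ * p x - q x - (μ ^ 2 - 2 * μ * r x - s x))) * hw x hxI -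
    d' x * g1 + c' x * g2

/-! ### Recovery of the coefficients by repeated halving -/

section Inverse

variable {T : ℝ} (hT : 0 < T) {p p' q : ℝ → ℂ} (hp' : HasACDeriv T p p')
  (hq : IntervalIntegrable q volume 0 T) {r r' s : ℝ → ℂ} (hr' : HasACDeriv T r r')
  (hs : IntervalIntegrable s volume 0 T) {ν : Measure (Icc (0 : ℝ) T)}
  {w : Icc (0 : ℝ) T → ℂ} (hw : Integrable w ν)

include hT hp' hq hr' hs hw in
theorem ae_eq_half_of_cauchyTransform_eq {H : ℂ}
    (hH : ∫ t in {⟨0, le_rfl, hT.le⟩}, w t ∂ν = H) (hH0 : H ≠ 0) {a : ℝ} (ha : a ∈ Ioc 0 T)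
    (h : ∀ μ, cauchyTransform T p q ν w a μ a = cauchyTransform T r s ν w a μ a ∧
      cauchyTransformDeriv T p q ν w a μ a = cauchyTransformDeriv T r s ν w a μ a) :
    ∀ᵐ x ∂(volume.restrict (Ioo (a / 2) a)), p x = r x ∧ q x = s x := by
  have hpi : IntervalIntegrable p volume 0 T := hp'.ac.continuousOn.intervalIntegrable
  have hri : IntervalIntegrable r volume 0 T := hr'.ac.continuousOn.intervalIntegrable
  have ha' := Ioc_subset_Icc_self ha
  have key : ∀ μ, ∀ᵐ x ∂(volume.restrict (Ioo (a / 2) a)),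
      pencilCoeff p q μ x = pencilCoeff r s μ x := by
    intro μ
    refine (pencilSolution_cauchyKernelDeriv hT hpi hq μ a).pencilCoeff_ae_eq hT hpi hq hri hs
      (pencilSolution_cauchyKernel hT hpi hq μ a) (pencilSolution_cauchyKernelDeriv hT hri hs μ a)
      (pencilSolution_cauchyKernel hT hri hs μ a) (by linarith [ha.1]) (by linarith [ha.1]) ha.2
      (cauchyKernelDeriv_self hT hpi hq μ ha') (cauchyKernelDeriv₂_self μ a)
      (cauchyKernel_self μ a) (cauchyKernelDeriv_self hT hpi hq μ ha')
      (cauchyKernelDeriv_self hT hri hs μ ha') (cauchyKernelDeriv₂_self μ a)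
      (cauchyKernel_self μ a) (cauchyKernelDeriv_self hT hri hs μ ha') fun x hx => ?_
    have := cauchyKernel_cross_eq_zero hT hp' hq hr' hs hw hH hH0 ha h hx μ
    rw [cauchyKernel_swap μ a x, cauchyKernel_swap μ a x]
    linear_combination -this
  -- The coefficient at `μ = 0` is `-q`, and at `μ = 1` it then determines `p`.
  filter_upwards [key 0, key 1] with x h0 h1
  simp only [pencilCoeff] at h0 h1
  have hqs : q x = s x := by linear_combination -h0
  exact ⟨by linear_combination -h1 / 2 - hqs / 2, hqs⟩

include hT hp' hq hr' hs hw in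
theorem ae_eq_of_cauchyTransform_eq {H : ℂ}
    (hH : ∫ t in {⟨0, le_rfl, hT.le⟩}, w t ∂ν = H) (hH0 : H ≠ 0)
    (h : ∀ μ, cauchyTransform T p q ν w T μ T = cauchyTransform T r s ν w T μ T ∧
      cauchyTransformDeriv T p q ν w T μ T = cauchyTransformDeriv T r s ν w T μ T) :
    ∀ᵐ x ∂(volume.restrict (Ioo 0 T)), p x = r x ∧ q x = s x := by
  have hpi : IntervalIntegrable p volume 0 T := hp'.ac.continuousOn.intervalIntegrable
  have hri : IntervalIntegrable r volume 0 T := hr'.ac.continuousOn.intervalIntegrable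
  have step : ∀ n : ℕ, ∀ᵐ x ∂(volume.restrict (Ioo (T / 2 ^ n) T)), p x = r x ∧ q x = s x := by
    intro n
    induction n with
    | zero => simp
    | succ n ih =>
      set a := T / 2 ^ n with hadef
      have ha : a ∈ Ioc 0 T := ⟨by positivity, div_le_self hT.le (one_le_pow₀ one_le_two)⟩
      have hhalf : T / 2 ^ (n + 1) = a / 2 := by rw [hadef, pow_succ, div_div]
      -- The induction hypothesis on `(a, T)` transfers the equality of the data at `T` to `a`,
      -- where the halving applies.
      have hstep := ae_eq_half_of_cauchyTransform_eq hT hp' hq hr' hs hw hH hH0 ha fun μ =>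
        cauchyTransform_eq_of_ae_eq hT hpi hq hri hs hw (h μ).1 (h μ).2
          (Ioc_subset_Icc_self ha) (ih.mono fun _ h => h.1) (ih.mono fun _ h => h.2)
      rw [hhalf]
      have hcover : Ioo (a / 2) T ⊆ (Ioo (a / 2) a ∪ Ioo a T) ∪ {a} := by
        intro x hx
        rcases lt_trichotomy x a with hxa | hxa | hxa
        · exact .inl (.inl ⟨hx.1, hxa⟩)
        · exact .inr hxa
        · exact .inl (.inr ⟨hxa, hx.2⟩)
      refine ae_restrict_of_ae_restrict_of_subset hcover ?_
      rw [ae_restrict_union_iff, ae_restrict_union_iff]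
      refine ⟨⟨hstep, ih⟩, ?_⟩
      rw [Measure.restrict_eq_zero.2 (by simp)]
      simp
  have hcover : Ioo 0 T ⊆ ⋃ n : ℕ, Ioo (T / 2 ^ n) T := by
    intro x hx
    obtain ⟨n, hn⟩ := pow_unbounded_of_one_lt (T / x) one_lt_two
    refine mem_iUnion.2 ⟨n, ?_, hx.2⟩
    rw [div_lt_iff₀ (by positivity), mul_comm]
    rwa [div_lt_iff₀ hx.1] at hn
  exact ae_restrict_of_ae_restrict_of_subset hcover ((ae_restrict_iUnion_iff _ _).2 step)

end Inverse

theorem theorem2 (T : ℝ) (hT : 0 < T)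
    -- the function of bounded variation that defines the nonlocal condition
    (σ₁ : ℝ → ℂ) (hσ₁ : BoundedVariationOn σ₁ (Icc 0 T))
    (hσ₁_right : ∀ t ∈ Ioo 0 T, ContinuousWithinAt σ₁ (Ioi t) t)
    (H₁ : ℂ) (hH₁_lim : Tendsto (fun t => σ₁ t - σ₁ 0) (𝓝[>] 0) (𝓝 H₁)) (hH₁ : H₁ ≠ 0)
    -- the two pairs of coefficients
    (p₁ q₁ p₂ q₂ : ℝ → ℂ)
    (hp₁ : AbsolutelyContinuousOnInterval p₁ 0 T) (hq₁ : IntegrableOn q₁ (Ioo 0 T) volume)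
    (hp₂ : AbsolutelyContinuousOnInterval p₂ 0 T) (hq₂ : IntegrableOn q₂ (Ioo 0 T) volume)
    (hint : ∫ x in (0 : ℝ)..T, p₁ x = ∫ x in (0 : ℝ)..T, p₂ x)
    -- equal spectra of the problems with `U₁(y) = 0`, `y(T) = 0`
    (hspec₁ : ∀ μ : ℂ,
      spectrumMultiplicity T p₁ q₁ (stieltjesForm hσ₁) (fun Y => Y.1 T) μ =
        spectrumMultiplicity T p₂ q₂ (stieltjesForm hσ₁) (fun Y => Y.1 T) μ)
    -- equal spectra of the problems with `U₁(y) = 0`, `y'(T) = 0`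
    (hspec₁₁ : ∀ μ : ℂ,
      spectrumMultiplicity T p₁ q₁ (stieltjesForm hσ₁) (fun Y => Y.2 T) μ =
        spectrumMultiplicity T p₂ q₂ (stieltjesForm hσ₁) (fun Y => Y.2 T) μ) :
    (∀ x ∈ Ioo 0 T, p₁ x = p₂ x) ∧ q₁ =ᵐ[volume.restrict (Ioo 0 T)] q₂ := by
  obtain ⟨ν, _, w, hw, hU, hH⟩ := exists_density_stieltjesForm hT hσ₁ hH₁_lim
  obtain ⟨p₁', hp₁'⟩ := hp₁.exists_hasACDeriv hT
  obtain ⟨p₂', hp₂'⟩ := hp₂.exists_hasACDeriv hT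
  have hpi₁ : IntervalIntegrable p₁ volume 0 T := hp₁.continuousOn.intervalIntegrable
  have hpi₂ : IntervalIntegrable p₂ volume 0 T := hp₂.continuousOn.intervalIntegrable
  have hqi₁ : IntervalIntegrable q₁ volume 0 T :=
    (intervalIntegrable_iff_integrableOn_Ioo_of_le hT.le).2 hq₁
  have hqi₂ : IntervalIntegrable q₂ volume 0 T :=
    (intervalIntegrable_iff_integrableOn_Ioo_of_le hT.le).2 hq₂
  have m₁ := spectrumMultiplicity_eq_analyticOrderAt_cauchyTransform hT hpi₁ hqi₁ hw hU
  have m₂ := spectrumMultiplicity_eq_analyticOrderAt_cauchyTransform hT hpi₂ hqi₂ hw hU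
  have key := ae_eq_of_cauchyTransform_eq hT hp₁' hqi₁ hp₂' hqi₂ hw hH hH₁
    (cauchyTransform_eq_of_analyticOrderAt_eq hT hp₁' hqi₁ hw hp₂' hqi₂ hH hH₁
      ⟨hT, le_rfl⟩ hint
      (fun μ => by rw [← (m₁ μ).1, ← (m₂ μ).1, hspec₁])
      (fun μ => by rw [← (m₁ μ).2, ← (m₂ μ).2, hspec₁₁]))
  -- Continuity of `p₁` and `p₂` turns equality almost everywhere on the open interval into equality
  -- at every point.
  refine ⟨Measure.eqOn_open_of_ae_eq (key.mono fun _ h => h.1) isOpen_Ioo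
    ((hp₁'.continuousOn hT).mono Ioo_subset_Icc_self)
    ((hp₂'.continuousOn hT).mono Ioo_subset_Icc_self), key.mono fun _ h => h.2⟩
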